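/- Let $M$ be a smooth manifold (finite-dimensional, Hausdorff, second countable, without boundary), let $H$ be a closed $3$-form on $M$, and let $\nabla$ be any smooth connection on $T^*M$, with curvature $\omega(X,Y)=[\nabla_X,\nabla_Y]-\nabla_{[X,Y]}$. Then $(T^*M\xrightarrow{\mathrm{Id}}T^*M,\nabla,\omega)$ is the coadjoint representation up to homotopy of the Lie algebroid $TM$. Graded manifolds over $M$ are given by their sheaves of functions. The graded manifold $T^*[2]T[1]M$ has as functions over a coordinate domain $U$ the free graded-commutative $\Omega(U)$-algebra on the module of derivations of $\Omega(U)$ with degrees raised by $2$: it is generated over the forms by the contractions $i_X$ (degree $1$) and the Lie derivatives $L_X$ (degree $2$), which are additive in $X$ and satisfy $i_{fX}=f\,i_X$ and $L_{fX}=f\,L_X+df\,i_X$. The exact Courant algebroid with Ševera class $[H]\in H^3(M,\mathbb R)$ is the NQ-manifold $(T^*[2]T[1]M,Q_H)$, where $Q_H$ is the degree $1$ derivation with $$Q_H f=df,\qquad Q_H\alpha=d\alpha,\qquad Q_H(i_X)=L_X-i_XH,\qquad Q_H(L_X)=L_XH .$$ (In coordinates $q^i$, $\xi^i=dq^i$,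 $\theta_i=i_{\partial_i}$, $p_i=L_{\partial_i}$ with $H=\frac16\phi_{ijk}\xi^i\xi^j\xi^k$, $Q_H$ is the Hamiltonian vector field $\xi^i\frac{\partial}{\partial q^i}+p_i\frac{\partial}{\partial\theta_i}+\frac16\frac{\partial\phi_{ijk}}{\partial q^l}\xi^i\xi^j\xi^k\frac{\partial}{\partial p_l}-\frac12\phi_{ijk}\xi^i\xi^j\frac{\partial}{\partial\theta_k}$ of $\xi^ip_i-\frac16\phi_{ijk}\xi^i\xi^j\xi^k$.) Put $$c_2(X,Y)=i_{X\wedge Y}H=H(X,Y,\cdot),\qquad c_3(X,Y,Z)=d_\nabla c_2(X,Y,Z)=\nabla_Xc_2(Y,Z)-c_2([X,Y],Z)+\text{c.p.}$$ **Proposition.** 1. $(c_2,c_3)$ is a $2$-cocycle of $TM$ with values in $(T^*M\xrightarrow{\mathrm{Id}}T^*M,\nabla,\omega)$, i.e. $d_\nabla c_2-c_3=0$ and $d_\nabla c_3-\omega\circ c_2=0$. 2. $Q_H$ exists, is uniquely determined, and satisfies $Q_H^2=0$. 3. Consider the extension of $TM$ by $(T^*M\xrightarrow{\mathrm{Id}}T^*M,\nabla,\omega)$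 defined by $(c_2,c_3)$: the graded vector bundle with $TM\oplus T^*M$ in degree $0$ and $T^*M$ in degree $-1$, with anchor $\rho(X+\xi)=X$ and brackets $$l_1(m)=m,\qquad l_2(X+\xi,Y+\eta)=[X,Y]+\nabla_X\eta-\nabla_Y\xi+c_2(X,Y),\qquad l_2(X+\xi,m)=\nabla_Xm,$$ $$l_3(X+\xi,Y+\eta,Z+\gamma)=c_3(X,Y,Z)+\omega(X,Y)(\gamma)+\omega(Y,Z)(\xi)+\omega(Z,X)(\eta).$$ It is a split Lie $2$-algebroid: on its function algebra $\Gamma(\Lambda(TM\oplus T^*M)^*)\otimes\Gamma(S(T^*M)^*)$ (generators of degrees $1$ and $2$) there is exactly one degree $1$ derivation $Q$ with $Q^2=0$, $Qf=\rho^*df$ and, for sections $\zeta_0$ of $(TM\oplus T^*M)^*$, $\zeta_1$ of $(T^*M)^*$, $x_0,y_0,z_0$ of $TM\oplus T^*M$ and $x_1$ of $T^*M$, $$(Q\zeta_0)(x_0\wedge y_0+x_1)=\rho(x_0)\langle\zeta_0,y_0\rangle-\rho(y_0)\langle\zeta_0,x_0\rangle-\langle\zeta_0,l_2(x_0,y_0)\rangle+\langle\zeta_0,l_1(x_1)\rangle,$$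 $$(Q\zeta_1)(x_0\wedge y_0\wedge z_0)=\langle\zeta_1,l_3(x_0,y_0,z_0)\rangle,\qquad (Q\zeta_1)(x_0\otimes x_1)=\rho(x_0)\langle\zeta_1,x_1\rangle-\langle\zeta_1,l_2(x_0,x_1)\rangle,$$ and $Q\zeta_0$, $Q\zeta_1$ have no components other than those displayed. 4. The exact Courant algebroid $(T^*[2]T[1]M,Q_H)$ is isomorphic to this extension as an NQ-manifold: there is an isomorphism of the sheaves of graded algebras of functions which intertwines $Q_H$ and $Q$, and which can be chosen to be the identity on $C^\infty(M)$ and on differential forms (i.e. over $\mathrm{id}_M$ and compatible with the projections to $T[1]M$). -/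

import Mathlib

open Set TopologicalSpace
open scoped Manifold ContDiff Bundle

noncomputable section

namespace CourantExt

/-! ### Vector fields, forms, connections

`M` is a smooth manifold modelled on the finite-dimensional real vector space `E`.  Vector fields
and `1`-forms are fields of tangent vectors, resp. covectors; the structures below record smoothness
on an open set `U`, and only the values on `U` ever matter. -/

variable (E : Type*) [NormedAddCommGroup E] [NormedSpace ℝ E]
variable {M : Type*} [TopologicalSpace M] [ChartedSpace E M] [IsManifold 𝓘(ℝ, E) ∞ M]

/-- Fields of tangent vectors. -/
abbrev VF (M : Type*) [TopologicalSpace M] [ChartedSpace E M] : Type _ :=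
  Π x : M, TangentSpace 𝓘(ℝ, E) x

/-- Fields of covectors. -/
abbrev CF (M : Type*) [TopologicalSpace M] [ChartedSpace E M] : Type _ :=
  Π x : M, TangentSpace 𝓘(ℝ, E) x →L[ℝ] ℝ

/-- Smooth functions on the open set `U`. -/
structure SmoothFn (U : Opens M) where
  val : M → ℝ
  smooth : ContMDiffOn 𝓘(ℝ, E) 𝓘(ℝ, ℝ) ∞ val U

/-- Smooth vector fields on the open set `U`, that is, sections of `TM` over `U`. -/
structure VecField (U : Opens M) where
  val : VF E M
  smooth : ContMDiffOn 𝓘(ℝ, E) (𝓘(ℝ, E).prod 𝓘(ℝ, E)) ∞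
    (fun x => (Bundle.TotalSpace.mk' E x (val x) : TangentBundle 𝓘(ℝ, E) M)) U

/-- Smooth `1`-forms on the open set `U`, that is, sections of `T^*M` over `U`. -/
structure OneForm (U : Opens M) where
  val : CF E M
  smooth : ContMDiffOn 𝓘(ℝ, E) (𝓘(ℝ, E).prod 𝓘(ℝ, E →L[ℝ] ℝ)) ∞
    (fun x => Bundle.TotalSpace.mk' (E →L[ℝ] ℝ)
      (E := fun x : M => TangentSpace 𝓘(ℝ, E) x →L[ℝ] ℝ) x (val x)) U

variable {E}

/-- The function `X(f)`. -/
def der (X : VF E M) (f : M → ℝ) : M → ℝ :=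
  fun x => mvfderiv 𝓘(ℝ, E) f x (X x)

/-- The Lie bracket of vector fields. -/
def bra (X Y : VF E M) : VF E M := VectorField.mlieBracket 𝓘(ℝ, E) X Y

variable (E M) in
/-- Smooth `3`-forms on `M`: fields of alternating trilinear forms on the tangent spaces such that
`H(X,Y,·)` is a smooth `1`-form for all smooth local vector fields `X`, `Y`. -/
structure ThreeForm where
  val : Π x : M, TangentSpace 𝓘(ℝ, E) x →L[ℝ] TangentSpace 𝓘(ℝ, E) x →L[ℝ]
    TangentSpace 𝓘(ℝ, E) x →L[ℝ] ℝ
  smooth : ∀ (U : Opens M) (X Y : VecField E U),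
    ContMDiffOn 𝓘(ℝ, E) (𝓘(ℝ, E).prod 𝓘(ℝ, E →L[ℝ] ℝ)) ∞
      (fun x => Bundle.TotalSpace.mk' (E →L[ℝ] ℝ)
        (E := fun x : M => TangentSpace 𝓘(ℝ, E) x →L[ℝ] ℝ) x (val x (X.val x) (Y.val x))) U
  alt_left : ∀ x v w, val x v v w = 0
  alt_right : ∀ x v w, val x v w w = 0

/-- The function `H(X,Y,Z)`. -/
def ThreeForm.app (H : ThreeForm E M) (X Y Z : VF E M) : M → ℝ :=
  fun x => H.val x (X x) (Y x) (Z x)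

/-- `dH = 0`. -/
def ThreeForm.Closed (H : ThreeForm E M) : Prop :=
  ∀ (U : Opens M) (X Y Z W : VecField E U), ∀ x ∈ U,
    der X.val (H.app Y.val Z.val W.val) x - der Y.val (H.app X.val Z.val W.val) x
      + der Z.val (H.app X.val Y.val W.val) x - der W.val (H.app X.val Y.val Z.val) x
      - H.app (bra X.val Y.val) Z.val W.val x + H.app (bra X.val Z.val) Y.val W.val x
      - H.app (bra X.val W.val) Y.val Z.val x - H.app (bra Y.val Z.val) X.val W.val x
      + H.app (bra Y.val W.val) X.val Z.val x - H.app (bra Z.val W.val) X.val Y.val x = 0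

variable (E M) in
/-- Connections on `T^*M`. -/
abbrev Connection : Type _ :=
  CovariantDerivative 𝓘(ℝ, E) (E →L[ℝ] ℝ) (fun x : M => TangentSpace 𝓘(ℝ, E) x →L[ℝ] ℝ)

/-- `∇_X η`. -/
def nabla (D : Connection E M) (X : VF E M) (η : CF E M) : CF E M :=
  fun x => D η x (X x)

/-- The curvature `[∇_X, ∇_Y] η - ∇_{[X,Y]} η`. -/
def curv (D : Connection E M) (X Y : VF E M) (η : CF E M) : CF E M :=
  nabla D X (nabla D Y η) - nabla D Y (nabla D X η) - nabla D (bra X Y) η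

/-- `d_∇ c` for a `T^*M`-valued `2`-form `c`. -/
def dNablaTwo (D : Connection E M) (c : VF E M → VF E M → CF E M) (X Y Z : VF E M) : CF E M :=
  nabla D X (c Y Z) + nabla D Y (c Z X) + nabla D Z (c X Y)
    - (c (bra X Y) Z + c (bra Y Z) X + c (bra Z X) Y)

/-- `d_∇ c` for a `T^*M`-valued `3`-form `c`. -/
def dNablaThree (D : Connection E M) (c : VF E M → VF E M → VF E M → CF E M)
    (X Y Z W : VF E M) : CF E M :=
  nabla D X (c Y Z W) - nabla D Y (c X Z W) + nabla D Z (c X Y W) - nabla D W (c X Y Z)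
    - c (bra X Y) Z W + c (bra X Z) Y W - c (bra X W) Y Z
    - c (bra Y Z) X W + c (bra Y W) X Z - c (bra Z W) X Y

/-- `R ∘ c` for an `End(T^*M)`-valued `2`-form `R` and a `T^*M`-valued `2`-form `c`: the sum over
the `(2,2)`-unshuffles. -/
def compTwo (R : VF E M → VF E M → CF E M → CF E M) (c : VF E M → VF E M → CF E M)
    (X Y Z W : VF E M) : CF E M :=
  R X Y (c Z W) - R X Z (c Y W) + R X W (c Y Z)
    + R Y Z (c X W) - R Y W (c X Z) + R Z W (c X Y)

/-- `(c₂, c₃)` is a `2`-cocycle of `TM` with values in the representation up to homotopy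
`(Id : T^*M → T^*M, ∇, ω)`, where `ω` is the curvature of `∇`:
`d_∇ c₂ - ∂ ∘ c₃ = 0` with `∂ = Id`, and `d_∇ c₃ - ω ∘ c₂ = 0`. -/
def IsTwoCocycle (D : Connection E M) (c₂ : VF E M → VF E M → CF E M)
    (c₃ : VF E M → VF E M → VF E M → CF E M) : Prop :=
  ∀ U : Opens M,
    (∀ X Y Z : VecField E U, ∀ x ∈ U,
      dNablaTwo D c₂ X.val Y.val Z.val x - c₃ X.val Y.val Z.val x = 0) ∧
    (∀ X Y Z W : VecField E U, ∀ x ∈ U,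
      dNablaThree D c₃ X.val Y.val Z.val W.val x
        - compTwo (curv D) c₂ X.val Y.val Z.val W.val x = 0)

/-- `c₂(X,Y) = i_{X ∧ Y} H = H(X,Y,·)`. -/
def cTwo (H : ThreeForm E M) (X Y : VF E M) : CF E M :=
  fun x => H.val x (X x) (Y x)

/-- `c₃ = d_∇ c₂`. -/
def cThree (D : Connection E M) (H : ThreeForm E M) (X Y Z : VF E M) : CF E M :=
  dNablaTwo D (cTwo H) X Y Z

/-! ### Graded manifolds

A nonnegatively graded manifold over `M` is a sheaf of graded-commutative algebras on `M`, locally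
freely generated over the smooth functions by coordinates of positive degree.  A sheaf is determined
by its restriction to a basis of open sets, and so are morphisms of sheaves; the structure sheaves
are given on the basis of all open sets that lie in the domain of a chart.  Both graded manifolds
needed have, over such an open set `U`, local coordinates of degrees `0`, `1`, `1`, `2`, and their
function algebras are presented by generators and relations, the generators being the functions and
`1`-forms on `U`, a degree `1` generator for each vector field on `U` and a degree `2` generator for
each vector field on `U`. -/

/-- Generators of the function algebras over `U`. -/
inductive Gen (U : Opens M) : Type _
  | fn (f : SmoothFn E U)
  | form (α : OneForm E U)
  | vec (X : VecField E U)
  | mom (X : VecField E U)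

/-- Degrees of the generators. -/
def Gen.deg {U : Opens M} : Gen (E := E) U → ℕ
  | .fn _ => 0
  | .form _ => 1
  | .vec _ => 1
  | .mom _ => 2

def SmoothFn.res {U V : Opens M} (h : V ≤ U) (f : SmoothFn E U) : SmoothFn E V :=
  ⟨f.val, f.smooth.mono h⟩

def OneForm.res {U V : Opens M} (h : V ≤ U) (α : OneForm E U) : OneForm E V :=
  ⟨α.val, α.smooth.mono h⟩

def VecField.res {U V : Opens M} (h : V ≤ U) (X : VecField E U) : VecField E V :=
  ⟨X.val, X.smooth.mono h⟩

def Gen.res {U V : Opens M} (h : V ≤ U) : Gen (E := E) U → Gen (E := E) V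
  | .fn f => .fn (f.res h)
  | .form α => .form (α.res h)
  | .vec X => .vec (X.res h)
  | .mom X => .mom (X.res h)

theorem Gen.deg_res {U V : Opens M} (h : V ≤ U) (a : Gen (E := E) U) :
    (a.res h).deg = a.deg := by
  cases a <;> rfl

/-- The free algebra on the generators. -/
abbrev FreeFn (U : Opens M) : Type _ := FreeAlgebra ℝ (Gen (E := E) U)

abbrev Gen.free {U : Opens M} (a : Gen (E := E) U) : FreeFn (E := E) U := FreeAlgebra.ι ℝ a

def freeRes {U V : Opens M} (h : V ≤ U) : FreeFn (E := E) U →ₐ[ℝ] FreeFn (E := E) V :=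
  FreeAlgebra.lift ℝ fun a => (a.res h).free

/-- `α = df` on `U`. -/
def IsDiff {U : Opens M} (f : SmoothFn E U) (α : OneForm E U) : Prop :=
  ∀ x ∈ U, α.val x = mvfderiv 𝓘(ℝ, E) f.val x

open Gen in
/-- Relations common to both graded manifolds: the functions form the algebra `C^∞(U)`; the
generators `form` and `vec` depend `C^∞(U)`-linearly on their arguments (in particular, only on
values on `U`); all generators commute in the graded sense. -/
inductive CommonRel (U : Opens M) : FreeFn (E := E) U → FreeFn (E := E) U → Prop
  | fn_const (c : ℝ) (f : SmoothFn E U) (h : ∀ x ∈ U, f.val x = c) :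
      CommonRel U (fn f).free (algebraMap ℝ _ c)
  | fn_add (f g k : SmoothFn E U) (h : ∀ x ∈ U, k.val x = f.val x + g.val x) :
      CommonRel U (fn k).free ((fn f).free + (fn g).free)
  | fn_mul (f g k : SmoothFn E U) (h : ∀ x ∈ U, k.val x = f.val x * g.val x) :
      CommonRel U (fn k).free ((fn f).free * (fn g).free)
  | form_linear (f g : SmoothFn E U) (α β γ : OneForm E U)
      (h : ∀ x ∈ U, γ.val x = f.val x • α.val x + g.val x • β.val x) :
      CommonRel U (form γ).free ((fn f).free * (form α).free + (fn g).free * (form β).free)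
  | vec_linear (f g : SmoothFn E U) (X Y Z : VecField E U)
      (h : ∀ x ∈ U, Z.val x = f.val x • X.val x + g.val x • Y.val x) :
      CommonRel U (vec Z).free ((fn f).free * (vec X).free + (fn g).free * (vec Y).free)
  | graded_comm (a b : Gen (E := E) U) :
      CommonRel U (a.free * b.free) ((-1 : ℝ) ^ (a.deg * b.deg) • (b.free * a.free))

open Gen in
/-- Relations of the function algebra of the split graded manifold `(TM ⊕ T^*M) ⊕ T^*M`, with
`TM ⊕ T^*M` in degree `0` and the second `T^*M` in degree `-1`, i.e. of the algebra
`Γ(Λ (TM ⊕ T^*M)^*) ⊗ Γ(S (T^*M)^*)`: `form` and `vec` are the sections of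
`(TM ⊕ T^*M)^* = T^*M ⊕ TM` (degree `1`) and `mom` are the sections of `(T^*M)^* = TM`
(degree `2`). -/
inductive SplitRel (U : Opens M) : FreeFn (E := E) U → FreeFn (E := E) U → Prop
  | of_common {a b : FreeFn (E := E) U} (h : CommonRel U a b) : SplitRel U a b
  | mom_linear (f g : SmoothFn E U) (X Y Z : VecField E U)
      (h : ∀ x ∈ U, Z.val x = f.val x • X.val x + g.val x • Y.val x) :
      SplitRel U (mom Z).free ((fn f).free * (mom X).free + (fn g).free * (mom Y).free)

open Gen in
/-- Relations of the function algebra of `T^*[2]T[1]M`.  The functions on `N = T[1]M` are the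
differential forms, and the functions on the shifted cotangent bundle `T^*[2]N` form the free
graded-commutative algebra over `Ω(U)` on the `Ω(U)`-module of derivations of `Ω(U)`, with degrees
raised by `2`.  This module is generated by the contractions `i_X` (here `vec X`, of degree `1`)
and the Lie derivatives `L_X` (here `mom X`, of degree `2`), with the relations
`i_{f X + g Y} = f i_X + g i_Y` and `L_{f X + g Y} = f L_X + df i_X + g L_Y + dg i_Y`.
In local coordinates `q^i` on `U`, one has the coordinates `q^i`, `ξ^i = dq^i`,
`θ_i = ∂/∂ξ^i = i_{∂_i}`, `p_i = ∂/∂q^i = L_{∂_i}`. -/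
inductive CourantRel (U : Opens M) : FreeFn (E := E) U → FreeFn (E := E) U → Prop
  | of_common {a b : FreeFn (E := E) U} (h : CommonRel U a b) : CourantRel U a b
  | mom_twisted (f g : SmoothFn E U) (df dg : OneForm E U) (X Y Z : VecField E U)
      (hf : IsDiff f df) (hg : IsDiff g dg)
      (h : ∀ x ∈ U, Z.val x = f.val x • X.val x + g.val x • Y.val x) :
      CourantRel U (mom Z).free
        ((fn f).free * (mom X).free + (form df).free * (vec X).free
          + ((fn g).free * (mom Y).free + (form dg).free * (vec Y).free))

theorem CommonRel.res {U V : Opens M} (hV : V ≤ U) {a b : FreeFn (E := E) U}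
    (h : CommonRel U a b) : CommonRel V (freeRes hV a) (freeRes hV b) := by
  cases h with
  | fn_const c f h =>
    simpa [freeRes, Gen.free, Gen.res] using
      CommonRel.fn_const c (f.res hV) (fun x hx => h x (hV hx))
  | fn_add f g k h =>
    simpa [freeRes, Gen.free, Gen.res] using
      CommonRel.fn_add (f.res hV) (g.res hV) (k.res hV) (fun x hx => h x (hV hx))
  | fn_mul f g k h =>
    simpa [freeRes, Gen.free, Gen.res] using
      CommonRel.fn_mul (f.res hV) (g.res hV) (k.res hV) (fun x hx => h x (hV hx))
  | form_linear f g α β γ h =>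
    simpa [freeRes, Gen.free, Gen.res] using
      CommonRel.form_linear (f.res hV) (g.res hV) (α.res hV) (β.res hV) (γ.res hV)
        (fun x hx => h x (hV hx))
  | vec_linear f g X Y Z h =>
    simpa [freeRes, Gen.free, Gen.res] using
      CommonRel.vec_linear (f.res hV) (g.res hV) (X.res hV) (Y.res hV) (Z.res hV)
        (fun x hx => h x (hV hx))
  | graded_comm a b =>
    simpa [freeRes, Gen.free, Gen.deg_res] using
      CommonRel.graded_comm (a.res hV) (b.res hV)

theorem SplitRel.res {U V : Opens M} (hV : V ≤ U) {a b : FreeFn (E := E) U}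
    (h : SplitRel U a b) : SplitRel V (freeRes hV a) (freeRes hV b) := by
  cases h with
  | of_common h => exact .of_common (h.res hV)
  | mom_linear f g X Y Z h =>
    simpa [freeRes, Gen.free, Gen.res] using
      SplitRel.mom_linear (f.res hV) (g.res hV) (X.res hV) (Y.res hV) (Z.res hV)
        (fun x hx => h x (hV hx))

theorem CourantRel.res {U V : Opens M} (hV : V ≤ U) {a b : FreeFn (E := E) U}
    (h : CourantRel U a b) : CourantRel V (freeRes hV a) (freeRes hV b) := by
  cases h with
  | of_common h => exact .of_common (h.res hV)
  | mom_twisted f g df dg X Y Z hf hg h =>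
    simpa [freeRes, Gen.free, Gen.res] using
      CourantRel.mom_twisted (f.res hV) (g.res hV) (df.res hV) (dg.res hV)
        (X.res hV) (Y.res hV) (Z.res hV) (fun x hx => hf x (hV hx)) (fun x hx => hg x (hV hx))
        (fun x hx => h x (hV hx))

variable (E M) in
/-- The basis of open sets of `M` that lie in the domain of a chart. -/
structure CoordDomain where
  carrier : Opens M
  exists_chart : ∃ φ ∈ atlas E M, (carrier : Set M) ⊆ φ.source

variable (E M) in
/-- A graded manifold over `M` whose function algebras are presented by relations between the
generators above, compatible with restriction. -/
structure GradedManifold where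
  rel : ∀ U : Opens M, FreeFn (E := E) U → FreeFn (E := E) U → Prop
  rel_res : ∀ {U V : Opens M} (h : V ≤ U) {a b : FreeFn (E := E) U},
    rel U a b → rel V (freeRes h a) (freeRes h b)

variable (E M) in
/-- The split graded manifold `(TM ⊕ T^*M) ⊕ T^*M`. -/
def splitManifold : GradedManifold E M := ⟨SplitRel, SplitRel.res⟩

variable (E M) in
/-- The graded manifold `T^*[2]T[1]M`. -/
def courantManifold : GradedManifold E M := ⟨CourantRel, CourantRel.res⟩

namespace GradedManifold

variable (𝓜 𝓝 : GradedManifold E M)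

/-- The algebra of functions over `U`. -/
abbrev Fn (U : CoordDomain E M) : Type _ := RingQuot (𝓜.rel U.carrier)

/-- Generators as functions. -/
def gen (U : CoordDomain E M) (a : Gen (E := E) U.carrier) : 𝓜.Fn U :=
  RingQuot.mkAlgHom ℝ (𝓜.rel U.carrier) a.free

/-- The functions of degree `k` over `U`: the span of the products of generators whose degrees add
up to `k`. -/
def homogeneous (U : CoordDomain E M) (k : ℕ) : Submodule ℝ (𝓜.Fn U) :=
  Submodule.span ℝ {w | ∃ l : List (Gen (E := E) U.carrier),
    (l.map Gen.deg).sum = k ∧ (l.map (𝓜.gen U)).prod = w}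

/-- Restriction of functions from `U` to `V ⊆ U`. -/
def res {U V : CoordDomain E M} (h : V.carrier ≤ U.carrier) : 𝓜.Fn U →ₐ[ℝ] 𝓜.Fn V :=
  RingQuot.liftAlgHom ℝ ⟨(RingQuot.mkAlgHom ℝ (𝓜.rel V.carrier)).comp (freeRes h),
    fun _ _ hab => RingQuot.mkAlgHom_rel ℝ (𝓜.rel_res h hab)⟩

theorem res_gen {U V : CoordDomain E M} (h : V.carrier ≤ U.carrier)
    (a : Gen (E := E) U.carrier) : 𝓜.res h (𝓜.gen U a) = 𝓜.gen V (a.res h) := by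
  simp [res, gen, freeRes, Gen.free]

/-- A homological vector field `Q` on a graded manifold: a graded derivation of degree `1` of the
sheaf of functions with `Q² = 0`. -/
@[ext]
structure HomologicalField where
  Q : ∀ U : CoordDomain E M, 𝓜.Fn U →ₗ[ℝ] 𝓜.Fn U
  degree_one : ∀ U k, ∀ a ∈ 𝓜.homogeneous U k, Q U a ∈ 𝓜.homogeneous U (k + 1)
  leibniz : ∀ U k, ∀ a ∈ 𝓜.homogeneous U k, ∀ b,
    Q U (a * b) = Q U a * b + (-1 : ℝ) ^ k • (a * Q U b)
  square_zero : ∀ U a, Q U (Q U a) = 0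
  natural : ∀ {U V : CoordDomain E M} (h : V.carrier ≤ U.carrier) (a : 𝓜.Fn U),
    𝓜.res h (Q U a) = Q V (𝓜.res h a)

variable {𝓜 𝓝}

/-- An isomorphism of NQ-manifolds over the identity of `M`: an isomorphism of sheaves of graded
algebras that is the identity on `C^∞(M)` and intertwines the homological vector fields. -/
structure NQIso (Q : 𝓜.HomologicalField) (Q' : 𝓝.HomologicalField) where
  equiv : ∀ U : CoordDomain E M, 𝓜.Fn U ≃ₐ[ℝ] 𝓝.Fn U
  degree : ∀ U k a, a ∈ 𝓜.homogeneous U k ↔ equiv U a ∈ 𝓝.homogeneous U k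
  base : ∀ U (f : SmoothFn E U.carrier), equiv U (𝓜.gen U (.fn f)) = 𝓝.gen U (.fn f)
  natural : ∀ {U V : CoordDomain E M} (h : V.carrier ≤ U.carrier) (a : 𝓜.Fn U),
    𝓝.res h (equiv U a) = equiv V (𝓜.res h a)
  intertwines : ∀ U a, equiv U (Q.Q U a) = Q'.Q U (equiv U a)

end GradedManifold

/-! ### Homological vector fields -/

/-- `w` is the element of the `k`-th exterior power of a module of covectors whose value on
`t₁ ∧ ⋯ ∧ t_k` is `Ω(t₁, …, t_k)`.  Here `gen` embeds covectors `s` into a function algebra and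
`ev s t` is the pairing of covectors and vectors; products of covectors pair with products of
vectors by the determinant. -/
def RepresentsAlt {R S T : Type*} [Ring R] (gen : S → R) (ev : S → T → M → ℝ) (U : Opens M)
    (k : ℕ) (w : R) (Ω : (Fin k → T) → M → ℝ) : Prop :=
  ∃ (r : ℕ) (s : Fin r → Fin k → S),
    w = ∑ j, (List.ofFn fun i => gen (s j i)).prod ∧
    ∀ t : Fin k → T, ∀ x ∈ U, Ω t x = ∑ j, (Matrix.of fun i l => ev (s j i) (t l) x).det

/-- `w` is the element of the tensor product of two modules of covectors whose value on `t ⊗ t'` is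
`Ω(t, t')`. -/
def RepresentsTensor {R S S' T T' : Type*} [Ring R] (gen : S → R) (gen' : S' → R)
    (ev : S → T → M → ℝ) (ev' : S' → T' → M → ℝ) (U : Opens M)
    (w : R) (Ω : T → T' → M → ℝ) : Prop :=
  ∃ (r : ℕ) (s : Fin r → S) (s' : Fin r → S'),
    w = ∑ j, gen (s j) * gen' (s' j) ∧
    ∀ t t', ∀ x ∈ U, Ω t t' x = ∑ j, ev (s j) t x * ev' (s' j) t' x

/-- The pairing of a `1`-form and a vector field. -/
def pairForm {U : Opens M} (α : OneForm E U) (X : VecField E U) : M → ℝ :=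
  fun x => α.val x (X.val x)

/-- The pairing of a section of `TM = (T^*M)^*` and a section of `T^*M`. -/
def pairVec {U : Opens M} (X : VecField E U) (α : OneForm E U) : M → ℝ :=
  fun x => α.val x (X.val x)

open GradedManifold in
/-- `Q` is the homological vector field on `T^*[2]T[1]M` of the exact Courant algebroid defined by
the closed `3`-form `H`:
`Q f = df`, `Q α = dα`, `Q i_X = L_X - i_X H`, `Q L_X = L_X H`.
In local coordinates, with `H = (1/6) φ_{ijk} ξ^i ξ^j ξ^k`, it is the Hamiltonian vector field
`ξ^i ∂/∂q^i + p_i ∂/∂θ_i + (1/6) (∂φ_{ijk}/∂q^l) ξ^i ξ^j ξ^k ∂/∂p_l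
  - (1/2) φ_{ijk} ξ^i ξ^j ∂/∂θ_k` of `ξ^i p_i - (1/6) φ_{ijk} ξ^i ξ^j ξ^k`. -/
structure IsCourantField (H : ThreeForm E M) (Q : (courantManifold E M).HomologicalField) :
    Prop where
  on_fn : ∀ U (f : SmoothFn E U.carrier), ∃ df : OneForm E U.carrier, IsDiff f df ∧
    Q.Q U (gen _ U (.fn f)) = gen _ U (.form df)
  on_form : ∀ U (α : OneForm E U.carrier),
    RepresentsAlt (fun β => gen _ U (.form β)) pairForm U.carrier 2
      (Q.Q U (gen _ U (.form α)))
      (fun Y => der (Y 0).val (pairForm α (Y 1)) - der (Y 1).val (pairForm α (Y 0))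
        - fun x => α.val x (bra (Y 0).val (Y 1).val x))
  on_vec : ∀ U (X : VecField E U.carrier), ∃ w,
    RepresentsAlt (fun β => gen _ U (.form β)) pairForm U.carrier 2 w
      (fun Y => H.app X.val (Y 0).val (Y 1).val) ∧
    Q.Q U (gen _ U (.vec X)) = gen _ U (.mom X) - w
  on_mom : ∀ U (X : VecField E U.carrier),
    RepresentsAlt (fun β => gen _ U (.form β)) pairForm U.carrier 3
      (Q.Q U (gen _ U (.mom X)))
      (fun Y => der X.val (H.app (Y 0).val (Y 1).val (Y 2).val)
        - H.app (bra X.val (Y 0).val) (Y 1).val (Y 2).val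
        - H.app (Y 0).val (bra X.val (Y 1).val) (Y 2).val
        - H.app (Y 0).val (Y 1).val (bra X.val (Y 2).val))

/-! ### The extension of `TM` by `Id : T^*M → T^*M` -/

variable (E M) in
/-- Fields `X + ξ` with values in `TM ⊕ T^*M`. -/
abbrev DF : Type _ := VF E M × CF E M

variable (E M) in
/-- Anchor and brackets on the sections of the graded vector bundle `A₀ ⊕ A₋₁` with
`A₀ = TM ⊕ T^*M` and `A₋₁ = T^*M`. -/
structure Brackets where
  anchor : DF E M → VF E M
  l₁ : CF E M → DF E M
  l₂ : DF E M → DF E M → DF E M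
  l₂' : DF E M → CF E M → CF E M
  l₃ : DF E M → DF E M → DF E M → CF E M

/-- The extension `TM ⋉_{(c₂, c₃)} (Id : T^*M → T^*M)` for the representation up to homotopy
`(Id : T^*M → T^*M, ∇, ω)`, where `ω` is the curvature of `∇`. -/
def extensionBrackets (D : Connection E M) (c₂ : VF E M → VF E M → CF E M)
    (c₃ : VF E M → VF E M → VF E M → CF E M) : Brackets E M where
  anchor a := a.1
  l₁ m := (0, m)
  l₂ a b := (bra a.1 b.1, nabla D a.1 b.2 - nabla D b.1 a.2 + c₂ a.1 b.1)
  l₂' a m := nabla D a.1 m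
  l₃ a b c := c₃ a.1 b.1 c.1 + curv D a.1 b.1 c.2 + curv D b.1 c.1 a.2 + curv D c.1 a.1 b.2

/-- Smooth sections of `TM ⊕ T^*M` over `U`. -/
abbrev DSec (U : Opens M) : Type _ := VecField E U × OneForm E U

/-- Smooth sections of `(TM ⊕ T^*M)^* = T^*M ⊕ TM` over `U`. -/
abbrev CoSec (U : Opens M) : Type _ := OneForm E U × VecField E U

def DSec.val {U : Opens M} (a : DSec (E := E) U) : DF E M := (a.1.val, a.2.val)

/-- The pairing of a section of `(TM ⊕ T^*M)^*` and a field with values in `TM ⊕ T^*M`. -/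
def coPair {U : Opens M} (s : CoSec (E := E) U) (a : DF E M) : M → ℝ :=
  fun x => s.1.val x (a.1 x) + a.2 x (s.2.val x)

/-- Sections of `(TM ⊕ T^*M)^*` as functions of degree `1`. -/
def coGen (U : CoordDomain E M) (s : CoSec (E := E) U.carrier) : (splitManifold E M).Fn U :=
  GradedManifold.gen _ U (.form s.1) + GradedManifold.gen _ U (.vec s.2)

open GradedManifold in
/-- `Q` is the homological vector field on the split graded manifold that corresponds to the anchor
`ρ` and the brackets `l₁, l₂, l₃`: for sections `ζ₀` of `A₀^*`, `ζ₁` of `A₋₁^*`, `x₀, y₀, z₀` of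
`A₀` and `x₁` of `A₋₁`,
* `Q f = ρ^* df`;
* `(Q ζ₀)(x₀ ∧ y₀ + x₁) = ρ(x₀) ⟨ζ₀, y₀⟩ - ρ(y₀) ⟨ζ₀, x₀⟩ - ⟨ζ₀, l₂(x₀, y₀)⟩ + ⟨ζ₀, l₁ x₁⟩`;
* `(Q ζ₁)(x₀ ∧ y₀ ∧ z₀) = ⟨ζ₁, l₃(x₀, y₀, z₀)⟩`;
* `(Q ζ₁)(x₀ ⊗ x₁) = ρ(x₀) ⟨ζ₁, x₁⟩ - ⟨ζ₁, l₂(x₀, x₁)⟩`.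
The brackets `L` make `A₀ ⊕ A₋₁` into a Lie `2`-algebroid if and only if such a `Q` (with `Q² = 0`)
exists. -/
structure IsChevalleyEilenberg (L : Brackets E M) (Q : (splitManifold E M).HomologicalField) :
    Prop where
  on_fn : ∀ U (f : SmoothFn E U.carrier), ∃ s : CoSec (E := E) U.carrier,
    (∀ a : DSec (E := E) U.carrier, ∀ x ∈ U.carrier,
      coPair s a.val x = der (L.anchor a.val) f.val x) ∧
    Q.Q U (gen _ U (.fn f)) = coGen U s
  on_degree_one : ∀ U (s : CoSec (E := E) U.carrier),
    ∃ (w : (splitManifold E M).Fn U) (Z : VecField E U.carrier),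
      RepresentsAlt (coGen U) (fun s (a : DSec (E := E) U.carrier) => coPair s a.val)
        U.carrier 2 w
        (fun a => der (L.anchor (a 0).val) (coPair s (a 1).val)
          - der (L.anchor (a 1).val) (coPair s (a 0).val)
          - coPair s (L.l₂ (a 0).val (a 1).val)) ∧
      (∀ m : OneForm E U.carrier, ∀ x ∈ U.carrier,
        pairVec Z m x = coPair s (L.l₁ m.val) x) ∧
      Q.Q U (coGen U s) = w + gen _ U (.mom Z)
  on_degree_two : ∀ U (Z : VecField E U.carrier),
    ∃ w w' : (splitManifold E M).Fn U,
      RepresentsAlt (coGen U) (fun s (a : DSec (E := E) U.carrier) => coPair s a.val)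
        U.carrier 3 w
        (fun a x => L.l₃ (a 0).val (a 1).val (a 2).val x (Z.val x)) ∧
      RepresentsTensor (coGen U) (fun Y => gen _ U (.mom Y))
        (fun s (a : DSec (E := E) U.carrier) => coPair s a.val) pairVec U.carrier w'
        (fun a m => der (L.anchor a.val) (pairVec Z m)
          - fun x => L.l₂' a.val m.val x (Z.val x)) ∧
      Q.Q U (gen _ U (.mom Z)) = w + w'

end CourantExt

end

open Set TopologicalSpace
open scoped Manifold ContDiff Bundle

noncomputable section

namespace CourantExt

variable {E : Type*} [NormedAddCommGroup E] [NormedSpace ℝ E]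
variable {M : Type*} [TopologicalSpace M] [ChartedSpace E M] [IsManifold 𝓘(ℝ, E) ∞ M]

set_option linter.unusedSectionVars false

-- Everything is done over a coordinate domain with coordinates $q^i$, coordinate fields $e_i$ and
-- closed forms $\theta^i=dq^i$, and the result is glued by showing that it does not depend on the
-- coordinates. Gluing and uniqueness both rest on one fact: an element of an exterior power or of a
-- tensor product is determined by its values (`RepresentsAlt.unique`, `RepresentsTensor.unique`),
-- since expansion in a frame recovers it from its values on frame vectors.
--
-- The cocycle property is formal. The first equation is the definition of $c_3$; the second is the
-- identity $d_\nabla^2=\omega\circ$ applied to $c_2$, with the Jacobi identity cancelling the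
-- double brackets.
--
-- A graded derivation on an algebra given by generators and relations amounts to an algebra map
-- into upper triangular $2\times 2$ matrices, so for $Q_H$ to exist it suffices to check the
-- relations (`derMatrix_common`, `derMatrix_courantDer`). Its square is an honest derivation and
-- vanishes on generators: $Q_H^2 i_X = L_XH - d\,i_XH$, which is zero because $dH=0$ turns Cartan's
-- formula into $L_XH=d\,i_XH$.
--
-- The two function algebras differ only in how the degree $2$ generators depend on $X$:
-- $L_{fX}=fL_X+df\,i_X$ against $C^\infty$-linearity. The connection $\nabla^*$ on $TM$ dual to
-- $\nabla$ repairs this. The element $\mathrm{conn}(X)=\sum_a\theta^a\,\nabla^*_{e_a}X$ has the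
-- same anomaly as $L_X$ (`conn_linear`), so $L_X\mapsto X+\mathrm{conn}(X)$, with functions, forms
-- and contractions fixed, defines an isomorphism (`splitEquiv`).
--
-- The field $Q$ on the split side is the transport of $Q_H$; hence $Q^2=0$ and the intertwining
-- property are automatic, and the higher Jacobi identities never have to be checked by hand. What
-- remains is to compute $Q$ on generators and recognise the brackets (`degree_one_represents`,
-- `degree_two_represents`). The term $i_XH$ gives $c_2$, the term $\mathrm{conn}(X)$ gives $\nabla$
-- in $l_2$, the iterated term $\sum_a\theta^a\,\mathrm{conn}(\nabla^*_{e_a}Z)$ gives the curvature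
-- in $l_3$ (`sum_dualPair_dualNabla`), and $d\,i_ZH-\sum_a\theta^a\,i_{\nabla^*_{e_a}Z}H$ gives
-- $c_3$ (`cThree_apply`).

local instance isManifold_minSmoothness_two : IsManifold 𝓘(ℝ, E) (minSmoothness ℝ 2) M := by
  simpa using (inferInstance : IsManifold 𝓘(ℝ, E) 2 M)

local instance isManifold_minSmoothness_three : IsManifold 𝓘(ℝ, E) (minSmoothness ℝ 3) M := by
  simpa using (inferInstance : IsManifold 𝓘(ℝ, E) 3 M)

/-! ### Modules of smooth functions, vector fields and forms -/

section Modules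

variable {U : Opens M}

attribute [ext] SmoothFn VecField OneForm

namespace SmoothFn

instance : Add (SmoothFn E U) := ⟨fun f g => ⟨f.val + g.val, f.smooth.add g.smooth⟩⟩
instance : Mul (SmoothFn E U) := ⟨fun f g => ⟨f.val * g.val, f.smooth.mul g.smooth⟩⟩
instance : Neg (SmoothFn E U) := ⟨fun f => ⟨-f.val, f.smooth.neg⟩⟩

/-- Constant functions. -/
def const (U : Opens M) (c : ℝ) : SmoothFn E U := ⟨fun _ => c, contMDiffOn_const⟩

instance : Zero (SmoothFn E U) := ⟨const U 0⟩
instance : One (SmoothFn E U) := ⟨const U 1⟩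

@[simp] theorem val_add (f g : SmoothFn E U) : (f + g).val = f.val + g.val := rfl
@[simp] theorem val_mul (f g : SmoothFn E U) : (f * g).val = f.val * g.val := rfl
@[simp] theorem val_neg (f : SmoothFn E U) : (-f).val = -f.val := rfl
@[simp] theorem val_zero : (0 : SmoothFn E U).val = 0 := rfl
@[simp] theorem val_one : (1 : SmoothFn E U).val = 1 := rfl
@[simp] theorem val_const (c : ℝ) : (const U c : SmoothFn E U).val = fun _ => c := rfl

instance : CommRing (SmoothFn E U) :=
  CommRing.ofMinimalAxioms
    (fun _ _ _ => SmoothFn.ext (add_assoc ..)) (fun _ => SmoothFn.ext (zero_add _))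
    (fun _ => SmoothFn.ext (neg_add_cancel _)) (fun _ _ _ => SmoothFn.ext (mul_assoc ..))
    (fun _ _ => SmoothFn.ext (mul_comm ..)) (fun _ => SmoothFn.ext (one_mul _))
    (fun _ _ _ => SmoothFn.ext (mul_add ..))

@[simp] theorem val_sub (f g : SmoothFn E U) : (f - g).val = f.val - g.val := by
  rw [sub_eq_add_neg, val_add, val_neg, sub_eq_add_neg]

instance : Algebra ℝ (SmoothFn E U) :=
  RingHom.toAlgebra
    { toFun := const U
      map_one' := rfl
      map_zero' := rfl
      map_add' := fun _ _ => rfl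
      map_mul' := fun _ _ => rfl }

@[simp] theorem val_smul (c : ℝ) (f : SmoothFn E U) : (c • f).val = c • f.val := by
  rw [Algebra.smul_def, val_mul]; rfl

@[simp] theorem val_sum {ι : Type*} (s : Finset ι) (f : ι → SmoothFn E U) (x : M) :
    (∑ i ∈ s, f i).val x = ∑ i ∈ s, (f i).val x := by
  classical
  induction s using Finset.induction_on with
  | empty => simp
  | insert a s ha ih => simp [Finset.sum_insert ha, ih]

theorem mdifferentiableAt (f : SmoothFn E U) {x : M} (hx : x ∈ U) :
    MDifferentiableAt 𝓘(ℝ, E) 𝓘(ℝ, ℝ) f.val x :=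
  (f.smooth.contMDiffAt (U.isOpen.mem_nhds hx)).mdifferentiableAt (by simp)

end SmoothFn

namespace VecField

instance : Add (VecField E U) := ⟨fun X Y => ⟨X.val + Y.val, X.smooth.add_section Y.smooth⟩⟩
instance : Neg (VecField E U) := ⟨fun X => ⟨-X.val, X.smooth.neg_section⟩⟩
instance : Zero (VecField E U) := ⟨⟨0, (Bundle.contMDiff_zeroSection ℝ _).contMDiffOn⟩⟩
instance : SMul (SmoothFn E U) (VecField E U) :=
  ⟨fun f X => ⟨f.val • X.val, f.smooth.smul_section X.smooth⟩⟩

@[simp] theorem val_add (X Y : VecField E U) : (X + Y).val = X.val + Y.val := rfl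
@[simp] theorem val_neg (X : VecField E U) : (-X).val = -X.val := rfl
@[simp] theorem val_zero : (0 : VecField E U).val = 0 := rfl
@[simp] theorem val_smul (f : SmoothFn E U) (X : VecField E U) : (f • X).val = f.val • X.val := rfl

instance : AddCommGroup (VecField E U) :=
  { AddGroup.ofLeftAxioms (G := VecField E U)
      (fun _ _ _ => VecField.ext (add_assoc ..)) (fun _ => VecField.ext (zero_add _))
      (fun _ => VecField.ext (neg_add_cancel _)) with
    add_comm := fun _ _ => VecField.ext (add_comm ..) }

instance : Module (SmoothFn E U) (VecField E U) where
  one_smul _ := VecField.ext (one_smul (M → ℝ) _)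
  mul_smul _ _ _ := VecField.ext (mul_smul (α := M → ℝ) ..)
  smul_zero _ := VecField.ext (smul_zero (M := M → ℝ) _)
  smul_add _ _ _ := VecField.ext (smul_add (M := M → ℝ) ..)
  add_smul _ _ _ := VecField.ext (add_smul (R := M → ℝ) ..)
  zero_smul _ := VecField.ext (zero_smul (M → ℝ) _)

@[simp] theorem val_sub (X Y : VecField E U) : (X - Y).val = X.val - Y.val := by
  rw [sub_eq_add_neg, val_add, val_neg, sub_eq_add_neg]

@[simp] theorem val_sum {ι : Type*} (s : Finset ι) (X : ι → VecField E U) (x : M) :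
    (∑ i ∈ s, X i).val x = ∑ i ∈ s, (X i).val x := by
  classical
  induction s using Finset.induction_on with
  | empty => simp
  | insert a s ha ih => simp [Finset.sum_insert ha, ih]

theorem contMDiffAt (X : VecField E U) {x : M} (hx : x ∈ U) :
    ContMDiffAt 𝓘(ℝ, E) (𝓘(ℝ, E).prod 𝓘(ℝ, E)) ∞
      (fun x => (Bundle.TotalSpace.mk' E x (X.val x) : TangentBundle 𝓘(ℝ, E) M)) x :=
  X.smooth.contMDiffAt (U.isOpen.mem_nhds hx)

theorem mdifferentiableAt (X : VecField E U) {x : M} (hx : x ∈ U) :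
    MDifferentiableAt 𝓘(ℝ, E) (𝓘(ℝ, E).prod 𝓘(ℝ, E))
      (fun x => (Bundle.TotalSpace.mk' E x (X.val x) : TangentBundle 𝓘(ℝ, E) M)) x :=
  (X.contMDiffAt hx).mdifferentiableAt (by simp)

end VecField

namespace OneForm

instance : Add (OneForm E U) := ⟨fun α β => ⟨α.val + β.val, α.smooth.add_section β.smooth⟩⟩
instance : Neg (OneForm E U) := ⟨fun α => ⟨-α.val, α.smooth.neg_section⟩⟩
instance : Zero (OneForm E U) := ⟨⟨0, (Bundle.contMDiff_zeroSection ℝ _).contMDiffOn⟩⟩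
instance : SMul (SmoothFn E U) (OneForm E U) :=
  ⟨fun f α => ⟨f.val • α.val, f.smooth.smul_section α.smooth⟩⟩

@[simp] theorem val_add (α β : OneForm E U) : (α + β).val = α.val + β.val := rfl
@[simp] theorem val_neg (α : OneForm E U) : (-α).val = -α.val := rfl
@[simp] theorem val_zero : (0 : OneForm E U).val = 0 := rfl
@[simp] theorem val_smul (f : SmoothFn E U) (α : OneForm E U) : (f • α).val = f.val • α.val := rfl

instance : AddCommGroup (OneForm E U) :=
  { AddGroup.ofLeftAxioms (G := OneForm E U)
      (fun _ _ _ => OneForm.ext (add_assoc ..)) (fun _ => OneForm.ext (zero_add _))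
      (fun _ => OneForm.ext (neg_add_cancel _)) with
    add_comm := fun _ _ => OneForm.ext (add_comm ..) }

instance : Module (SmoothFn E U) (OneForm E U) where
  one_smul _ := OneForm.ext (one_smul (M → ℝ) _)
  mul_smul _ _ _ := OneForm.ext (mul_smul (α := M → ℝ) ..)
  smul_zero _ := OneForm.ext (smul_zero (M := M → ℝ) _)
  smul_add _ _ _ := OneForm.ext (smul_add (M := M → ℝ) ..)
  add_smul _ _ _ := OneForm.ext (add_smul (R := M → ℝ) ..)
  zero_smul _ := OneForm.ext (zero_smul (M → ℝ) _)

@[simp] theorem val_sub (α β : OneForm E U) : (α - β).val = α.val - β.val := by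
  rw [sub_eq_add_neg, val_add, val_neg, sub_eq_add_neg]

@[simp] theorem val_sum {ι : Type*} (s : Finset ι) (α : ι → OneForm E U) (x : M) :
    (∑ i ∈ s, α i).val x = ∑ i ∈ s, (α i).val x := by
  classical
  induction s using Finset.induction_on with
  | empty => simp
  | insert a s ha ih => simp [Finset.sum_insert ha, ih]

theorem mdifferentiableAt (α : OneForm E U) {x : M} (hx : x ∈ U) :
    MDifferentiableAt 𝓘(ℝ, E) (𝓘(ℝ, E).prod 𝓘(ℝ, E →L[ℝ] ℝ))
      (fun x => Bundle.TotalSpace.mk' (E →L[ℝ] ℝ)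
        (E := fun x : M => TangentSpace 𝓘(ℝ, E) x →L[ℝ] ℝ) x (α.val x)) x :=
  (α.smooth.contMDiffAt (U.isOpen.mem_nhds hx)).mdifferentiableAt (by simp)

/-- The pairing of a `1`-form and a vector field, as a smooth function. -/
def pair (α : OneForm E U) (X : VecField E U) : SmoothFn E U :=
  ⟨pairForm α X, fun x hx => (Bundle.contMDiffWithinAt_totalSpace.1
    (ContMDiffOn.clm_bundle_apply (b := fun x : M => x) (F₂ := ℝ) (E₂ := fun _ => ℝ)
      (IB := 𝓘(ℝ, E)) α.smooth X.smooth x hx)).2⟩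

@[simp] theorem val_pair_apply (α : OneForm E U) (X : VecField E U) (x : M) :
    (α.pair X).val x = α.val x (X.val x) := rfl

end OneForm

/-! ### Differential calculus -/

/-- The differential of a smooth function. -/
def SmoothFn.d (f : SmoothFn E U) : OneForm E U where
  val := mvfderiv 𝓘(ℝ, E) f.val
  smooth x hx := by
    refine ContMDiffAt.contMDiffWithinAt ?_
    rw [contMDiffAt_hom_bundle]
    refine ⟨contMDiffAt_id, ?_⟩
    have hf : ContMDiffAt 𝓘(ℝ, E) 𝓘(ℝ, ℝ) ∞ f.val x :=
      f.smooth.contMDiffAt (U.isOpen.mem_nhds hx)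
    -- The derivative of a smooth map is smooth when read in tangent coordinates. The target is a
    -- vector space with trivial coordinates, so this reading agrees with the one in the Hom bundle.
    refine (hf.mfderiv_const (m := ∞) (by simp)).congr_of_eventuallyEq
      (Filter.Eventually.of_forall fun y => ?_)
    simp [inTangentCoordinates]

    ext v
    simp [ContinuousLinearMap.inCoordinates, mvfderiv]

    rfl

theorem SmoothFn.val_d (f : SmoothFn E U) : f.d.val = mvfderiv 𝓘(ℝ, E) f.val := rfl

theorem SmoothFn.isDiff_d (f : SmoothFn E U) : IsDiff f f.d := fun _ _ => rfl

namespace VecField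

/-- The derivative of a smooth function along a vector field. -/
def der (X : VecField E U) (f : SmoothFn E U) : SmoothFn E U :=
  ⟨CourantExt.der X.val f.val, (f.d.pair X).smooth⟩

/-- The bracket of smooth vector fields. -/
def bracket [CompleteSpace E] (X Y : VecField E U) : VecField E U :=
  ⟨bra X.val Y.val, fun x hx => by
    -- The bracket costs one derivative, which is harmless since $\infty+1=\infty$.
    have : IsManifold 𝓘(ℝ, E) (((⊤ : ℕ∞) : WithTop ℕ∞) + 1) M := by simpa
    exact ((X.contMDiffAt hx).mlieBracket_vectorField (n := ⊤) (m := ⊤) (Y.contMDiffAt hx)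
      (by simp)).contMDiffWithinAt⟩

end VecField

end Modules

/-! ### Rules of calculus, valid at points of `U` -/

section Calculus

variable {U : Opens M}

namespace SmoothFn

theorem d_congr {f g : SmoothFn E U} (h : ∀ x ∈ U, f.val x = g.val x) {x : M} (hx : x ∈ U) :
    f.d.val x = g.d.val x := by
  have : f.val =ᶠ[nhds x] g.val := Filter.eventuallyEq_of_mem (U.isOpen.mem_nhds hx) h
  simp only [val_d, mvfderiv, this.mfderiv_eq]
  rw [h x hx]

theorem d_add (f g : SmoothFn E U) {x : M} (hx : x ∈ U) :
    (f + g).d.val x = f.d.val x + g.d.val x :=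
  mvfderiv_add (f.mdifferentiableAt hx) (g.mdifferentiableAt hx)

theorem d_neg (f : SmoothFn E U) (x : M) : (-f).d.val x = -f.d.val x := mvfderiv_neg

theorem d_sub (f g : SmoothFn E U) {x : M} (hx : x ∈ U) :
    (f - g).d.val x = f.d.val x - g.d.val x := by
  rw [sub_eq_add_neg, d_add _ _ hx, d_neg, sub_eq_add_neg]

theorem d_mul (f g : SmoothFn E U) {x : M} (hx : x ∈ U) :
    (f * g).d.val x = f.val x • g.d.val x + g.val x • f.d.val x :=
  mvfderiv_mul (f.mdifferentiableAt hx) (g.mdifferentiableAt hx)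

theorem d_const (c : ℝ) (x : M) : (const U c : SmoothFn E U).d.val x = 0 := mvfderiv_const c

theorem d_zero (x : M) : (0 : SmoothFn E U).d.val x = 0 := d_const 0 x

theorem d_sum {ι : Type*} (s : Finset ι) (f : ι → SmoothFn E U) {x : M} (hx : x ∈ U) :
    (∑ i ∈ s, f i).d.val x = ∑ i ∈ s, (f i).d.val x := by
  classical
  induction s using Finset.induction_on with
  | empty => simpa using d_zero x
  | insert a s ha ih => simp [Finset.sum_insert ha, ih, d_add _ _ hx]

end SmoothFn

namespace VecField

theorem val_der_apply (X : VecField E U) (f : SmoothFn E U) (x : M) :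
    (X.der f).val x = f.d.val x (X.val x) := rfl

theorem bracket_swap [CompleteSpace E] (X Y : VecField E U) : X.bracket Y = -Y.bracket X :=
  VecField.ext VectorField.mlieBracket_swap

theorem jacobi [CompleteSpace E] (X Y Z : VecField E U) {x : M} (hx : x ∈ U) :
    (X.bracket (Y.bracket Z)).val x =
      ((X.bracket Y).bracket Z).val x + (Y.bracket (X.bracket Z)).val x :=
  have h2 : minSmoothness ℝ 2 ≤ ∞ := by
    rw [minSmoothness_of_isRCLikeNormedField]; exact WithTop.coe_le_coe.2 (le_top : (2 : ℕ∞) ≤ ⊤)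
  VectorField.leibniz_identity_mlieBracket_apply
    ((X.contMDiffAt hx).of_le h2) ((Y.contMDiffAt hx).of_le h2) ((Z.contMDiffAt hx).of_le h2)

theorem bracket_add [CompleteSpace E] (X Y Z : VecField E U) {x : M} (hx : x ∈ U) :
    (X.bracket (Y + Z)).val x = (X.bracket Y).val x + (X.bracket Z).val x :=
  VectorField.mlieBracket_add_right (Y.mdifferentiableAt hx) (Z.mdifferentiableAt hx)

theorem bracket_smul [CompleteSpace E] (X Y : VecField E U) (f : SmoothFn E U)
    {x : M} (hx : x ∈ U) :
    (X.bracket (f • Y)).val x = (X.der f).val x • Y.val x + f.val x • (X.bracket Y).val x :=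
  VectorField.mlieBracket_smul_right (f.mdifferentiableAt hx) (Y.mdifferentiableAt hx)

theorem bracket_congr [CompleteSpace E] (X : VecField E U) {Y Z : VecField E U}
    (h : ∀ x ∈ U, Y.val x = Z.val x) {x : M} (hx : x ∈ U) :
    (X.bracket Y).val x = (X.bracket Z).val x :=
  Filter.EventuallyEq.mlieBracket_vectorField_eq Filter.EventuallyEq.rfl
    (Filter.eventuallyEq_of_mem (U.isOpen.mem_nhds hx) h)

/-- Compare the Jacobi identity for $X,Y,fZ$ with $f$ times the one for $X,Y,Z$. After the Leibniz
rule the mixed terms $(Xf)[Y,Z]$ and $(Yf)[X,Z]$ cancel, and the commutator formula multiplied by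
$Z$ is left. -/
theorem der_bracket_smul [CompleteSpace E] (X Y Z : VecField E U) (f : SmoothFn E U)
    {x : M} (hx : x ∈ U) :
    ((X.bracket Y).der f).val x • Z.val x =
      ((X.der (Y.der f)).val x - (Y.der (X.der f)).val x) • Z.val x := by
  have key (V W : VecField E U) : (V.bracket (W.bracket (f • Z))).val x =
      (V.der (W.der f)).val x • Z.val x + (W.der f).val x • (V.bracket Z).val x +
      ((V.der f).val x • (W.bracket Z).val x + f.val x • (V.bracket (W.bracket Z)).val x) := by
    rw [V.bracket_congr (Z := W.der f • Z + f • W.bracket Z)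
      (fun y hy => bracket_smul W Z f hy) hx, bracket_add _ _ _ hx, bracket_smul _ _ _ hx,
      bracket_smul _ _ _ hx]
  have h := jacobi X Y (f • Z) hx
  rw [key, key, bracket_smul _ _ _ hx, jacobi X Y Z hx] at h
  rw [sub_smul, ← sub_eq_zero]
  rw [← sub_eq_zero] at h
  rw [← neg_eq_zero, ← h]
  module

/-- The commutator formula `[X, Y] f = X (Y f) - Y (X f)`. -/
theorem der_bracket [CompleteSpace E] (X Y : VecField E U) (f : SmoothFn E U)
    {x : M} (hx : x ∈ U) :
    ((X.bracket Y).der f).val x = (X.der (Y.der f)).val x - (Y.der (X.der f)).val x := by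
  -- The factor $Z(x)$ can be cancelled once some available field is nonzero at $x$. The candidates
  -- are $X$, $Y$ and $[X,Y]$; if all three vanish at $x$, both sides are zero.
  by_cases h₁ : X.val x = 0
  · by_cases h₂ : Y.val x = 0
    · by_cases h₃ : (X.bracket Y).val x = 0
      · simp [val_der_apply, h₁, h₂, h₃]
      · exact smul_left_injective ℝ h₃ (der_bracket_smul X Y (X.bracket Y) f hx)
    · exact smul_left_injective ℝ h₂ (der_bracket_smul X Y Y f hx)
  · exact smul_left_injective ℝ h₁ (der_bracket_smul X Y X f hx)

end VecField

/-! ### Coordinate frames -/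

variable (E) in
/-- Coordinate functions on `U`, together with the coordinate vector fields. -/
structure Frame (U : Opens M) where
  n : ℕ
  q : Fin n → SmoothFn E U
  e : Fin n → VecField E U
  expand : ∀ x ∈ U, ∀ v : TangentSpace 𝓘(ℝ, E) x, ∑ i, (q i).d.val x v • (e i).val x = v

/-- The coordinates are the components of the chart in a basis of $E$, and the frame consists of the
pullbacks of the constant basis fields. The derivative of the chart is invertible on $U$, so
expanding its value on $v$ in the basis and pulling back returns $v$. -/
theorem exists_frame [FiniteDimensional ℝ E] {U : Opens M}
    (hU : ∃ φ ∈ atlas E M, (U : Set M) ⊆ φ.source) : Nonempty (Frame E U) := by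
  have : CompleteSpace E := FiniteDimensional.complete ℝ E
  obtain ⟨φ, hφ, hs⟩ := hU
  let b := Module.finBasis ℝ E
  have hφ' : φ ∈ IsManifold.maximalAtlas 𝓘(ℝ, E) ∞ M := IsManifold.subset_maximalAtlas hφ
  have hφs : ∀ x ∈ U, ContMDiffAt 𝓘(ℝ, E) 𝓘(ℝ, E) ∞ φ x := fun x hx =>
    contMDiffAt_of_mem_maximalAtlas hφ' (hs hx)
  have hd := mdifferentiable_of_mem_atlas (I := 𝓘(ℝ, E)) hφ
  have hinv : ∀ x ∈ U, (mfderiv 𝓘(ℝ, E) 𝓘(ℝ, E) φ x).IsInvertible := fun x hx =>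
    ⟨hd.mfderiv (hs hx), rfl⟩
  refine ⟨⟨Module.finrank ℝ E, fun i => ⟨fun x => (b.coord i).toContinuousLinearMap (φ x), ?_⟩,
    fun i => ⟨VectorField.mpullback 𝓘(ℝ, E) 𝓘(ℝ, E) φ (fun _ => b i), ?_⟩, ?_⟩⟩
  · exact fun x hx => (((b.coord i).toContinuousLinearMap.contMDiff.contMDiffAt).comp x
      (hφs x hx)).contMDiffWithinAt
  · refine fun x hx => (ContMDiffAt.mpullback_vectorField_preimage (n := ∞) ?_ (hφs x hx)
      (hinv x hx) (by simp)).contMDiffWithinAt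
    exact contMDiffAt_vectorSpace_iff_contDiffAt.2 contDiffAt_const
  · intro x hx v
    have hφx := (hφs x hx).mdifferentiableAt (by simp)
    have h1 : ∀ i, mvfderiv 𝓘(ℝ, E) (fun x => (b.coord i).toContinuousLinearMap (φ x)) x v =
        b.repr (mfderiv 𝓘(ℝ, E) 𝓘(ℝ, E) φ x v) i := by
      intro i
      have := mfderiv_comp x
        ((b.coord i).toContinuousLinearMap.mdifferentiableAt (x := φ x)) hφx
      change mfderiv 𝓘(ℝ, E) 𝓘(ℝ, ℝ) ((b.coord i).toContinuousLinearMap ∘ φ) x v = _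
      rw [this, ContinuousLinearMap.mfderiv_eq]
      rfl
    change ∑ i, mvfderiv 𝓘(ℝ, E) (fun x => (b.coord i).toContinuousLinearMap (φ x)) x v •
      (mfderiv 𝓘(ℝ, E) 𝓘(ℝ, E) φ x).inverse (b i) = v
    simp only [h1]
    obtain ⟨A, hA⟩ := hinv x hx
    rw [← hA, ContinuousLinearMap.inverse_equiv]
    refine Eq.trans ?_ ((congrArg A.symm (b.sum_repr (A v))).trans (A.symm_apply_apply v))
    exact ((map_sum A.symm _ _).trans (Finset.sum_congr rfl fun i _ => map_smul A.symm _ _)).symm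

/-! ### Connections -/

/-- Smoothness of a connection is a condition on its values on global sections, so a local form is
first multiplied by a bump function supported in $U$. The bump function is $1$ near $x$ and
connections are local, so nothing changes near $x$. -/
theorem contMDiffAt_connection [FiniteDimensional ℝ E] [T2Space M] (D : Connection E M)
    [CovariantDerivative.ContMDiffCovariantDerivative D ∞] (α : OneForm E U) {x : M} (hx : x ∈ U) :
    ContMDiffAt 𝓘(ℝ, E) (𝓘(ℝ, E).prod 𝓘(ℝ, E →L[ℝ] E →L[ℝ] ℝ)) ∞
      (fun x => Bundle.TotalSpace.mk' (E →L[ℝ] E →L[ℝ] ℝ)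
        (E := fun x : M => TangentSpace 𝓘(ℝ, E) x →L[ℝ] TangentSpace 𝓘(ℝ, E) x →L[ℝ] ℝ) x
        (D α.val x)) x := by
  obtain ⟨ψ, -, hψ⟩ := (SmoothBumpFunction.nhds_basis_tsupport (I := 𝓘(ℝ, E)) x).mem_iff.1
    (U.isOpen.mem_nhds hx)
  have hσ := ContMDiffOn.smul_section_of_tsupport (ψ := (ψ : M → ℝ)) (u := U) (n := ∞)
    ψ.contMDiff.contMDiffOn U.isOpen hψ α.smooth
  have hD := (CovariantDerivative.ContMDiffCovariantDerivative.contMDiff (cov := D) (k := ∞)).contMDiff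
    (σ := (ψ : M → ℝ) • α.val) (by simpa using hσ.contMDiffOn)
  refine (hD.contMDiffAt Filter.univ_mem).congr_of_eventuallyEq ?_
  obtain ⟨V, hV, hVo, hxV⟩ := eventually_nhds_iff.1 ψ.eventuallyEq_one
  filter_upwards [hVo.mem_nhds hxV, U.isOpen.mem_nhds hx] with y hy hyU
  have : D α.val y = D ((ψ : M → ℝ) • α.val) y :=
    D.isCovariantDerivativeOnUniv.congr_of_eventuallyEq (α.mdifferentiableAt hyU)
    ((hσ y).mdifferentiableAt (by simp)) Filter.univ_mem
    (Filter.mem_of_superset (hVo.mem_nhds hy) fun z hz => by simp [hV z hz])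
  rw [this]

/-- `∇_X α` as a smooth `1`-form. -/
def nablaForm [FiniteDimensional ℝ E] [T2Space M] (D : Connection E M)
    [CovariantDerivative.ContMDiffCovariantDerivative D ∞] (X : VecField E U) (α : OneForm E U) :
    OneForm E U where
  val := nabla D X.val α.val
  smooth _ hx := (ContMDiffAt.clm_bundle_apply (contMDiffAt_connection D α hx)
    (X.contMDiffAt hx)).contMDiffWithinAt

section Connection

variable [FiniteDimensional ℝ E] [T2Space M] (D : Connection E M)
  [CovariantDerivative.ContMDiffCovariantDerivative D ∞]

theorem nablaForm_add (X : VecField E U) (α β : OneForm E U) {x : M} (hx : x ∈ U) :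
    (nablaForm D X (α + β)).val x = (nablaForm D X α).val x + (nablaForm D X β).val x :=
  congrArg (fun L => L (X.val x))
    (D.isCovariantDerivativeOnUniv.add (α.mdifferentiableAt hx) (β.mdifferentiableAt hx))

theorem nablaForm_smul (X : VecField E U) (f : SmoothFn E U) (α : OneForm E U)
    {x : M} (hx : x ∈ U) :
    (nablaForm D X (f • α)).val x =
      f.val x • (nablaForm D X α).val x + (X.der f).val x • α.val x :=
  congrArg (fun L => L (X.val x))
    (D.isCovariantDerivativeOnUniv.leibniz (α.mdifferentiableAt hx) (f.mdifferentiableAt hx))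

theorem nablaForm_neg (X : VecField E U) (α : OneForm E U) {x : M} (hx : x ∈ U) :
    (nablaForm D X (-α)).val x = -(nablaForm D X α).val x := by
  have h : -α = (SmoothFn.const U (-1) : SmoothFn E U) • α := by
    refine OneForm.ext (funext fun y => ?_)
    rw [OneForm.val_neg, OneForm.val_smul]
    exact (neg_one_smul ℝ (α.val y)).symm
  rw [h, nablaForm_smul _ _ _ _ hx, VecField.val_der_apply, SmoothFn.d_const]
  simp only [zero_apply, zero_smul, add_zero]
  exact neg_one_smul ℝ ((nablaForm D X α).val x)

theorem nablaForm_sub (X : VecField E U) (α β : OneForm E U) {x : M} (hx : x ∈ U) :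
    (nablaForm D X (α - β)).val x = (nablaForm D X α).val x - (nablaForm D X β).val x := by
  rw [sub_eq_add_neg, nablaForm_add _ _ _ _ hx, nablaForm_neg _ _ _ hx, sub_eq_add_neg]

theorem nablaForm_congr (X : VecField E U) {α β : OneForm E U}
    (h : ∀ x ∈ U, α.val x = β.val x) {x : M} (hx : x ∈ U) :
    (nablaForm D X α).val x = (nablaForm D X β).val x :=
  congrArg (fun L => L (X.val x))
    (D.isCovariantDerivativeOnUniv.congr_of_eventuallyEq (α.mdifferentiableAt hx)
      (β.mdifferentiableAt hx) Filter.univ_mem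
      (Filter.mem_of_superset (U.isOpen.mem_nhds hx) h))

end Connection

/-! ### Contractions of a `3`-form -/

namespace ThreeForm

variable (H : ThreeForm E M)

/-- The `1`-form `H(X, Y, ·)`. -/
def contract (X Y : VecField E U) : OneForm E U := ⟨cTwo H X.val Y.val, H.smooth U X Y⟩

theorem val_contract_apply (X Y : VecField E U) (x : M) :
    (H.contract X Y).val x = H.val x (X.val x) (Y.val x) := rfl

theorem val_add₁ (x : M) (u v w z : TangentSpace 𝓘(ℝ, E) x) :
    H.val x (u + v) w z = H.val x u w z + H.val x v w z :=
  congrArg (fun L => L w z) (ContinuousLinearMap.map_add (H.val x) u v)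

theorem val_smul₁ (x : M) (c : ℝ) (u w z : TangentSpace 𝓘(ℝ, E) x) :
    H.val x (c • u) w z = c * H.val x u w z :=
  congrArg (fun L => L w z) (ContinuousLinearMap.map_smul (H.val x) c u)

theorem val_add₂ (x : M) (u v w z : TangentSpace 𝓘(ℝ, E) x) :
    H.val x w (u + v) z = H.val x w u z + H.val x w v z :=
  congrArg (fun L => L z) (ContinuousLinearMap.map_add (H.val x w) u v)

theorem val_swap_left (x : M) (u v w : TangentSpace 𝓘(ℝ, E) x) :
    H.val x u v w = -H.val x v u w := by
  have h := H.alt_left x (u + v) w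
  rw [val_add₁, val_add₂, val_add₂, H.alt_left, H.alt_left] at h
  linarith

theorem val_swap_right (x : M) (u v w : TangentSpace 𝓘(ℝ, E) x) :
    H.val x u v w = -H.val x u w v := by
  have h := H.alt_right x u (v + w)
  rw [val_add₂, map_add, map_add, H.alt_right, H.alt_right] at h
  linarith

theorem val_rotate (x : M) (u v w : TangentSpace 𝓘(ℝ, E) x) :
    H.val x u v w = H.val x v w u := by
  rw [val_swap_left, val_swap_right, neg_neg]

theorem val_neg₁ (x : M) (u w z : TangentSpace 𝓘(ℝ, E) x) :
    H.val x (-u) w z = -H.val x u w z := by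
  rw [← neg_one_smul ℝ u, val_smul₁, neg_one_mul]

theorem contract_swap (X Y : VecField E U) : H.contract X Y = -H.contract Y X := by
  refine OneForm.ext (funext fun x => ContinuousLinearMap.ext fun w => ?_)
  exact H.val_swap_left x _ _ w

end ThreeForm

/-! ### The cocycle property -/

/-- The second equation is $d_\nabla d_\nabla c_2=\omega\circ c_2$. The second covariant derivatives
assemble into curvatures, terms with one derivative and one bracket cancel in pairs, and the double
brackets cancel by the Jacobi identity and the skew symmetry of $c_2$. -/
theorem isTwoCocycle_cTwo [FiniteDimensional ℝ E] [T2Space M] (D : Connection E M)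
    [CovariantDerivative.ContMDiffCovariantDerivative D ∞] (H : ThreeForm E M) :
    IsTwoCocycle D (cTwo H) (cThree D H) := by
  have : CompleteSpace E := FiniteDimensional.complete ℝ E
  refine fun U => ⟨fun X Y Z x _ => sub_self _, fun X Y Z W x hx => ?_⟩
  let c : VecField E U → VecField E U → OneForm E U := H.contract
  let T (X Y Z : VecField E U) : OneForm E U :=
    nablaForm D X (c Y Z) + nablaForm D Y (c Z X) + nablaForm D Z (c X Y)
      - (c (X.bracket Y) Z + c (Y.bracket Z) X + c (Z.bracket X) Y)
  have hT (X Y Z : VecField E U) : cThree D H X.val Y.val Z.val = (T X Y Z).val := by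
    simp only [T, OneForm.val_sub]; rfl
  have hR (X Y : VecField E U) (α : OneForm E U) : curv D X.val Y.val α.val x =
      (nablaForm D X (nablaForm D Y α)).val x - (nablaForm D Y (nablaForm D X α)).val x
        - (nablaForm D (X.bracket Y) α).val x := rfl
  have hc (X Y : VecField E U) : cTwo H X.val Y.val = (c X Y).val := rfl
  have hn (X : VecField E U) (α : OneForm E U) : nabla D X.val α.val = (nablaForm D X α).val := rfl
  have hcs (X Y : VecField E U) : c X Y = -c Y X := H.contract_swap X Y
  have hbs (X Y : VecField E U) : X.bracket Y = -Y.bracket X := X.bracket_swap Y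
  have hb (X Y : VecField E U) : bra X.val Y.val = (X.bracket Y).val := rfl
  have hca (X Y : VecField E U) : c (-X) Y = -c X Y :=
    OneForm.ext (funext fun y => ContinuousLinearMap.ext fun w => H.val_neg₁ y _ _ w)
  have hT' (V X Y Z : VecField E U) : (nablaForm D V (T X Y Z)).val x =
    (nablaForm D V (nablaForm D X (c Y Z))).val x + (nablaForm D V (nablaForm D Y (c Z X))).val x
     + (nablaForm D V (nablaForm D Z (c X Y))).val x - ((nablaForm D V (c (X.bracket Y) Z)).val x
      + (nablaForm D V (c (Y.bracket Z) X)).val x + (nablaForm D V (c (Z.bracket X) Y)).val x) := by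
    simp only [T, nablaForm_sub _ _ _ _ hx, nablaForm_add _ _ _ _ hx]
  -- The Jacobi identity, oriented so that it eliminates one of the three double brackets.
  have hj (X Y Z V : VecField E U) : (c ((Y.bracket Z).bracket X) V).val x =
      -(c ((X.bracket Y).bracket Z) V).val x + (c ((X.bracket Z).bracket Y) V).val x := by
    refine ContinuousLinearMap.ext fun w => ?_
    change H.val x _ _ w = -H.val x _ _ w + H.val x _ _ w
    rw [hbs (Y.bracket Z) X, hbs (X.bracket Z) Y, VecField.val_neg, VecField.val_neg, Pi.neg_apply,
      Pi.neg_apply, VecField.jacobi X Y Z hx, H.val_neg₁, H.val_neg₁, H.val_add₁]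
    ring
  simp only [dNablaThree, compTwo, hT, hc, hb, hn, hR, hT', Pi.add_apply, Pi.sub_apply]
  simp only [T, OneForm.val_add, OneForm.val_sub, Pi.add_apply, Pi.sub_apply]
  have hnn (V W : VecField E U) (α : OneForm E U) : (nablaForm D V (nablaForm D W (-α))).val x =
      -(nablaForm D V (nablaForm D W α)).val x := by
    rw [nablaForm_congr D V (β := -nablaForm D W α) (fun y hy => nablaForm_neg D W α hy) hx,
      nablaForm_neg _ _ _ hx]
  -- All brackets and contractions are brought to one fixed order of their arguments. Afterwards the
  -- identity is a cancellation in an abelian group.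
  simp only [hbs Z X, hbs W X, hbs W Y, hbs W (X.bracket Y),
    hbs W (X.bracket Z), hbs Z (X.bracket W), hbs W (Y.bracket Z), hbs Y (Z.bracket W), hbs Z (Y.bracket W),
    hca, hcs Z X, hcs W X, hcs W Y, hcs W (X.bracket Y), hcs W (X.bracket Z), hcs W (Y.bracket Z), hcs Z (X.bracket W), hcs Z (Y.bracket W), hcs Y (Z.bracket W), hcs (Z.bracket W) (X.bracket Y), hcs (Y.bracket W) (X.bracket Z),
    hcs (Y.bracket Z) (X.bracket W)]
  simp only [OneForm.val_neg, Pi.neg_apply, hj X Y Z, hj X Y W, hj X Z W, hj Y Z W,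
    nablaForm_neg _ _ _ hx, hnn]
  abel

end Calculus

/-! ### Elements of exterior powers are determined by their values -/

section Represents

/-- The products of `k` elements of the image of a linear map with anticommuting values. -/
def altProd {A R S : Type*} [CommRing A] [Ring R] [Algebra A R] [AddCommGroup S] [Module A S]
    (g : S →ₗ[A] R) (hg : ∀ s, g s * g s = 0) (k : ℕ) : S [⋀^Fin k]→ₗ[A] R :=
  (ExteriorAlgebra.lift A ⟨g, hg⟩).toLinearMap.compAlternatingMap (ExteriorAlgebra.ιMulti A k)

theorem altProd_apply {A R S : Type*} [CommRing A] [Ring R] [Algebra A R] [AddCommGroup S]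
    [Module A S] (g : S →ₗ[A] R) (hg : ∀ s, g s * g s = 0) (k : ℕ) (s : Fin k → S) :
    altProd g hg k s = (List.ofFn fun i => g (s i)).prod := by
  simp only [altProd, LinearMap.compAlternatingMap_apply, AlgHom.toLinearMap_apply,
    ExteriorAlgebra.ιMulti_apply, map_list_prod, List.map_ofFn]
  congr 2
  funext i
  simp

/-- The determinant antisymmetrises the coefficients of the multilinear expansion. Each permutation
in it contributes $G(s)$ again, since reindexing the multi-indices produces its sign a second time
through the alternation of $G$. The sum runs over all multi-indices and not only increasing ones,
whence the factor $k!$. -/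
theorem factorial_smul_alternatingMap {A R S ι : Type*} [CommRing A] [AddCommGroup R] [Module A R]
    [AddCommGroup S] [Module A S] [Fintype ι] {k : ℕ} (G : S [⋀^Fin k]→ₗ[A] R)
    (σ : ι → S) (c : Fin k → ι → A) (s : Fin k → S)
    (h : G s = ∑ a : Fin k → ι, (∏ i, c i (a i)) • G (σ ∘ a)) :
    k.factorial • G s =
      ∑ a : Fin k → ι, (Matrix.of fun i l => c i (a l)).det • G (σ ∘ a) := by
  classical
  simp only [Matrix.det_apply, Finset.sum_smul]
  rw [Finset.sum_comm]
  have key (τ : Equiv.Perm (Fin k)) : ∑ a : Fin k → ι,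
      (Equiv.Perm.sign τ • ∏ i, Matrix.of (fun i l => c i (a l)) (τ i) i) • G (σ ∘ a) = G s := by
    rw [h]
    refine Fintype.sum_equiv (Equiv.arrowCongr τ (Equiv.refl ι)) _ _ fun a => ?_
    have h1 : σ ∘ a = (σ ∘ (Equiv.arrowCongr τ (Equiv.refl ι) a)) ∘ τ := by
      funext i; simp [Equiv.arrowCongr]
    have h2 : ∏ i, c i (Equiv.arrowCongr τ (Equiv.refl ι) a i) = ∏ i, c (τ i) (a i) := by
      rw [← Equiv.prod_comp τ]; simp [Equiv.arrowCongr]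
    rw [h1, G.map_perm, h2]
    rcases Int.units_eq_one_or (Equiv.Perm.sign τ) with h | h <;> simp [h]
  rw [Finset.sum_congr rfl fun τ _ => key τ]
  simp [Fintype.card_perm]

/-- The expansion is assumed for the images $g(s_i)$ only. In the application a section agrees with
its frame expansion on $U$ but not elsewhere, and only its image in $R$ forgets the values outside
$U$. -/
theorem altProd_expand {A R S ι : Type*} [CommRing A] [Ring R] [Algebra A R]
    [AddCommGroup S] [Module A S] [Fintype ι] (g : S →ₗ[A] R) (hg : ∀ s, g s * g s = 0) {k : ℕ}
    (σ : ι → S) (c : Fin k → ι → A) (s : Fin k → S) (h : ∀ i, g (s i) = ∑ j, c i j • g (σ j)) :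
    altProd g hg k s = ∑ a : Fin k → ι, (∏ i, c i (a i)) • altProd g hg k (σ ∘ a) := by
  classical
  have h1 : altProd g hg k s = altProd g hg k fun i => ∑ j, c i j • σ j := by
    simp [altProd_apply, h]
  rw [h1, ← AlternatingMap.coe_multilinearMap, MultilinearMap.map_sum]
  refine Finset.sum_congr rfl fun a _ => ?_
  rw [MultilinearMap.map_smul_univ]
  rfl

variable {U : Opens M}

/-- Expansion in a frame writes $k!\,w$ as a combination of products of frame covectors whose
coefficients are the values of $\Omega$ on the dual vectors. Equal values therefore give equal
multiples, and $k!$ is invertible. -/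
theorem RepresentsAlt.unique {R S T ι : Type*} [Ring R] [Algebra (SmoothFn E U) R] [Module ℝ R]
    [AddCommGroup S] [Module (SmoothFn E U) S] [Fintype ι] {g : S →ₗ[SmoothFn E U] R}
    (hg : ∀ s, g s * g s = 0) (hU : ∀ f : SmoothFn E U, (∀ x ∈ U, f.val x = 0) → ∀ r : R, f • r = 0)
    {ev : S → T → M → ℝ} (σ : ι → S) (e : ι → T) (c : S → ι → SmoothFn E U)
    (hc : ∀ s i, ∀ x ∈ U, (c s i).val x = ev s (e i) x) (h : ∀ s, g s = ∑ i, c s i • g (σ i))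
    {k : ℕ} {w w' : R} {Ω Ω' : (Fin k → T) → M → ℝ} (hw : RepresentsAlt g ev U k w Ω)
    (hw' : RepresentsAlt g ev U k w' Ω') (hΩ : ∀ t, ∀ x ∈ U, Ω t x = Ω' t x) : w = w' := by
  have key {w : R} {Ω : (Fin k → T) → M → ℝ} (hw : RepresentsAlt g ev U k w Ω) :
      ∃ f : (Fin k → ι) → SmoothFn E U, (∀ a, ∀ x ∈ U, (f a).val x = Ω (e ∘ a) x) ∧
        k.factorial • w = ∑ a, f a • altProd g hg k (σ ∘ a) := by
    obtain ⟨r, s, rfl, hs⟩ := hw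
    refine ⟨fun a => ∑ j, (Matrix.of fun i l => c (s j i) (a l)).det, fun a x hx => ?_, ?_⟩
    · rw [hs _ x hx, SmoothFn.val_sum]
      refine Finset.sum_congr rfl fun j _ => ?_
      -- Evaluation at $x$ is a ring homomorphism, so it commutes with the determinant.
      let evx : SmoothFn E U →+* ℝ :=
        { toFun := fun f => f.val x
          map_one' := rfl
          map_zero' := rfl
          map_add' := fun _ _ => rfl
          map_mul' := fun _ _ => rfl }
      change evx _ = _
      rw [RingHom.map_det]
      congr 1
      ext i l
      exact hc _ _ x hx
    · simp only [Finset.sum_smul, Finset.smul_sum]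
      rw [Finset.sum_comm]
      refine Finset.sum_congr rfl fun j _ => ?_
      rw [← altProd_apply g hg]
      exact factorial_smul_alternatingMap _ _ _ _ (altProd_expand g hg σ _ _ fun i => h _)
  obtain ⟨f, hf, hfw⟩ := key hw
  obtain ⟨f', hf', hfw'⟩ := key hw'
  have h1 : k.factorial • w = k.factorial • w' := by
    rw [hfw, hfw', ← sub_eq_zero, ← Finset.sum_sub_distrib]
    refine Finset.sum_eq_zero fun a _ => ?_
    rw [← sub_smul]
    exact hU _ (fun x hx => by simp [hf a x hx, hf' a x hx, hΩ _ x hx]) _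
  rw [← Nat.cast_smul_eq_nsmul ℝ, ← Nat.cast_smul_eq_nsmul ℝ] at h1
  exact smul_right_injective R (Nat.cast_ne_zero.2 k.factorial_ne_zero) h1

theorem RepresentsTensor.unique {R S S' T T' ι ι' : Type*} [Ring R] [Algebra (SmoothFn E U) R]
    [AddCommGroup S] [Module (SmoothFn E U) S] [AddCommGroup S'] [Module (SmoothFn E U) S']
    [Fintype ι] [Fintype ι'] {g : S →ₗ[SmoothFn E U] R} {g' : S' →ₗ[SmoothFn E U] R}
    (hU : ∀ f : SmoothFn E U, (∀ x ∈ U, f.val x = 0) → ∀ r : R, f • r = 0)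
    {ev : S → T → M → ℝ} {ev' : S' → T' → M → ℝ}
    (σ : ι → S) (e : ι → T) (c : S → ι → SmoothFn E U)
    (hc : ∀ s i, ∀ x ∈ U, (c s i).val x = ev s (e i) x) (h : ∀ s, g s = ∑ i, c s i • g (σ i))
    (σ' : ι' → S') (e' : ι' → T') (c' : S' → ι' → SmoothFn E U)
    (hc' : ∀ s i, ∀ x ∈ U, (c' s i).val x = ev' s (e' i) x)
    (h' : ∀ s, g' s = ∑ i, c' s i • g' (σ' i))
    {w w' : R} {Ω Ω' : T → T' → M → ℝ} (hw : RepresentsTensor g g' ev ev' U w Ω)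
    (hw' : RepresentsTensor g g' ev ev' U w' Ω') (hΩ : ∀ t t', ∀ x ∈ U, Ω t t' x = Ω' t t' x) :
    w = w' := by
  have key {w : R} {Ω : T → T' → M → ℝ} (hw : RepresentsTensor g g' ev ev' U w Ω) :
      ∃ f : ι → ι' → SmoothFn E U, (∀ a b, ∀ x ∈ U, (f a b).val x = Ω (e a) (e' b) x) ∧
        w = ∑ a, ∑ b, f a b • (g (σ a) * g' (σ' b)) := by
    obtain ⟨r, s, s', rfl, hs⟩ := hw
    refine ⟨fun a b => ∑ j, c (s j) a * c' (s' j) b, fun a b x hx => ?_, ?_⟩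
    · rw [hs _ _ x hx, SmoothFn.val_sum]
      refine Finset.sum_congr rfl fun j _ => ?_
      simp [hc _ _ x hx, hc' _ _ x hx]
    · simp only [Finset.sum_smul]
      rw [Finset.sum_congr rfl fun a _ => Finset.sum_comm, Finset.sum_comm]
      refine Finset.sum_congr rfl fun j _ => ?_
      rw [h (s j), h' (s' j), Finset.sum_mul]
      simp only [Finset.mul_sum, smul_mul_smul_comm]
  obtain ⟨f, hf, hfw⟩ := key hw
  obtain ⟨f', hf', hfw'⟩ := key hw'
  rw [hfw, hfw', ← sub_eq_zero]
  simp only [← Finset.sum_sub_distrib, ← sub_smul]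
  exact Finset.sum_eq_zero fun a _ => Finset.sum_eq_zero fun b _ =>
    hU _ (fun x hx => by simp [hf a b x hx, hf' a b x hx, hΩ _ _ x hx]) _

theorem RepresentsAlt.congr {R S T : Type*} [Ring R] {g : S → R} {ev : S → T → M → ℝ} {k : ℕ}
    {w : R} {Ω Ω' : (Fin k → T) → M → ℝ} (hw : RepresentsAlt g ev U k w Ω)
    (hΩ : ∀ t, ∀ x ∈ U, Ω t x = Ω' t x) : RepresentsAlt g ev U k w Ω' := by
  obtain ⟨r, s, hw, hs⟩ := hw
  exact ⟨r, s, hw, fun t x hx => (hΩ t x hx).symm.trans (hs t x hx)⟩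

theorem RepresentsAlt.add {R S T : Type*} [Ring R] {g : S → R} {ev : S → T → M → ℝ} {k : ℕ}
    {w w' : R} {Ω Ω' : (Fin k → T) → M → ℝ} (hw : RepresentsAlt g ev U k w Ω)
    (hw' : RepresentsAlt g ev U k w' Ω') :
    RepresentsAlt g ev U k (w + w') (fun t x => Ω t x + Ω' t x) := by
  obtain ⟨r, s, rfl, hs⟩ := hw
  obtain ⟨r', s', rfl, hs'⟩ := hw'
  refine ⟨r + r', Fin.append s s', by simp [Fin.sum_univ_add], fun t x hx => ?_⟩
  simp [Fin.sum_univ_add, hs t x hx, hs' t x hx]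

theorem RepresentsAlt.zero {R S T : Type*} [Ring R] {g : S → R} {ev : S → T → M → ℝ} {k : ℕ} :
    RepresentsAlt g ev U k 0 (fun _ _ => 0) :=
  ⟨0, Fin.elim0, by simp, by simp⟩

theorem RepresentsAlt.sum {R S T ι : Type*} [Ring R] {g : S → R} {ev : S → T → M → ℝ} {k : ℕ}
    (I : Finset ι) {w : ι → R} {Ω : ι → (Fin k → T) → M → ℝ}
    (hw : ∀ i ∈ I, RepresentsAlt g ev U k (w i) (Ω i)) :
    RepresentsAlt g ev U k (∑ i ∈ I, w i) (fun t x => ∑ i ∈ I, Ω i t x) := by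
  classical
  induction I using Finset.induction_on with
  | empty => simpa using RepresentsAlt.zero
  | insert a I ha ih =>
    simp only [Finset.sum_insert ha]
    exact (hw a (Finset.mem_insert_self ..)).add
      (ih fun i hi => hw i (Finset.mem_insert_of_mem hi))

theorem RepresentsAlt.mul_two {R S T : Type*} [Ring R] {g : S → R} {ev : S → T → M → ℝ}
    (s₀ s₁ : S) : RepresentsAlt g ev U 2 (g s₀ * g s₁)
      (fun t x => ev s₀ (t 0) x * ev s₁ (t 1) x - ev s₀ (t 1) x * ev s₁ (t 0) x) :=
  ⟨1, fun _ => ![s₀, s₁], by simp, fun t x _ => by simp [Matrix.det_fin_two]⟩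

theorem RepresentsAlt.mul_three {R S T : Type*} [Ring R] {g : S → R} {ev : S → T → M → ℝ}
    (s₀ s₁ s₂ : S) : RepresentsAlt g ev U 3 (g s₀ * (g s₁ * g s₂))
      (fun t x => ev s₀ (t 0) x * (ev s₁ (t 1) x * ev s₂ (t 2) x - ev s₁ (t 2) x * ev s₂ (t 1) x)
        - ev s₀ (t 1) x * (ev s₁ (t 0) x * ev s₂ (t 2) x - ev s₁ (t 2) x * ev s₂ (t 0) x)
        + ev s₀ (t 2) x * (ev s₁ (t 0) x * ev s₂ (t 1) x - ev s₁ (t 1) x * ev s₂ (t 0) x)) :=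
  ⟨1, fun _ => ![s₀, s₁, s₂], by simp [List.ofFn_succ], fun t x _ => by
    simp [Matrix.det_fin_three]; ring⟩

/-- The product of a covector and an element of the second exterior power. -/
theorem RepresentsAlt.cons {R S T : Type*} [Ring R] {g : S → R} {ev : S → T → M → ℝ}
    (s₀ : S) {w : R} {Ω : (Fin 2 → T) → M → ℝ} (hw : RepresentsAlt g ev U 2 w Ω) :
    RepresentsAlt g ev U 3 (g s₀ * w)
      (fun t x => ev s₀ (t 0) x * Ω ![t 1, t 2] x - ev s₀ (t 1) x * Ω ![t 0, t 2] x
        + ev s₀ (t 2) x * Ω ![t 0, t 1] x) := by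
  obtain ⟨r, s, rfl, hs⟩ := hw
  have h := RepresentsAlt.sum (g := g) (ev := ev) (U := U) Finset.univ
    fun j (_ : j ∈ Finset.univ) => RepresentsAlt.mul_three s₀ (s j 0) (s j 1)
  convert! h.congr ?_ using 1
  · simp [Finset.mul_sum]
  · intro t x hx
    simp only [hs _ x hx, Matrix.det_fin_two, Finset.mul_sum, ← Finset.sum_sub_distrib,
      ← Finset.sum_add_distrib]
    refine Finset.sum_congr rfl fun j _ => ?_
    simp

end Represents

/-! ### Function algebras -/

namespace GradedManifold

/-- The function algebras of `𝓜` satisfy the common relations. -/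
class IsCommon (𝓜 : GradedManifold E M) : Prop where
  of_common : ∀ {U : Opens M} {a b : FreeFn (E := E) U}, CommonRel U a b → 𝓜.rel U a b

instance : IsCommon (splitManifold E M) := ⟨SplitRel.of_common⟩
instance : IsCommon (courantManifold E M) := ⟨CourantRel.of_common⟩

variable {𝓜 : GradedManifold E M} {U V : CoordDomain E M}

theorem mk_free (a : Gen (E := E) U.carrier) :
    RingQuot.mkAlgHom ℝ (𝓜.rel U.carrier) a.free = 𝓜.gen U a := rfl

theorem mk_eq {a b : FreeFn (E := E) U.carrier} (h : 𝓜.rel U.carrier a b) :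
    RingQuot.mkAlgHom ℝ (𝓜.rel U.carrier) a = RingQuot.mkAlgHom ℝ (𝓜.rel U.carrier) b :=
  RingQuot.mkAlgHom_rel ℝ h

@[elab_as_elim]
theorem Fn_induction {C : 𝓜.Fn U → Prop} (const : ∀ c : ℝ, C (algebraMap ℝ _ c))
    (gen : ∀ a, C (𝓜.gen U a)) (mul : ∀ x y, C x → C y → C (x * y))
    (add : ∀ x y, C x → C y → C (x + y)) (x : 𝓜.Fn U) : C x := by
  obtain ⟨y, rfl⟩ := RingQuot.mkAlgHom_surjective ℝ (𝓜.rel U.carrier) x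
  induction y using FreeAlgebra.induction with
  | grade0 c => simpa using const c
  | grade1 a => exact gen a
  | mul a b ha hb => simpa using mul _ _ ha hb
  | add a b ha hb => simpa using add _ _ ha hb

theorem algHom_ext {A : Type*} [Semiring A] [Algebra ℝ A] {F G : 𝓜.Fn U →ₐ[ℝ] A}
    (h : ∀ a, F (𝓜.gen U a) = G (𝓜.gen U a)) (x : 𝓜.Fn U) : F x = G x := by
  induction x using Fn_induction with
  | const c => simp
  | gen a => exact h a
  | mul x y hx hy => simp [hx, hy]
  | add x y hx hy => simp [hx, hy]

/-! ### Homogeneous elements -/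

theorem gen_mem (a : Gen (E := E) U.carrier) : 𝓜.gen U a ∈ 𝓜.homogeneous U a.deg :=
  Submodule.subset_span ⟨[a], by simp, by simp⟩

theorem one_mem : (1 : 𝓜.Fn U) ∈ 𝓜.homogeneous U 0 :=
  Submodule.subset_span ⟨[], by simp, by simp⟩

theorem mul_mem {k l : ℕ} {x y : 𝓜.Fn U} (hx : x ∈ 𝓜.homogeneous U k)
    (hy : y ∈ 𝓜.homogeneous U l) : x * y ∈ 𝓜.homogeneous U (k + l) := by
  have := Submodule.mul_mem_mul hx hy
  rw [homogeneous, homogeneous, Submodule.span_mul_span] at this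
  refine Submodule.span_mono ?_ this
  rintro _ ⟨_, ⟨a, ha, rfl⟩, _, ⟨b, hb, rfl⟩, rfl⟩
  exact ⟨a ++ b, by simp [ha, hb], by simp⟩

/-- Homogeneous functions are spanned by words in the generators, so it suffices to follow what
happens when one generator is put in front. -/
theorem homogeneous_induction {C : ℕ → 𝓜.Fn U → Prop}
    (one : C 0 1) (gen_mul : ∀ a k x, x ∈ 𝓜.homogeneous U k → C k x → C (a.deg + k) (𝓜.gen U a * x))
    (zero : ∀ k, C k 0) (add : ∀ k x y, C k x → C k y → C k (x + y))
    (smul : ∀ k (c : ℝ) x, C k x → C k (c • x)) {k : ℕ} {x : 𝓜.Fn U}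
    (hx : x ∈ 𝓜.homogeneous U k) : C k x := by
  induction hx using Submodule.span_induction with
  | mem x h =>
    obtain ⟨l, rfl, rfl⟩ := h
    induction l with
    | nil => simpa using one
    | cons a l ih =>
      simpa using gen_mul a _ _ (Submodule.subset_span ⟨l, rfl, rfl⟩) ih
  | zero => exact zero k
  | add x y _ _ hx hy => exact add _ _ _ hx hy
  | smul c x _ hx => exact smul _ _ _ hx

theorem map_homogeneous {𝓝 : GradedManifold E M} (F : 𝓜.Fn U →ₐ[ℝ] 𝓝.Fn V)
    (h : ∀ a, F (𝓜.gen U a) ∈ 𝓝.homogeneous V a.deg) {k : ℕ} {x : 𝓜.Fn U}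
    (hx : x ∈ 𝓜.homogeneous U k) : F x ∈ 𝓝.homogeneous V k := by
  refine homogeneous_induction (C := fun k x => F x ∈ 𝓝.homogeneous V k) ?_ ?_ ?_ ?_ ?_ hx
  · simpa using one_mem
  · exact fun a k x _ ih => by simpa using mul_mem (h a) ih
  · simp
  · exact fun k x y hx hy => by simpa using add_mem hx hy
  · exact fun k c x hx => by simpa using Submodule.smul_mem _ c hx

variable [IsCommon 𝓜]

theorem gen_comm (a b : Gen (E := E) U.carrier) :
    𝓜.gen U a * 𝓜.gen U b = (-1 : ℝ) ^ (a.deg * b.deg) • (𝓜.gen U b * 𝓜.gen U a) := by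
  simpa [mk_free] using! mk_eq (IsCommon.of_common (𝓜 := 𝓜) (CommonRel.graded_comm a b))

theorem homogeneous_comm_gen {k : ℕ} {x : 𝓜.Fn U} (hx : x ∈ 𝓜.homogeneous U k)
    (b : Gen (E := E) U.carrier) :
    x * 𝓜.gen U b = (-1 : ℝ) ^ (k * b.deg) • (𝓜.gen U b * x) := by
  refine homogeneous_induction (C := fun k x =>
    x * 𝓜.gen U b = (-1 : ℝ) ^ (k * b.deg) • (𝓜.gen U b * x)) ?_ ?_ ?_ ?_ ?_ hx
  · simp
  · intro a k x _ ih
    rw [mul_assoc, ih, mul_smul_comm, ← mul_assoc, gen_comm a b, smul_mul_assoc, smul_smul,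
      mul_assoc, ← pow_add]
    congr 2
    ring
  · simp
  · exact fun k x y hx hy => by rw [add_mul, hx, hy, mul_add, smul_add]
  · exact fun k c x hx => by rw [smul_mul_assoc, hx, mul_smul_comm, smul_comm]

/-- A `SmoothFn` carries arbitrary values outside $U$, and the relations see only those on $U$. This
lemma and its analogues for forms and vector fields make every later pointwise computation on $U$ an
identity in the function algebra. -/
theorem fn_congr {f g : SmoothFn E U.carrier} (h : ∀ x ∈ U.carrier, f.val x = g.val x) :
    𝓜.gen U (.fn f) = 𝓜.gen U (.fn g) := by
  have h0 := mk_eq (IsCommon.of_common (𝓜 := 𝓜)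
    (CommonRel.fn_const 0 (0 : SmoothFn E U.carrier) (fun _ _ => rfl)))
  have h1 := mk_eq (IsCommon.of_common (𝓜 := 𝓜)
    (CommonRel.fn_add g 0 f (fun x hx => by simpa using h x hx)))
  simp only [map_add, mk_free] at h0 h1
  rw [h1, h0]
  simp

theorem fn_comm (f : SmoothFn E U.carrier) (x : 𝓜.Fn U) :
    𝓜.gen U (.fn f) * x = x * 𝓜.gen U (.fn f) := by
  induction x using Fn_induction with
  | const c => exact (Algebra.commutes c _).symm
  | gen a => simpa [Gen.deg] using gen_comm (𝓜 := 𝓜) (.fn f) a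
  | mul x y hx hy => rw [← mul_assoc, hx, mul_assoc, hy, mul_assoc]
  | add x y hx hy => rw [mul_add, hx, hy, add_mul]

/-- Smooth functions as functions on a graded manifold. -/
def fnHom (𝓜 : GradedManifold E M) [IsCommon 𝓜] (U : CoordDomain E M) :
    SmoothFn E U.carrier →+* 𝓜.Fn U where
  toFun f := 𝓜.gen U (.fn f)
  map_one' := by
    simpa [mk_free] using mk_eq (IsCommon.of_common (𝓜 := 𝓜)
      (CommonRel.fn_const 1 (1 : SmoothFn E U.carrier) (fun _ _ => rfl)))
  map_zero' := by
    simpa [mk_free] using mk_eq (IsCommon.of_common (𝓜 := 𝓜)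
      (CommonRel.fn_const 0 (0 : SmoothFn E U.carrier) (fun _ _ => rfl)))
  map_add' f g := by
    simpa [mk_free] using mk_eq (IsCommon.of_common (𝓜 := 𝓜)
      (CommonRel.fn_add f g (f + g) (fun _ _ => rfl)))
  map_mul' f g := by
    simpa [mk_free] using mk_eq (IsCommon.of_common (𝓜 := 𝓜)
      (CommonRel.fn_mul f g (f * g) (fun _ _ => rfl)))

instance : Algebra (SmoothFn E U.carrier) (𝓜.Fn U) :=
  (fnHom 𝓜 U).toAlgebra' fn_comm

theorem fn_smul_def (f : SmoothFn E U.carrier) (x : 𝓜.Fn U) : f • x = 𝓜.gen U (.fn f) * x := rfl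

theorem smul_eq_zero_of_eqOn {f : SmoothFn E U.carrier} (h : ∀ x ∈ U.carrier, f.val x = 0)
    (x : 𝓜.Fn U) : f • x = 0 := by
  rw [fn_smul_def, fn_congr (𝓜 := 𝓜) (g := 0) h]
  exact zero_smul (SmoothFn E U.carrier) x

theorem form_linear (f g : SmoothFn E U.carrier) (α β γ : OneForm E U.carrier)
    (h : ∀ x ∈ U.carrier, γ.val x = f.val x • α.val x + g.val x • β.val x) :
    𝓜.gen U (.form γ) = f • 𝓜.gen U (.form α) + g • 𝓜.gen U (.form β) := by
  simpa [mk_free] using! mk_eq (IsCommon.of_common (𝓜 := 𝓜) (CommonRel.form_linear f g α β γ h))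

theorem vec_linear (f g : SmoothFn E U.carrier) (X Y Z : VecField E U.carrier)
    (h : ∀ x ∈ U.carrier, Z.val x = f.val x • X.val x + g.val x • Y.val x) :
    𝓜.gen U (.vec Z) = f • 𝓜.gen U (.vec X) + g • 𝓜.gen U (.vec Y) := by
  simpa [mk_free] using! mk_eq (IsCommon.of_common (𝓜 := 𝓜) (CommonRel.vec_linear f g X Y Z h))

/-- `1`-forms as functions of degree `1`. -/
def formHom (𝓜 : GradedManifold E M) [IsCommon 𝓜] (U : CoordDomain E M) :
    OneForm E U.carrier →ₗ[SmoothFn E U.carrier] 𝓜.Fn U where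
  toFun α := 𝓜.gen U (.form α)
  map_add' α β := by
    simpa using form_linear (𝓜 := 𝓜) 1 1 α β (α + β) (fun x _ => by simp)
  map_smul' f α := by
    simpa using form_linear (𝓜 := 𝓜) f 0 α 0 (f • α) (fun x _ => by simp)

/-- Vector fields as functions of degree `1`. -/
def vecHom (𝓜 : GradedManifold E M) [IsCommon 𝓜] (U : CoordDomain E M) :
    VecField E U.carrier →ₗ[SmoothFn E U.carrier] 𝓜.Fn U where
  toFun X := 𝓜.gen U (.vec X)
  map_add' X Y := by
    simpa using vec_linear (𝓜 := 𝓜) 1 1 X Y (X + Y) (fun x _ => by simp)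
  map_smul' f X := by
    simpa using vec_linear (𝓜 := 𝓜) f 0 X 0 (f • X) (fun x _ => by simp)

theorem formHom_apply (α : OneForm E U.carrier) : formHom 𝓜 U α = 𝓜.gen U (.form α) := rfl
theorem vecHom_apply (X : VecField E U.carrier) : vecHom 𝓜 U X = 𝓜.gen U (.vec X) := rfl

theorem formHom_congr {α β : OneForm E U.carrier} (h : ∀ x ∈ U.carrier, α.val x = β.val x) :
    formHom 𝓜 U α = formHom 𝓜 U β := by
  simpa using! form_linear (𝓜 := 𝓜) 1 0 β 0 α (fun x hx => by simpa using h x hx)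

theorem vecHom_congr {X Y : VecField E U.carrier} (h : ∀ x ∈ U.carrier, X.val x = Y.val x) :
    vecHom 𝓜 U X = vecHom 𝓜 U Y := by
  simpa using! vec_linear (𝓜 := 𝓜) 1 0 Y 0 X (fun x hx => by simpa using h x hx)

theorem formHom_mem (α : OneForm E U.carrier) : formHom 𝓜 U α ∈ 𝓜.homogeneous U 1 :=
  gen_mem (𝓜 := 𝓜) (.form α)

theorem vecHom_mem (X : VecField E U.carrier) : vecHom 𝓜 U X ∈ 𝓜.homogeneous U 1 :=
  gen_mem (𝓜 := 𝓜) (.vec X)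

theorem formHom_anticomm (α β : OneForm E U.carrier) :
    formHom 𝓜 U α * formHom 𝓜 U β = -(formHom 𝓜 U β * formHom 𝓜 U α) := by
  simpa [Gen.deg] using! gen_comm (𝓜 := 𝓜) (.form α) (.form β)

theorem vecHom_anticomm (X Y : VecField E U.carrier) :
    vecHom 𝓜 U X * vecHom 𝓜 U Y = -(vecHom 𝓜 U Y * vecHom 𝓜 U X) := by
  simpa [Gen.deg] using! gen_comm (𝓜 := 𝓜) (.vec X) (.vec Y)

theorem formHom_vecHom_anticomm (α : OneForm E U.carrier) (X : VecField E U.carrier) :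
    formHom 𝓜 U α * vecHom 𝓜 U X = -(vecHom 𝓜 U X * formHom 𝓜 U α) := by
  simpa [Gen.deg] using! gen_comm (𝓜 := 𝓜) (.form α) (.vec X)

/-- Graded commutativity says only that the square of an odd element equals its own negative. It
vanishes because $2$ is invertible, which is what makes products of covectors alternating. -/
theorem eq_zero_of_eq_neg {x : 𝓜.Fn U} (h : x = -x) : x = 0 := by
  have h2 : (2 : ℝ) • x = 0 := by rw [two_smul]; exact add_eq_zero_iff_eq_neg.2 h
  exact (smul_eq_zero_iff_right (two_ne_zero' ℝ)).1 h2

theorem formHom_sq (α : OneForm E U.carrier) : formHom 𝓜 U α * formHom 𝓜 U α = 0 :=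
  eq_zero_of_eq_neg (formHom_anticomm α α)

end GradedManifold

/-! ### Graded derivations -/

namespace GradedManifold

variable {𝓜 : GradedManifold E M} {U V : CoordDomain E M}

/-- Graded derivations of odd degree of a function algebra. -/
def IsGradedDer (Q : 𝓜.Fn U →ₗ[ℝ] 𝓜.Fn U) : Prop :=
  ∀ k, ∀ a ∈ 𝓜.homogeneous U k, ∀ b, Q (a * b) = Q a * b + (-1 : ℝ) ^ k • (a * Q b)

namespace IsGradedDer

variable {Q Q' : 𝓜.Fn U →ₗ[ℝ] 𝓜.Fn U}

theorem map_one (hQ : IsGradedDer Q) : Q 1 = 0 := by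
  simpa using hQ 0 1 one_mem 1

theorem gen_mul (hQ : IsGradedDer Q) (a : Gen (E := E) U.carrier) (x : 𝓜.Fn U) :
    Q (𝓜.gen U a * x) = Q (𝓜.gen U a) * x + (-1 : ℝ) ^ a.deg • (𝓜.gen U a * Q x) :=
  hQ _ _ (gen_mem a) x

theorem exists_sum_prod (x : 𝓜.Fn U) :
    x ∈ Submodule.span ℝ {w | ∃ l : List (Gen (E := E) U.carrier), (l.map (𝓜.gen U)).prod = w} := by
  induction x using Fn_induction with
  | const c =>
    rw [Algebra.algebraMap_eq_smul_one]
    exact Submodule.smul_mem _ _ (Submodule.subset_span ⟨[], by simp⟩)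
  | gen a => exact Submodule.subset_span ⟨[a], by simp⟩
  | mul x y hx hy =>
    have := Submodule.mul_mem_mul hx hy
    rw [Submodule.span_mul_span] at this
    refine Submodule.span_mono ?_ this
    rintro _ ⟨_, ⟨a, rfl⟩, _, ⟨b, rfl⟩, rfl⟩
    exact ⟨a ++ b, by simp⟩
  | add x y hx hy => exact add_mem hx hy

theorem ext (hQ : IsGradedDer Q) (hQ' : IsGradedDer Q')
    (h : ∀ a, Q (𝓜.gen U a) = Q' (𝓜.gen U a)) : Q = Q' := by
  refine LinearMap.ext fun x => ?_
  induction exists_sum_prod x using Submodule.span_induction with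
  | mem x hx =>
    obtain ⟨l, rfl⟩ := hx
    induction l with
    | nil => simp [hQ.map_one, hQ'.map_one]
    | cons a l ih => simp [hQ.gen_mul, hQ'.gen_mul, h, ih]
  | zero => simp
  | add x y _ _ hx hy => simp [hx, hy]
  | smul c x _ hx => simp [hx]

theorem mem_homogeneous (hQ : IsGradedDer Q)
    (h : ∀ a, Q (𝓜.gen U a) ∈ 𝓜.homogeneous U (a.deg + 1)) {k : ℕ} {x : 𝓜.Fn U}
    (hx : x ∈ 𝓜.homogeneous U k) : Q x ∈ 𝓜.homogeneous U (k + 1) := by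
  refine (homogeneous_induction
    (C := fun k x => x ∈ 𝓜.homogeneous U k ∧ Q x ∈ 𝓜.homogeneous U (k + 1)) ?_ ?_ ?_ ?_ ?_ hx).2
  · exact ⟨one_mem, by simp [hQ.map_one]⟩
  · rintro a k x - ⟨hx, hQx⟩
    refine ⟨mul_mem (gen_mem a) hx, ?_⟩
    rw [hQ.gen_mul]
    refine add_mem ?_ (Submodule.smul_mem _ _ ?_)
    · have := mul_mem (h a) hx
      rwa [add_right_comm] at this
    · have := mul_mem (gen_mem a) hQx
      rwa [← add_assoc] at this
  · simp
  · exact fun k x y hx hy => ⟨add_mem hx.1 hy.1, by simpa using add_mem hx.2 hy.2⟩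
  · exact fun k c x hx => ⟨Submodule.smul_mem _ _ hx.1, by simpa using Submodule.smul_mem _ c hx.2⟩

/-- The square of an odd derivation is an ordinary derivation: in $Q(Q(ax))$ the two terms $Qa\cdot
Qx$ carry opposite signs because $Qa$ has degree one more than $a$. Hence vanishing on generators is
enough. -/
theorem sq_eq_zero (hQ : IsGradedDer Q)
    (hd : ∀ a, Q (𝓜.gen U a) ∈ 𝓜.homogeneous U (a.deg + 1))
    (h : ∀ a, Q (Q (𝓜.gen U a)) = 0) (x : 𝓜.Fn U) : Q (Q x) = 0 := by
  induction exists_sum_prod x using Submodule.span_induction with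
  | mem x hx =>
    obtain ⟨l, rfl⟩ := hx
    induction l with
    | nil => simp [hQ.map_one]
    | cons a l ih =>
      simp only [List.map_cons, List.prod_cons, hQ.gen_mul, map_add, map_smul, ih,
        hQ _ _ (hd a), h, pow_succ]
      simp only [mul_neg, mul_one, smul_zero, mul_zero, zero_mul, add_zero, zero_add]
      module
  | zero => simp
  | add x y _ _ hx hy => simp [hx, hy]
  | smul c x _ hx => simp [hx]

/-- Since $\rho$ takes generators to generators of the same degree, both sides obey the same signed
Leibniz rule along words. -/
theorem natural (hQ : IsGradedDer Q) {Q' : 𝓜.Fn V →ₗ[ℝ] 𝓜.Fn V} (hQ' : IsGradedDer Q')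
    {ρ : 𝓜.Fn U →ₐ[ℝ] 𝓜.Fn V} (hρ : ∀ a, ∃ b, b.deg = a.deg ∧ ρ (𝓜.gen U a) = 𝓜.gen V b)
    (h : ∀ a, ρ (Q (𝓜.gen U a)) = Q' (ρ (𝓜.gen U a))) (x : 𝓜.Fn U) : ρ (Q x) = Q' (ρ x) := by
  induction exists_sum_prod x using Submodule.span_induction with
  | mem x hx =>
    obtain ⟨l, rfl⟩ := hx
    induction l with
    | nil => simp [hQ.map_one, hQ'.map_one]
    | cons a l ih =>
      obtain ⟨b, hb, hab⟩ := hρ a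
      simp only [List.map_cons, List.prod_cons, hQ.gen_mul, map_add, map_smul, map_mul, ih, h a]
      rw [hab, hQ'.gen_mul, hb]
  | zero => simp
  | add x y _ _ hx hy => simp [hx, hy]
  | smul c x _ hx => simp [hx]

end IsGradedDer

theorem HomologicalField.isGradedDer (Q : 𝓜.HomologicalField) (U : CoordDomain E M) :
    IsGradedDer (Q.Q U) := Q.leibniz U

theorem HomologicalField.ext_gen {Q Q' : 𝓜.HomologicalField}
    (h : ∀ U a, Q.Q U (𝓜.gen U a) = Q'.Q U (𝓜.gen U a)) : Q = Q' :=
  HomologicalField.ext (funext fun U => (Q.isGradedDer U).ext (Q'.isGradedDer U) (h U))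

/-- A homological vector field from its values on the generators. -/
def HomologicalField.ofGen (Q : ∀ U : CoordDomain E M, 𝓜.Fn U →ₗ[ℝ] 𝓜.Fn U)
    (hQ : ∀ U, IsGradedDer (Q U))
    (hd : ∀ U a, Q U (𝓜.gen U a) ∈ 𝓜.homogeneous U (a.deg + 1))
    (hs : ∀ U a, Q U (Q U (𝓜.gen U a)) = 0)
    (hn : ∀ {U V : CoordDomain E M} (h : V.carrier ≤ U.carrier) (a : Gen (E := E) U.carrier),
      𝓜.res h (Q U (𝓜.gen U a)) = Q V (𝓜.gen V (a.res h))) : 𝓜.HomologicalField where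
  Q := Q
  degree_one U _ _ ha := (hQ U).mem_homogeneous (hd U) ha
  leibniz := hQ
  square_zero U := (hQ U).sq_eq_zero (hd U) (hs U)
  natural {U V} h := IsGradedDer.natural (hQ U) (hQ V) (fun a => ⟨a.res h, Gen.deg_res h a, 𝓜.res_gen h a⟩)
    (fun a => by rw [hn, res_gen])

/-! ### Construction of derivations -/

/-- The homomorphism `a ↦ (±a, d a; 0, a)` defined by values `d` on the generators. -/
def derMatrix (d : Gen (E := E) U.carrier → 𝓜.Fn U) :
    FreeFn (E := E) U.carrier →ₐ[ℝ] Matrix (Fin 2) (Fin 2) (𝓜.Fn U) :=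
  FreeAlgebra.lift ℝ fun a => !![(-1 : ℝ) ^ a.deg • 𝓜.gen U a, d a; 0, 𝓜.gen U a]

theorem derMatrix_free (d : Gen (E := E) U.carrier → 𝓜.Fn U) (a : Gen (E := E) U.carrier) :
    derMatrix d a.free = !![(-1 : ℝ) ^ a.deg • 𝓜.gen U a, d a; 0, 𝓜.gen U a] := by
  simp [derMatrix, Gen.free]

section Lift

variable (d : Gen (E := E) U.carrier → 𝓜.Fn U)
  (hd : ∀ ⦃a b⦄, 𝓜.rel U.carrier a b → derMatrix d a = derMatrix d b)

/-- The homomorphism `a ↦ (±a, d a; 0, a)` on the function algebra. -/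
def derHom : 𝓜.Fn U →ₐ[ℝ] Matrix (Fin 2) (Fin 2) (𝓜.Fn U) :=
  RingQuot.liftAlgHom ℝ ⟨derMatrix d, hd⟩

theorem derHom_gen (a : Gen (E := E) U.carrier) :
    derHom d hd (𝓜.gen U a) = !![(-1 : ℝ) ^ a.deg • 𝓜.gen U a, d a; 0, 𝓜.gen U a] := by
  rw [← derMatrix_free, derHom, ← mk_free, RingQuot.liftAlgHom_mkAlgHom_apply]

/-- The derivation with values `d` on the generators. -/
def derLift : 𝓜.Fn U →ₗ[ℝ] 𝓜.Fn U where
  toFun x := derHom d hd x 0 1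
  map_add' x y := by simp
  map_smul' c x := by simp

theorem derLift_gen (a : Gen (E := E) U.carrier) : derLift d hd (𝓜.gen U a) = d a := by
  simp [derLift, derHom_gen]

theorem derHom_one_one (x : 𝓜.Fn U) : derHom d hd x 1 0 = 0 ∧ derHom d hd x 1 1 = x := by
  induction x using Fn_induction with
  | const c => simp [Matrix.algebraMap_matrix_apply]
  | gen a => simp [derHom_gen]
  | mul x y hx hy => simp [Matrix.mul_apply, hx, hy]
  | add x y hx hy => simp [hx, hy]

/-- The upper left entry carries the sign of the graded Leibniz rule: the corner of a product of two
such matrices is $\pm a\,d(b)+d(a)\,b$. -/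
theorem derHom_zero_zero {k : ℕ} {x : 𝓜.Fn U} (hx : x ∈ 𝓜.homogeneous U k) :
    derHom d hd x 0 0 = (-1 : ℝ) ^ k • x := by
  refine homogeneous_induction (C := fun k x => derHom d hd x 0 0 = (-1 : ℝ) ^ k • x)
    ?_ ?_ ?_ ?_ ?_ hx
  · simp
  · intro a k x _ ih
    simp [Matrix.mul_apply, derHom_gen, ih, derHom_one_one, smul_smul, pow_add, mul_comm]
  · simp
  · exact fun k x y hx hy => by simp [hx, hy]
  · exact fun k c x hx => by simp [hx, smul_comm c]

theorem isGradedDer_derLift : IsGradedDer (derLift d hd) := by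
  intro k x hx y
  simp [derLift, Matrix.mul_apply, derHom_zero_zero d hd hx, derHom_one_one, add_comm]

end Lift

variable [IsCommon 𝓜]

/-- The relations among functions hold by the sum and product rules for $df$, and those for forms
and contractions are the hypotheses `hform` and `hvec`. Graded commutativity needs only that $d$
raises degrees by one. -/
theorem derMatrix_common (d : Gen (E := E) U.carrier → 𝓜.Fn U)
    (hdeg : ∀ a, d a ∈ 𝓜.homogeneous U (a.deg + 1))
    (hfn : ∀ f, d (.fn f) = formHom 𝓜 U f.d)
    (hform : ∀ (f g : SmoothFn E U.carrier) (α β γ : OneForm E U.carrier),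
      (∀ x ∈ U.carrier, γ.val x = f.val x • α.val x + g.val x • β.val x) →
      d (.form γ) = formHom 𝓜 U f.d * formHom 𝓜 U α + f • d (.form α)
        + (formHom 𝓜 U g.d * formHom 𝓜 U β + g • d (.form β)))
    (hvec : ∀ (f g : SmoothFn E U.carrier) (X Y Z : VecField E U.carrier),
      (∀ x ∈ U.carrier, Z.val x = f.val x • X.val x + g.val x • Y.val x) →
      d (.vec Z) = formHom 𝓜 U f.d * vecHom 𝓜 U X + f • d (.vec X)
        + (formHom 𝓜 U g.d * vecHom 𝓜 U Y + g • d (.vec Y)))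
    {a b : FreeFn (E := E) U.carrier} (h : CommonRel U.carrier a b) :
    derMatrix d a = derMatrix d b := by
  have h' := mk_eq (IsCommon.of_common (𝓜 := 𝓜) h)
  cases h with
  | fn_const c f h =>
    have h0 : formHom 𝓜 U f.d = 0 := by
      rw [formHom_congr (β := 0), map_zero]
      intro x hx
      rw [SmoothFn.d_congr (g := SmoothFn.const _ c) h hx, SmoothFn.d_const]; rfl
    simp only [mk_free, AlgHom.commutes] at h'
    rw [derMatrix_free, AlgHom.commutes, hfn, h0, h']
    ext i j; fin_cases i <;> fin_cases j <;> simp [Gen.deg, Matrix.algebraMap_matrix_apply]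
  | fn_add f g k h =>
    have h0 : formHom 𝓜 U k.d = formHom 𝓜 U f.d + formHom 𝓜 U g.d := by
      rw [← map_add]
      refine formHom_congr fun x hx => ?_
      rw [SmoothFn.d_congr (g := f + g) h hx, SmoothFn.d_add _ _ hx]; rfl
    simp only [mk_free, map_add] at h'
    rw [map_add, derMatrix_free, derMatrix_free, derMatrix_free, hfn, hfn, hfn, h0, h']
    ext i j; fin_cases i <;> fin_cases j <;> simp [Gen.deg]
  | fn_mul f g k h =>
    have h0 : formHom 𝓜 U k.d = f • formHom 𝓜 U g.d + g • formHom 𝓜 U f.d := by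
      rw [← map_smul, ← map_smul, ← map_add]
      refine formHom_congr fun x hx => ?_
      rw [SmoothFn.d_congr (g := f * g) h hx, SmoothFn.d_mul _ _ hx]; rfl
    simp only [mk_free, map_mul] at h'
    rw [map_mul, derMatrix_free, derMatrix_free, derMatrix_free, hfn, hfn, hfn, h0, h']
    ext i j; fin_cases i <;> fin_cases j <;> simp [Gen.deg, Matrix.mul_apply, fn_smul_def, fn_comm g]
  | form_linear f g α β γ h =>
    simp only [mk_free, map_add, map_mul] at h'
    simp only [map_add, map_mul, derMatrix_free, hfn, hform f g α β γ h, h']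
    ext i j; fin_cases i <;> fin_cases j <;>
      simp [Gen.deg, fn_smul_def, formHom_apply]
    · module
    · abel
  | vec_linear f g X Y Z h =>
    simp only [mk_free, map_add, map_mul] at h'
    simp only [map_add, map_mul, derMatrix_free, hfn, hvec f g X Y Z h, h']
    ext i j; fin_cases i <;> fin_cases j <;>
      simp [Gen.deg, fn_smul_def, formHom_apply, vecHom_apply]
    · module
    · abel
  | graded_comm a b =>
    simp only [mk_free, map_smul, map_mul] at h'
    have h1 := homogeneous_comm_gen (hdeg a) b
    have h2 := homogeneous_comm_gen (hdeg b) a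
    simp only [map_smul, map_mul, derMatrix_free]
    ext i j; fin_cases i <;> fin_cases j <;> simp [Matrix.mul_apply]
    · rw [h', smul_comm (_ ^ b.deg), smul_comm (_ ^ a.deg), smul_comm (_ ^ b.deg)]
      module
    -- Commuting $a$ past $d(b)$, of degree $\deg b+1$, costs the commutation sign of $a$ and $b$
    -- and a further $(-1)^{\deg a}$, which is the sign in the Leibniz rule.
    · have e1 (m n : ℕ) : (-1 : ℝ) ^ (m * n) * (-1) ^ ((n + 1) * m) = (-1) ^ m := by
        rw [← pow_add, show m * n + (n + 1) * m = 2 * (m * n) + m by ring, pow_add, pow_mul]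
        simp
      rw [h1, h2, smul_smul, smul_smul, e1, ← e1 b.deg a.deg, mul_comm b.deg a.deg, ← mul_assoc,
        ← pow_add, ← two_mul, pow_mul]
      simp [add_comm]
    · exact h'

end GradedManifold

/-! ### Calculus in a coordinate frame -/

section Frames

variable {U V : Opens M}

namespace VecField

theorem der_congr (X : VecField E U) {f g : SmoothFn E U} (h : ∀ x ∈ U, f.val x = g.val x) {x : M}
    (hx : x ∈ U) : (X.der f).val x = (X.der g).val x :=
  congrArg (fun L => L (X.val x)) (SmoothFn.d_congr h hx)

theorem der_add (X : VecField E U) (f g : SmoothFn E U) {x : M} (hx : x ∈ U) :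
    (X.der (f + g)).val x = (X.der f).val x + (X.der g).val x :=
  congrArg (fun L => L (X.val x)) (SmoothFn.d_add f g hx)

theorem der_sub (X : VecField E U) (f g : SmoothFn E U) {x : M} (hx : x ∈ U) :
    (X.der (f - g)).val x = (X.der f).val x - (X.der g).val x :=
  congrArg (fun L => L (X.val x)) (SmoothFn.d_sub f g hx)

theorem der_neg (X : VecField E U) (f : SmoothFn E U) (x : M) :
    (X.der (-f)).val x = -(X.der f).val x :=
  congrArg (fun L => L (X.val x)) (SmoothFn.d_neg f x)

theorem der_mul (X : VecField E U) (f g : SmoothFn E U) {x : M} (hx : x ∈ U) :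
    (X.der (f * g)).val x = f.val x * (X.der g).val x + g.val x * (X.der f).val x :=
  congrArg (fun L => L (X.val x)) (SmoothFn.d_mul f g hx)

theorem der_sum {ι : Type*} (s : Finset ι) (X : VecField E U) (f : ι → SmoothFn E U) {x : M}
    (hx : x ∈ U) : (X.der (∑ i ∈ s, f i)).val x = ∑ i ∈ s, (X.der (f i)).val x := by
  rw [val_der_apply, SmoothFn.d_sum s f hx, sum_apply]
  rfl

end VecField

theorem OneForm.pair_smul (α : OneForm E U) (f : SmoothFn E U) (X : VecField E U) (x : M) :
    (α.pair (f • X)).val x = f.val x * (α.pair X).val x :=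
  map_smul (α.val x) (f.val x) (X.val x)

theorem OneForm.pair_add (α : OneForm E U) (X Y : VecField E U) (x : M) :
    (α.pair (X + Y)).val x = (α.pair X).val x + (α.pair Y).val x :=
  map_add (α.val x) (X.val x) (Y.val x)

theorem OneForm.pair_sum {ι : Type*} (s : Finset ι) (α : OneForm E U) (X : ι → VecField E U)
    (x : M) : (α.pair (∑ i ∈ s, X i)).val x = ∑ i ∈ s, (α.pair (X i)).val x := by
  rw [val_pair_apply, VecField.val_sum]
  exact map_sum (α.val x) _ _

theorem OneForm.sum_pair {ι : Type*} (s : Finset ι) (α : ι → OneForm E U) (X : VecField E U)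
    (x : M) : ((∑ i ∈ s, α i).pair X).val x = ∑ i ∈ s, ((α i).pair X).val x := by
  rw [val_pair_apply, OneForm.val_sum, sum_apply]
  rfl

namespace Frame

variable (F : Frame E U)

/-- The coordinate `1`-forms. -/
def θ (i : Fin F.n) : OneForm E U := (F.q i).d

theorem pair_eq (α : OneForm E U) (Y : VecField E U) {x : M} (hx : x ∈ U) :
    (α.pair Y).val x = ∑ i, (α.pair (F.e i)).val x * ((F.θ i).pair Y).val x := by
  rw [OneForm.val_pair_apply, ← F.expand x hx (Y.val x)]
  refine (map_sum (α.val x) _ _).trans (Finset.sum_congr rfl fun i _ => ?_)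
  refine (map_smul (α.val x) _ _).trans (mul_comm _ _)

theorem form_eq (α : OneForm E U) {x : M} (hx : x ∈ U) :
    α.val x = (∑ i, α.pair (F.e i) • F.θ i).val x := by
  refine ContinuousLinearMap.ext fun v => ?_
  rw [OneForm.val_sum, sum_apply, ← F.expand x hx v]
  refine (map_sum (α.val x) _ _).trans (Finset.sum_congr rfl fun i _ => ?_)
  rw [F.expand x hx v]
  refine (map_smul (α.val x) _ _).trans (mul_comm _ _)

theorem vec_eq (X : VecField E U) {x : M} (hx : x ∈ U) :
    X.val x = (∑ i, (F.θ i).pair X • F.e i).val x := by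
  rw [VecField.val_sum]
  exact (F.expand x hx (X.val x)).symm

/-- The differential of a `1`-form in terms of its components. -/
theorem sum_der [CompleteSpace E] (α : OneForm E U) (Y Z : VecField E U) {x : M} (hx : x ∈ U) :
    ∑ i, ((Y.der (α.pair (F.e i))).val x * ((F.θ i).pair Z).val x
        - (Z.der (α.pair (F.e i))).val x * ((F.θ i).pair Y).val x) =
      (Y.der (α.pair Z)).val x - (Z.der (α.pair Y)).val x - (α.pair (Y.bracket Z)).val x := by
  -- The product rule for $\alpha(Z)=\sum_i\alpha(e_i)\,Zq^i$. In the difference of the two orders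
  -- the second derivatives of $q^i$ combine to $[Y,Z]q^i$, that is, to $\theta^i([Y,Z])$.
  have h (Y Z : VecField E U) : (Y.der (α.pair Z)).val x =
      ∑ i, ((α.pair (F.e i)).val x * (Y.der (Z.der (F.q i))).val x
        + ((F.θ i).pair Z).val x * (Y.der (α.pair (F.e i))).val x) := by
    rw [Y.der_congr (g := ∑ i, α.pair (F.e i) * (F.θ i).pair Z)
      (fun y hy => by rw [SmoothFn.val_sum]; exact F.pair_eq α Z hy) hx, VecField.der_sum _ _ _ hx]
    exact Finset.sum_congr rfl fun i _ => Y.der_mul _ _ hx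
  rw [h Y Z, h Z Y, F.pair_eq α _ hx, ← Finset.sum_sub_distrib, ← Finset.sum_sub_distrib]
  refine Finset.sum_congr rfl fun i _ => ?_
  have := VecField.der_bracket Y Z (F.q i) hx
  rw [show ((F.θ i).pair (Y.bracket Z)).val x = _ from this]
  ring

/-- Halves of the coordinate `1`-forms. -/
def halfθ (i : Fin F.n) : OneForm E U := (SmoothFn.const U 2⁻¹ : SmoothFn E U) • F.θ i

theorem pairForm_halfθ (i : Fin F.n) (Y : VecField E U) (x : M) :
    pairForm (F.halfθ i) Y x = 2⁻¹ * ((F.θ i).pair Y).val x := rfl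

/-- Restriction of coordinates to a smaller open set. -/
def res (h : V ≤ U) : Frame E V where
  n := F.n
  q i := (F.q i).res h
  e i := (F.e i).res h
  expand x hx := F.expand x (h hx)

end Frame

namespace ThreeForm

variable (H : ThreeForm E M)

theorem contract_pair_rotate (X Y Z : VecField E U) (x : M) :
    ((H.contract X Y).pair Z).val x = ((H.contract Y Z).pair X).val x :=
  H.val_rotate x _ _ _

theorem contract_pair_swap (X Y Z : VecField E U) (x : M) :
    ((H.contract X Y).pair Z).val x = -((H.contract X Z).pair Y).val x :=
  H.val_swap_right x _ _ _

theorem contract_linear (f g : SmoothFn E U) {X Y Z : VecField E U}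
    (h : ∀ x ∈ U, Z.val x = f.val x • X.val x + g.val x • Y.val x) (W : VecField E U)
    {x : M} (hx : x ∈ U) : (H.contract Z W).val x =
      f.val x • (H.contract X W).val x + g.val x • (H.contract Y W).val x := by
  refine ContinuousLinearMap.ext fun v => ?_
  rw [val_contract_apply, h x hx, H.val_add₁, H.val_smul₁, H.val_smul₁]
  rfl

end ThreeForm

end Frames

/-! ### Differential forms in a function algebra -/

section Forms

variable {U : Opens M} {R : Type*} [Ring R] [Algebra (SmoothFn E U) R]

/-- An embedding of the `1`-forms on `U` into an algebra in which the images of `1`-forms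
anticommute, and in which all functions that vanish on `U` are zero. -/
structure IsFormMap (φ : OneForm E U →ₗ[SmoothFn E U] R) : Prop where
  congr : ∀ {α β : OneForm E U}, (∀ x ∈ U, α.val x = β.val x) → φ α = φ β
  sq : ∀ α, φ α * φ α = 0
  smul_eq_zero : ∀ f : SmoothFn E U, (∀ x ∈ U, f.val x = 0) → ∀ r : R, f • r = 0

variable {φ : OneForm E U →ₗ[SmoothFn E U] R} (F : Frame E U)

namespace IsFormMap

theorem anticomm (hφ : IsFormMap φ) (α β : OneForm E U) : φ α * φ β = -(φ β * φ α) := by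
  have h := hφ.sq (α + β)
  rw [map_add, mul_add, add_mul, add_mul, hφ.sq, hφ.sq, zero_add, add_zero, add_comm] at h
  exact eq_neg_of_add_eq_zero_left h

theorem expand (hφ : IsFormMap φ) (α : OneForm E U) :
    φ α = ∑ i, α.pair (F.e i) • φ (F.θ i) := by
  rw [hφ.congr (fun x hx => F.form_eq α hx), map_sum]
  simp only [map_smul]

theorem linear (hφ : IsFormMap φ) (f g : SmoothFn E U) {α β γ : OneForm E U}
    (h : ∀ x ∈ U, γ.val x = f.val x • α.val x + g.val x • β.val x) :
    φ γ = f • φ α + g • φ β := by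
  rw [hφ.congr (β := f • α + g • β) h, map_add, map_smul, map_smul]

theorem d_linear (hφ : IsFormMap φ) (f g a b : SmoothFn E U) {c : SmoothFn E U}
    (h : ∀ x ∈ U, c.val x = f.val x * a.val x + g.val x * b.val x) :
    φ c.d = f • φ a.d + a • φ f.d + (g • φ b.d + b • φ g.d) := by
  simp only [← map_smul, ← map_add]
  refine hφ.congr fun x hx => ?_
  rw [SmoothFn.d_congr (g := f * a + g * b) h hx, SmoothFn.d_add _ _ hx, SmoothFn.d_mul _ _ hx,
    SmoothFn.d_mul _ _ hx]
  rfl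

theorem unique (hφ : IsFormMap φ) (F : Frame E U) [Module ℝ R] {k : ℕ} {w w' : R}
    {Ω : (Fin k → VecField E U) → M → ℝ}
    (hw : RepresentsAlt φ pairForm U k w Ω) (hw' : RepresentsAlt φ pairForm U k w' Ω) : w = w' :=
  RepresentsAlt.unique hφ.sq hφ.smul_eq_zero F.θ F.e (fun α i => α.pair (F.e i))
    (fun _ _ _ _ => rfl) (hφ.expand F) hw hw' (fun _ _ _ => rfl)

end IsFormMap

variable (φ) in
/-- The exterior derivative of a `1`-form. -/
def dForm (α : OneForm E U) : R := ∑ i, φ (α.pair (F.e i)).d * φ (F.θ i)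

theorem dForm_linear (hφ : IsFormMap φ) (f g : SmoothFn E U) {α β γ : OneForm E U}
    (h : ∀ x ∈ U, γ.val x = f.val x • α.val x + g.val x • β.val x) :
    dForm φ F γ = φ f.d * φ α + f • dForm φ F α + (φ g.d * φ β + g • dForm φ F β) := by
  have h1 (i) : φ (γ.pair (F.e i)).d = _ := hφ.d_linear f g (α.pair (F.e i)) (β.pair (F.e i))
    (fun x hx => by rw [OneForm.val_pair_apply, h x hx]; rfl)
  rw [hφ.expand F α, hφ.expand F β]
  simp only [dForm, h1, Finset.mul_sum, Finset.smul_sum, add_mul, Finset.sum_add_distrib,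
    smul_mul_assoc, mul_smul_comm]
  abel

theorem dForm_represents [CompleteSpace E] (α : OneForm E U) :
    RepresentsAlt φ pairForm U 2 (dForm φ F α)
      (fun Y => der (Y 0).val (pairForm α (Y 1)) - der (Y 1).val (pairForm α (Y 0))
        - fun x => α.val x (bra (Y 0).val (Y 1).val x)) := by
  refine (RepresentsAlt.sum Finset.univ fun i _ => RepresentsAlt.mul_two _ _).congr
    fun Y x hx => ?_
  exact F.sum_der α (Y 0) (Y 1) hx

theorem dForm_d [CompleteSpace E] [Module ℝ R] (hφ : IsFormMap φ) (f : SmoothFn E U) :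
    dForm φ F f.d = 0 := by
  refine hφ.unique F (dForm_represents F _) (RepresentsAlt.zero.congr fun Y x hx => ?_)
  have := VecField.der_bracket (Y 0) (Y 1) f hx
  exact (sub_eq_zero.2 this.symm).symm

theorem dForm_halfθ [CompleteSpace E] [Module ℝ R] (hφ : IsFormMap φ) (i : Fin F.n) :
    dForm φ F (F.halfθ i) = 0 := by
  have h0 : φ (SmoothFn.const U 2⁻¹ : SmoothFn E U).d = 0 := by
    rw [hφ.congr (β := 0) (fun x _ => SmoothFn.d_const _ x), map_zero]
  have h1 : φ (0 : SmoothFn E U).d = 0 := by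
    rw [hφ.congr (β := 0) (fun x _ => SmoothFn.d_zero x), map_zero]
  rw [dForm_linear F hφ (SmoothFn.const U 2⁻¹) 0 (α := F.θ i) (β := 0)
    (fun x _ => by simp [Frame.halfθ]), h0, Frame.θ, dForm_d F hφ]
  simp [h1]

variable (H : ThreeForm E M)

variable (φ) in
/-- The `2`-form `i_X H`. -/
def iForm (X : VecField E U) : R := ∑ i, φ (F.halfθ i) * φ (H.contract X (F.e i))

theorem iForm_linear (hφ : IsFormMap φ) (f g : SmoothFn E U) {X Y Z : VecField E U}
    (h : ∀ x ∈ U, Z.val x = f.val x • X.val x + g.val x • Y.val x) :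
    iForm φ F H Z = f • iForm φ F H X + g • iForm φ F H Y := by
  have h1 (i) : φ (H.contract Z (F.e i)) = _ :=
    hφ.linear f g (fun x hx => H.contract_linear f g h _ hx)
  simp only [iForm, h1, Finset.smul_sum, mul_add, Finset.sum_add_distrib, mul_smul_comm]

/-- On $(Y,Z)$ the sum of the $\theta^i\wedge H(X,e_i,\cdot)$ has the value
$H(X,Y,Z)-H(X,Z,Y)=2H(X,Y,Z)$, which explains the halved coordinate forms. -/
theorem iForm_represents (X : VecField E U) :
    RepresentsAlt φ pairForm U 2 (iForm φ F H X)
      (fun Y => H.app X.val (Y 0).val (Y 1).val) := by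
  refine (RepresentsAlt.sum Finset.univ fun i _ => RepresentsAlt.mul_two _ _).congr
    fun Y x hx => ?_
  have h (Y Z : VecField E U) : ((H.contract X Y).pair Z).val x / 2 =
      ∑ i, pairForm (F.halfθ i) Y x * ((H.contract X (F.e i)).pair Z).val x := by
    rw [← H.contract_pair_rotate, F.pair_eq _ _ hx, Finset.sum_div]
    refine Finset.sum_congr rfl fun i _ => ?_
    rw [H.contract_pair_rotate Z, F.pairForm_halfθ]
    ring
  rw [Finset.sum_sub_distrib]
  refine Eq.trans (congrArg₂ (· - ·) (h (Y 0) (Y 1)).symm (h (Y 1) (Y 0)).symm) ?_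
  rw [H.contract_pair_swap X (Y 1)]
  change _ = ((H.contract X (Y 0)).pair (Y 1)).val x
  ring

variable (φ) in
/-- The `3`-form `d (i_X H)`. -/
def diForm (X : VecField E U) : R := -∑ i, φ (F.halfθ i) * dForm φ F (H.contract X (F.e i))

theorem diForm_linear (hφ : IsFormMap φ) (f g : SmoothFn E U) {X Y Z : VecField E U}
    (h : ∀ x ∈ U, Z.val x = f.val x • X.val x + g.val x • Y.val x) :
    diForm φ F H Z = f • diForm φ F H X + φ f.d * iForm φ F H X
      + (g • diForm φ F H Y + φ g.d * iForm φ F H Y) := by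
  have h1 (i) : φ (F.halfθ i) * dForm φ F (H.contract Z (F.e i)) =
      f • (φ (F.halfθ i) * dForm φ F (H.contract X (F.e i)))
      - φ f.d * (φ (F.halfθ i) * φ (H.contract X (F.e i)))
      + (g • (φ (F.halfθ i) * dForm φ F (H.contract Y (F.e i)))
      - φ g.d * (φ (F.halfθ i) * φ (H.contract Y (F.e i)))) := by
    rw [dForm_linear F hφ f g (fun x hx => H.contract_linear f g h _ hx), mul_add, mul_add, mul_add,
      mul_smul_comm, mul_smul_comm, ← mul_assoc, ← mul_assoc, hφ.anticomm _ f.d,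
      hφ.anticomm _ g.d, neg_mul, neg_mul, mul_assoc, mul_assoc]
    abel
  simp only [diForm, iForm, h1, Finset.sum_add_distrib, Finset.sum_sub_distrib, ← Finset.smul_sum,
    ← Finset.mul_sum, smul_neg]
  abel

/-- The values of `d (i_X H)`. -/
theorem diForm_represents [CompleteSpace E] (X : VecField E U) :
    RepresentsAlt φ pairForm U 3 (diForm φ F H X)
      (fun Y => der (Y 0).val (H.app X.val (Y 1).val (Y 2).val)
        - der (Y 1).val (H.app X.val (Y 0).val (Y 2).val)
        + der (Y 2).val (H.app X.val (Y 0).val (Y 1).val)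
        - H.app X.val (bra (Y 0).val (Y 1).val) (Y 2).val
        + H.app X.val (bra (Y 0).val (Y 2).val) (Y 1).val
        - H.app X.val (bra (Y 1).val (Y 2).val) (Y 0).val) := by
  have h := RepresentsAlt.sum (g := φ) (ev := pairForm) (U := U) Finset.univ
    fun i _ => RepresentsAlt.cons (-F.halfθ i)
      (dForm_represents (φ := φ) F (H.contract X (F.e i)))
  simp only [map_neg, neg_mul, Finset.sum_neg_distrib] at h
  refine h.congr fun Y x hx => ?_
  let h₂ (A B : VecField E U) : SmoothFn E U := (H.contract X A).pair B
  have hrot (A B : VecField E U) (y : M) : ((H.contract B X).pair A).val y = (h₂ A B).val y :=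
    H.contract_pair_rotate B X A y
  have hswap (A B : VecField E U) (y : M) : (h₂ A B).val y = -(h₂ B A).val y :=
    H.contract_pair_swap X A B y
  have hdswap (C A B : VecField E U) : (C.der (h₂ A B)).val x = -(C.der (h₂ B A)).val x := by
    rw [← VecField.der_neg]
    exact C.der_congr (fun y _ => hswap A B y) hx
  have hbra (A B C : VecField E U) : (h₂ (A.bracket B) C).val x = -(h₂ (B.bracket A) C).val x := by
    rw [hswap, hswap (B.bracket A), A.bracket_swap]
    exact congrArg Neg.neg (map_neg ((H.contract X C).val x) _)
  -- This is the coordinate formula for the differential of the form $H(C,X,\cdot)$. It resums the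
  -- terms in which the frame vector stands beside $C$.
  have hsum (A B C : VecField E U) :
      ∑ i, ((A.der (h₂ (F.e i) C)).val x * ((F.θ i).pair B).val x
        - (B.der (h₂ (F.e i) C)).val x * ((F.θ i).pair A).val x) =
      (A.der (h₂ B C)).val x - (B.der (h₂ A C)).val x - (h₂ (A.bracket B) C).val x := by
    have hd (A B : VecField E U) : (A.der ((H.contract C X).pair B)).val x =
      (A.der (h₂ B C)).val x := A.der_congr (fun y _ => hrot B C y) hx
    simpa only [hd, hrot] using F.sum_der (H.contract C X) A B hx
  have hsum' (A C : VecField E U) :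
      ∑ i, (h₂ (F.e i) C).val x * ((F.θ i).pair A).val x = (h₂ A C).val x := by
    simpa only [hrot] using (F.pair_eq (H.contract C X) A hx).symm
  have hneg (i) (A : VecField E U) :
      pairForm (-F.halfθ i) A x = -(2⁻¹ * ((F.θ i).pair A).val x) := rfl
  have h0 := hsum (Y 1) (Y 0) (Y 2)
  have h1 := hsum (Y 0) (Y 2) (Y 1)
  have h2 := hsum (Y 2) (Y 1) (Y 0)
  have h3 := hsum' (Y 0) ((Y 1).bracket (Y 2))
  have h4 := hsum' (Y 1) ((Y 0).bracket (Y 2))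
  have h5 := hsum' (Y 2) ((Y 0).bracket (Y 1))
  simp only [hneg]
  symm
  change ((Y 0).der (h₂ (Y 1) (Y 2))).val x - ((Y 1).der (h₂ (Y 0) (Y 2))).val x
    + ((Y 2).der (h₂ (Y 0) (Y 1))).val x - (h₂ ((Y 0).bracket (Y 1)) (Y 2)).val x
    + (h₂ ((Y 0).bracket (Y 2)) (Y 1)).val x - (h₂ ((Y 1).bracket (Y 2)) (Y 0)).val x =
    ∑ i, (-(2⁻¹ * ((F.θ i).pair (Y 0)).val x) *
      (((Y 1).der (h₂ (F.e i) (Y 2))).val x - ((Y 2).der (h₂ (F.e i) (Y 1))).val x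
        - (h₂ (F.e i) ((Y 1).bracket (Y 2))).val x)
     - -(2⁻¹ * ((F.θ i).pair (Y 1)).val x) *
      (((Y 0).der (h₂ (F.e i) (Y 2))).val x - ((Y 2).der (h₂ (F.e i) (Y 0))).val x
        - (h₂ (F.e i) ((Y 0).bracket (Y 2))).val x)
     + -(2⁻¹ * ((F.θ i).pair (Y 2)).val x) *
      (((Y 0).der (h₂ (F.e i) (Y 1))).val x - ((Y 1).der (h₂ (F.e i) (Y 0))).val x
        - (h₂ (F.e i) ((Y 0).bracket (Y 1))).val x))
  rw [hswap _ ((Y 1).bracket (Y 2))] at h3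
  rw [hswap _ ((Y 0).bracket (Y 2))] at h4
  rw [hswap _ ((Y 0).bracket (Y 1))] at h5
  rw [hbra (Y 1) (Y 0)] at h0
  rw [hdswap (Y 0) (Y 2) (Y 1)] at h1
  rw [hbra (Y 2) (Y 1), hdswap _ (Y 1) (Y 0), hdswap _ (Y 2) (Y 0)] at h2
  -- In this combination each of the three derivative terms and each of the three bracket terms
  -- occurs twice, which cancels the factor $\frac12$ of the halved forms. The sign is the one in
  -- the definition of `diForm`.
  have key := congrArg (-2⁻¹ * ·) (congrArg₂ (· + ·) (congrArg₂ (· + ·) h0 h1)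
    (congrArg₂ (· + ·) h2 (congrArg₂ (· - ·) h4 (congrArg₂ (· + ·) h3 h5))))
  simp only [← Finset.sum_add_distrib, ← Finset.sum_sub_distrib, Finset.mul_sum] at key
  refine Eq.trans ?_ (key.symm.trans (Finset.sum_congr rfl fun i _ => ?_)) <;> ring

end Forms

/-! ### The homological vector field of an exact Courant algebroid -/

section Forms

variable {U : Opens M} {R : Type*} [Ring R] [Algebra (SmoothFn E U) R]
  {φ : OneForm E U →ₗ[SmoothFn E U] R} (F : Frame E U)

theorem dForm_congr (hφ : IsFormMap φ) {α β : OneForm E U} (h : ∀ x ∈ U, α.val x = β.val x) :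
    dForm φ F α = dForm φ F β :=
  Finset.sum_congr rfl fun i _ => congrArg (· * _) <| hφ.congr fun _ hx =>
    SmoothFn.d_congr (fun y hy => congrArg (· ((F.e i).val y)) (h y hy)) hx

/-- Cartan's formula $L_XH=d\,i_XH+i_X\,dH$ with $dH=0$. The equation $dH(X,Y_0,Y_1,Y_2)=0$ is the
difference of the two value formulas once the arguments of $H$ are permuted. -/
theorem diForm_represents_of_closed [CompleteSpace E] {H : ThreeForm E M} (hH : H.Closed)
    (X : VecField E U) :
    RepresentsAlt φ pairForm U 3 (diForm φ F H X)
      (fun Y => der X.val (H.app (Y 0).val (Y 1).val (Y 2).val)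
        - H.app (bra X.val (Y 0).val) (Y 1).val (Y 2).val
        - H.app (Y 0).val (bra X.val (Y 1).val) (Y 2).val
        - H.app (Y 0).val (Y 1).val (bra X.val (Y 2).val)) := by
  refine (diForm_represents F H X).congr fun Y x hx => ?_
  have h := hH U X (Y 0) (Y 1) (Y 2) x hx
  have hs (u v w) : H.val x u v w = -H.val x v u w := H.val_swap_left x u v w
  have hr (u v w) : H.val x u v w = H.val x v w u := H.val_rotate x u v w
  simp only [Pi.add_apply, Pi.sub_apply, ThreeForm.app] at h ⊢
  rw [hs (bra (Y 0).val (Y 1).val x), hs (bra (Y 0).val (Y 2).val x),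
    hs (bra (Y 1).val (Y 2).val x)] at h
  rw [hs ((Y 0).val x) (bra X.val (Y 1).val x), hr ((Y 0).val x), hr ((Y 1).val x)]
  linarith

end Forms

namespace GradedManifold

section

variable {𝓜 : GradedManifold E M} [IsCommon 𝓜] {U V : CoordDomain E M}

theorem isFormMap_formHom : IsFormMap (formHom 𝓜 U) :=
  ⟨formHom_congr, formHom_sq, fun _ h => smul_eq_zero_of_eqOn h⟩

theorem mul_mem_of_eq {k l n : ℕ} {x y : 𝓜.Fn U} (hx : x ∈ 𝓜.homogeneous U k)
    (hy : y ∈ 𝓜.homogeneous U l) (h : k + l = n) : x * y ∈ 𝓜.homogeneous U n :=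
  h ▸ mul_mem hx hy

theorem dForm_mem (F : Frame E U.carrier) (α : OneForm E U.carrier) :
    dForm (formHom 𝓜 U) F α ∈ 𝓜.homogeneous U 2 :=
  sum_mem fun _ _ => mul_mem_of_eq (formHom_mem _) (formHom_mem _) rfl

theorem iForm_mem (F : Frame E U.carrier) (H : ThreeForm E M) (X : VecField E U.carrier) :
    iForm (formHom 𝓜 U) F H X ∈ 𝓜.homogeneous U 2 :=
  sum_mem fun _ _ => mul_mem_of_eq (formHom_mem _) (formHom_mem _) rfl

theorem diForm_mem (F : Frame E U.carrier) (H : ThreeForm E M) (X : VecField E U.carrier) :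
    diForm (formHom 𝓜 U) F H X ∈ 𝓜.homogeneous U 3 :=
  neg_mem (sum_mem fun _ _ => mul_mem_of_eq (formHom_mem _) (dForm_mem _ _) rfl)

theorem res_formHom (h : V.carrier ≤ U.carrier) (α : OneForm E U.carrier) :
    𝓜.res h (formHom 𝓜 U α) = formHom 𝓜 V (α.res h) := 𝓜.res_gen h (.form α)

theorem res_dForm (h : V.carrier ≤ U.carrier) (F : Frame E U.carrier) (α : OneForm E U.carrier) :
    𝓜.res h (dForm (formHom 𝓜 U) F α) = dForm (formHom 𝓜 V) (F.res h) (α.res h) := by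
  simp only [dForm, map_sum, map_mul, res_formHom]
  rfl

theorem res_iForm (h : V.carrier ≤ U.carrier) (F : Frame E U.carrier) (H : ThreeForm E M)
    (X : VecField E U.carrier) :
    𝓜.res h (iForm (formHom 𝓜 U) F H X) = iForm (formHom 𝓜 V) (F.res h) H (X.res h) := by
  simp only [iForm, map_sum, map_mul, res_formHom]
  rfl

theorem res_diForm (h : V.carrier ≤ U.carrier) (F : Frame E U.carrier) (H : ThreeForm E M)
    (X : VecField E U.carrier) :
    𝓜.res h (diForm (formHom 𝓜 U) F H X) = diForm (formHom 𝓜 V) (F.res h) H (X.res h) := by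
  simp only [diForm, map_neg, map_sum, map_mul, res_formHom, res_dForm]
  rfl

end

variable {U V : CoordDomain E M}

-- The derivation `Q_H` over a coordinate domain

local notation "𝓒" => courantManifold E M

theorem mom_twisted (f g : SmoothFn E U.carrier) {X Y Z : VecField E U.carrier}
    (h : ∀ x ∈ U.carrier, Z.val x = f.val x • X.val x + g.val x • Y.val x) :
    gen 𝓒 U (.mom Z) = f • gen 𝓒 U (.mom X) + formHom 𝓒 U f.d * vecHom 𝓒 U X
      + (g • gen 𝓒 U (.mom Y) + formHom 𝓒 U g.d * vecHom 𝓒 U Y) := by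
  simpa [mk_free] using! mk_eq (𝓜 := 𝓒) (CourantRel.mom_twisted f g _ _ X Y Z f.isDiff_d g.isDiff_d h)

/-- The values of `Q_H` on the generators. -/
def courantDer (F : Frame E U.carrier) (H : ThreeForm E M) : Gen (E := E) U.carrier → Fn 𝓒 U
  | .fn f => formHom 𝓒 U f.d
  | .form α => dForm (formHom 𝓒 U) F α
  | .vec X => gen 𝓒 U (.mom X) - iForm (formHom 𝓒 U) F H X
  | .mom X => diForm (formHom 𝓒 U) F H X

theorem courantDer_mem (F : Frame E U.carrier) (H : ThreeForm E M) (a : Gen (E := E) U.carrier) :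
    courantDer F H a ∈ homogeneous 𝓒 U (a.deg + 1) := by
  cases a with
  | fn f => exact formHom_mem _
  | form α => exact dForm_mem _ _
  | vec X =>
    change _ ∈ homogeneous 𝓒 U 2
    exact sub_mem (gen_mem (𝓜 := 𝓒) (.mom X)) (iForm_mem _ _ _)
  | mom X =>
    change _ ∈ homogeneous 𝓒 U 3
    exact diForm_mem _ _ _

/-- The twisted relation is respected because $Q_H(fL_X+df\,i_X)=df\,L_X+f\,d\,i_XH-df\,(L_X-i_XH)$.
The terms $df\,L_X$ cancel, and what remains is $d(f\,i_XH)$. -/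
theorem derMatrix_courantDer [CompleteSpace E] (F : Frame E U.carrier) (H : ThreeForm E M)
    ⦃a b : FreeFn (E := E) U.carrier⦄ (h : CourantRel U.carrier a b) :
    derMatrix (courantDer F H) a = derMatrix (courantDer F H) b := by
  have h' := mk_eq (𝓜 := 𝓒) h
  cases h with
  | of_common h =>
    refine derMatrix_common _ (courantDer_mem F H) (fun _ => rfl) ?_ ?_ h
    · exact fun f g _ _ _ h => dForm_linear F isFormMap_formHom f g h
    · intro f g X Y Z h
      simp only [courantDer]
      rw [mom_twisted f g h, iForm_linear F H isFormMap_formHom f g h, smul_sub, smul_sub]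
      abel
  | mom_twisted f g df dg X Y Z hf hg h =>
    have e1 {f : SmoothFn E U.carrier} {df : OneForm E U.carrier} (hf : IsDiff f df) :
        gen 𝓒 U (.form df) = formHom 𝓒 U f.d := formHom_congr hf
    have e2 {f : SmoothFn E U.carrier} {df : OneForm E U.carrier} (hf : IsDiff f df) :
        dForm (formHom 𝓒 U) F df = 0 :=
      (dForm_congr F isFormMap_formHom (β := f.d) hf).trans (dForm_d F isFormMap_formHom f)
    simp only [mk_free, map_add, map_mul] at h'
    simp only [map_add, map_mul, derMatrix_free, courantDer, e1 hf, e1 hg, e2 hf, e2 hg,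
      diForm_linear F H isFormMap_formHom f g h] at h' ⊢
    ext i j; fin_cases i <;> fin_cases j
    · simp [Gen.deg, h']
      module
    · simp [Gen.deg, fn_smul_def, mul_sub]
      module
    · simp
    · simp [h']

/-- The derivation `Q_H` over a coordinate domain. -/
def courantQ [CompleteSpace E] (F : Frame E U.carrier) (H : ThreeForm E M) : Fn 𝓒 U →ₗ[ℝ] Fn 𝓒 U :=
  derLift (courantDer F H) (derMatrix_courantDer F H)

section

variable [CompleteSpace E] (F : Frame E U.carrier) (H : ThreeForm E M)

theorem isGradedDer_courantQ : IsGradedDer (courantQ F H) := isGradedDer_derLift _ _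

theorem courantQ_gen (a : Gen (E := E) U.carrier) : courantQ F H (gen 𝓒 U a) = courantDer F H a :=
  derLift_gen _ _ a

theorem courantQ_form (α : OneForm E U.carrier) :
    courantQ F H (formHom 𝓒 U α) = dForm (formHom 𝓒 U) F α := courantQ_gen F H (.form α)

theorem courantQ_form_mul (α : OneForm E U.carrier) (x : Fn 𝓒 U) :
    courantQ F H (formHom 𝓒 U α * x) =
      dForm (formHom 𝓒 U) F α * x - formHom 𝓒 U α * courantQ F H x := by
  rw [isGradedDer_courantQ F H 1 _ (formHom_mem α), courantQ_form, pow_one]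
  module

/-- In coordinates $d\alpha$ is a sum of products of exact $1$-forms, and $Q_H$ annihilates each
factor. -/
theorem courantQ_dForm (α : OneForm E U.carrier) :
    courantQ F H (dForm (formHom 𝓒 U) F α) = 0 := by
  simp only [dForm, map_sum, courantQ_form_mul, courantQ_form]
  refine Finset.sum_eq_zero fun i _ => ?_
  change dForm (formHom 𝓒 U) F _ * _ - _ * dForm (formHom 𝓒 U) F _ = 0
  rw [dForm_d F isFormMap_formHom, Frame.θ, dForm_d F isFormMap_formHom, zero_mul, mul_zero,
    sub_zero]

/-- The halved coordinate forms are closed, so $Q_H$ acts on the second factor alone and passes the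
first with a sign, exactly as in the definition of `diForm`. -/
theorem courantQ_iForm (X : VecField E U.carrier) :
    courantQ F H (iForm (formHom 𝓒 U) F H X) = diForm (formHom 𝓒 U) F H X := by
  simp only [iForm, diForm, map_sum, courantQ_form_mul, courantQ_form,
    dForm_halfθ F isFormMap_formHom]
  simp

theorem courantQ_diForm (X : VecField E U.carrier) :
    courantQ F H (diForm (formHom 𝓒 U) F H X) = 0 := by
  simp only [diForm, map_neg, map_sum, courantQ_form_mul, courantQ_dForm,
    dForm_halfθ F isFormMap_formHom]
  simp

theorem courantQ_sq (a : Gen (E := E) U.carrier) :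
    courantQ F H (courantQ F H (gen 𝓒 U a)) = 0 := by
  rw [courantQ_gen]
  cases a with
  | fn f => exact (courantQ_form F H _).trans (dForm_d F isFormMap_formHom f)
  | form α => exact courantQ_dForm F H α
  | vec X =>
    simp only [courantDer, map_sub, courantQ_gen, courantQ_iForm, sub_self]
  | mom X => exact courantQ_diForm F H X

end

/-- The frames on $U$ and $V$ are unrelated. The coordinate formulas still agree, because on $V$
they represent the same intrinsic multilinear maps and these determine the elements. -/
theorem courantQ_natural [CompleteSpace E] {H : ThreeForm E M} (hH : H.Closed)
    (h : V.carrier ≤ U.carrier) (F : Frame E U.carrier) (F' : Frame E V.carrier)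
    (a : Gen (E := E) U.carrier) :
    res 𝓒 h (courantQ F H (gen 𝓒 U a)) = courantQ F' H (gen 𝓒 V (a.res h)) := by
  rw [courantQ_gen, courantQ_gen]
  cases a with
  | fn f => exact res_formHom h _
  | form α =>
    exact (res_dForm h F α).trans (isFormMap_formHom.unique F' (dForm_represents _ _)
      (dForm_represents _ _))
  | vec X =>
    refine (map_sub (res 𝓒 h) _ _).trans (congrArg₂ (· - ·) (res_gen 𝓒 h (.mom X)) ?_)
    exact (res_iForm h F H X).trans (isFormMap_formHom.unique F' (iForm_represents _ _ _)
      (iForm_represents _ _ _))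
  | mom X =>
    exact (res_diForm h F H X).trans (isFormMap_formHom.unique F'
      (diForm_represents_of_closed _ hH _) (diForm_represents_of_closed _ hH _))

end GradedManifold

/-- Coordinates on a coordinate domain. -/
def CoordDomain.frame [FiniteDimensional ℝ E] (U : CoordDomain E M) : Frame E U.carrier :=
  Classical.choice (exists_frame U.exists_chart)

namespace GradedManifold

/-- The homological vector field `Q_H` on `T^*[2]T[1]M`. -/
def courantField [FiniteDimensional ℝ E] {H : ThreeForm E M} (hH : H.Closed) :
    (courantManifold E M).HomologicalField :=
  have : CompleteSpace E := FiniteDimensional.complete ℝ E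
  .ofGen (fun U => courantQ U.frame H) (fun U => isGradedDer_courantQ U.frame H)
    (fun U a => by rw [courantQ_gen]; exact courantDer_mem _ _ _)
    (fun U => courantQ_sq U.frame H) (fun h => courantQ_natural hH h _ _)

theorem courantField_gen [FiniteDimensional ℝ E] {H : ThreeForm E M} (hH : H.Closed)
    (U : CoordDomain E M) (a : Gen (E := E) U.carrier) :
    (courantField hH).Q U (gen _ U a) = courantDer U.frame H a :=
  have : CompleteSpace E := FiniteDimensional.complete ℝ E
  courantQ_gen U.frame H a

end GradedManifold

open GradedManifold

theorem isCourantField_courantField [FiniteDimensional ℝ E] {H : ThreeForm E M} (hH : H.Closed) :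
    IsCourantField H (courantField hH) := by
  have : CompleteSpace E := FiniteDimensional.complete ℝ E
  refine ⟨fun U f => ⟨f.d, f.isDiff_d, courantField_gen hH U _⟩, fun U α => ?_, fun U X => ?_,
    fun U X => ?_⟩
  · rw [courantField_gen]
    exact dForm_represents _ _
  · exact ⟨_, iForm_represents (φ := formHom _ U) U.frame H X, courantField_gen hH U _⟩
  · rw [courantField_gen]
    exact diForm_represents_of_closed _ hH _

theorem IsCourantField.eq_courantDer [CompleteSpace E] {H : ThreeForm E M} (hH : H.Closed)
    {Q : (courantManifold E M).HomologicalField} (hQ : IsCourantField H Q) {U : CoordDomain E M}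
    (F : Frame E U.carrier) (a : Gen (E := E) U.carrier) :
    Q.Q U (gen _ U a) = courantDer F H a := by
  cases a with
  | fn f =>
    obtain ⟨df, hdf, h⟩ := hQ.on_fn U f
    exact h.trans (formHom_congr (β := f.d) hdf)
  | form α => exact isFormMap_formHom.unique F (hQ.on_form U α) (dForm_represents F α)
  | vec X =>
    obtain ⟨w, hw, h⟩ := hQ.on_vec U X
    exact h.trans (congrArg (_ - ·) (isFormMap_formHom.unique F hw (iForm_represents F H X)))
  | mom X =>
    exact isFormMap_formHom.unique F (hQ.on_mom U X) (diForm_represents_of_closed F hH X)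

theorem IsCourantField.eq_courantField [FiniteDimensional ℝ E] {H : ThreeForm E M} (hH : H.Closed)
    {Q : (courantManifold E M).HomologicalField} (hQ : IsCourantField H Q) :
    Q = courantField hH :=
  have : CompleteSpace E := FiniteDimensional.complete ℝ E
  HomologicalField.ext_gen fun U a =>
    (hQ.eq_courantDer hH U.frame a).trans (courantField_gen hH U a).symm

/-! ### The dual connection -/

section DualConnection

variable [FiniteDimensional ℝ E] [T2Space M] (D : Connection E M)
  [CovariantDerivative.ContMDiffCovariantDerivative D ∞] {U V : Opens M} (F : Frame E U)

/-- The dual connection on `TM`: `⟨∇_Y X, m⟩ = Y ⟨X, m⟩ - ⟨X, ∇_Y m⟩`. -/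
def dualNabla (Y X : VecField E U) : VecField E U :=
  ∑ b, (Y.der ((F.θ b).pair X) - (nablaForm D Y (F.θ b)).pair X) • F.e b

/-- The function `Y ⟨X, m⟩ - ⟨X, ∇_Y m⟩`. -/
def dualPair (X Y : VecField E U) (m : OneForm E U) : SmoothFn E U :=
  Y.der (m.pair X) - (nablaForm D Y m).pair X

/-- The derivative of $f$ enters both $Y\langle fm,X\rangle$ and $\langle\nabla_Y(fm),X\rangle$, so
it cancels. This tensoriality in $m$ is what lets the dual connection be defined by its components
in a frame. -/
theorem dualPair_sum_smul {ι : Type*} (s : Finset ι) (X Y : VecField E U) (f : ι → SmoothFn E U)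
    (m : ι → OneForm E U) {x : M} (hx : x ∈ U) :
    (dualPair D X Y (∑ i ∈ s, f i • m i)).val x =
      ∑ i ∈ s, (f i).val x * (dualPair D X Y (m i)).val x := by
  classical
  have hadd (m m' : OneForm E U) : (dualPair D X Y (m + m')).val x =
      (dualPair D X Y m).val x + (dualPair D X Y m').val x := by
    have h1 : ((nablaForm D Y (m + m')).pair X).val x = ((nablaForm D Y m).pair X).val x
        + ((nablaForm D Y m').pair X).val x :=
      congrArg (fun L => L (X.val x)) (nablaForm_add D Y m m' hx)
    have h2 := Y.der_add (m.pair X) (m'.pair X) hx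
    simp only [dualPair, SmoothFn.val_sub, Pi.sub_apply, h1]
    rw [show (m + m').pair X = m.pair X + m'.pair X from rfl, h2]
    ring
  have hsmul (f : SmoothFn E U) (m : OneForm E U) : (dualPair D X Y (f • m)).val x =
      f.val x * (dualPair D X Y m).val x := by
    have h1 : ((nablaForm D Y (f • m)).pair X).val x = f.val x * ((nablaForm D Y m).pair X).val x
        + (Y.der f).val x * (m.pair X).val x :=
      congrArg (fun L => L (X.val x)) (nablaForm_smul D Y f m hx)
    have h2 := Y.der_mul f (m.pair X) hx
    simp only [dualPair, SmoothFn.val_sub, Pi.sub_apply, h1]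
    rw [show (f • m).pair X = f * m.pair X from rfl, h2]
    ring
  induction s using Finset.induction_on with
  | empty =>
    have := hsmul 0 0
    rw [zero_smul] at this
    simpa using this
  | insert a s ha ih => rw [Finset.sum_insert ha, Finset.sum_insert ha, hadd, hsmul, ih]

theorem dualPair_congr (X Y : VecField E U) {m m' : OneForm E U}
    (h : ∀ x ∈ U, m.val x = m'.val x) {x : M} (hx : x ∈ U) :
    (dualPair D X Y m).val x = (dualPair D X Y m').val x := by
  have h1 : ((nablaForm D Y m).pair X).val x = ((nablaForm D Y m').pair X).val x :=
      congrArg (fun L => L (X.val x)) (nablaForm_congr D Y h hx)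
  have h2 := Y.der_congr (f := m.pair X) (g := m'.pair X)
    (fun y hy => congrArg (fun L => L (X.val y)) (h y hy)) hx
  simp only [dualPair, SmoothFn.val_sub, Pi.sub_apply, h1, h2]

/-- Both terms of `dualPair` depend on $Y$ only through its value at $x$, and linearly, so $Y$ may
be expanded in the frame. -/
theorem dualPair_sum (X Y : VecField E U) (m : OneForm E U) {x : M} (hx : x ∈ U) :
    ∑ a, ((F.θ a).pair Y).val x * (dualPair D X (F.e a) m).val x = (dualPair D X Y m).val x := by
  have h1 := F.pair_eq (m.pair X).d Y hx
  have h2 : (nablaForm D Y m).val x (X.val x) =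
      ∑ a, ((F.θ a).pair Y).val x * (nablaForm D (F.e a) m).val x (X.val x) := by
    change D m.val x (Y.val x) (X.val x) = _
    rw [F.vec_eq Y hx, VecField.val_sum]
    refine (congrArg (fun L => L (X.val x)) (map_sum (D m.val x) _ _)).trans ?_
    rw [sum_apply]
    exact Finset.sum_congr rfl fun i _ =>
      congrArg (fun L => L (X.val x)) (map_smul (D m.val x) _ _)
  simp only [dualPair, SmoothFn.val_sub, Pi.sub_apply, OneForm.val_pair_apply _ X, h2, mul_sub,
    Finset.sum_sub_distrib]
  refine congrArg (· - _) (Eq.trans ?_ h1.symm)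
  exact Finset.sum_congr rfl fun i _ => mul_comm _ _

theorem pair_dualNabla (X Y : VecField E U) (m : OneForm E U) {x : M} (hx : x ∈ U) :
    (m.pair (dualNabla D F Y X)).val x = (dualPair D X Y m).val x := by
  rw [dualPair_congr D X Y (fun y hy => F.form_eq m hy) hx, dualPair_sum_smul D _ _ _ _ _ hx,
    dualNabla, OneForm.pair_sum]
  exact Finset.sum_congr rfl fun b _ => (m.pair_smul _ _ _).trans (mul_comm _ _)

end DualConnection

/-! ### The shear defined by the dual connection -/

section Shear

theorem Frame.vec_ext {U : Opens M} (F : Frame E U) {X Y : VecField E U} {x : M} (hx : x ∈ U)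
    (h : ∀ m : OneForm E U, (m.pair X).val x = (m.pair Y).val x) : X.val x = Y.val x := by
  rw [F.vec_eq X hx, F.vec_eq Y hx, VecField.val_sum, VecField.val_sum]
  exact Finset.sum_congr rfl fun i _ => congrArg (· • (F.e i).val x) (h (F.θ i))

variable [FiniteDimensional ℝ E] [T2Space M] (D : Connection E M)
  [CovariantDerivative.ContMDiffCovariantDerivative D ∞] {U V : Opens M} (F : Frame E U)

theorem dualNabla_linear (f g : SmoothFn E U) (W : VecField E U) {X Y Z : VecField E U}
    (h : ∀ x ∈ U, Z.val x = f.val x • X.val x + g.val x • Y.val x) {x : M} (hx : x ∈ U) :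
    (dualNabla D F W Z).val x = (f • dualNabla D F W X + W.der f • X
      + (g • dualNabla D F W Y + W.der g • Y)).val x := by
  refine F.vec_ext hx fun m => ?_
  have hZ (m : OneForm E U) {y : M} (hy : y ∈ U) :
      (m.pair Z).val y = (f * m.pair X + g * m.pair Y).val y :=
    (congrArg (m.val y) (h y hy)).trans (m.pair_add (f • X) (g • Y) y |>.trans
      (congrArg₂ (· + ·) (m.pair_smul f X y) (m.pair_smul g Y y)))
  simp only [OneForm.pair_add, OneForm.pair_smul, pair_dualNabla D F _ _ m hx, dualPair,
    SmoothFn.val_sub, Pi.sub_apply, hZ _ hx, W.der_congr (fun y hy => hZ m hy) hx,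
    VecField.der_add _ _ _ hx, VecField.der_mul _ _ _ hx, SmoothFn.val_add, SmoothFn.val_mul,
    Pi.add_apply, Pi.mul_apply]
  ring

variable {R : Type*} [Ring R] [Algebra (SmoothFn E U) R] (φ : OneForm E U →ₗ[SmoothFn E U] R)
  (ψ : VecField E U →ₗ[SmoothFn E U] R)

/-- The element `∑ dq_a ∇^*_{e_a} X` of the tensor product of `1`-forms and vector fields. -/
def conn (X : VecField E U) : R := ∑ a, φ (F.θ a) * ψ (dualNabla D F (F.e a) X)

variable {φ ψ}

/-- By the Leibniz rule of the dual connection the extra terms are $\sum_a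
(e_af)\,\theta^a\,\psi(X)=df\,\psi(X)$. This is the anomaly of $L_{fX}$, so subtracting `conn` from
$L_X$ leaves a linear expression. -/
theorem conn_linear (hφ : IsFormMap φ)
    (hψ : ∀ {X Y : VecField E U}, (∀ x ∈ U, X.val x = Y.val x) → ψ X = ψ Y)
    (f g : SmoothFn E U) {X Y Z : VecField E U}
    (h : ∀ x ∈ U, Z.val x = f.val x • X.val x + g.val x • Y.val x) :
    conn D F φ ψ Z = f • conn D F φ ψ X + φ f.d * ψ X + (g • conn D F φ ψ Y + φ g.d * ψ Y) := by
  have h1 (a) := hψ (fun x hx => dualNabla_linear D F f g (F.e a) h hx)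
  have h2 (f : SmoothFn E U) : φ f.d = ∑ a, (F.e a).der f • φ (F.θ a) := hφ.expand F f.d
  simp only [conn, h1, h2, map_add, map_smul, mul_add, Finset.sum_add_distrib, Finset.smul_sum,
    Finset.sum_mul, mul_smul_comm, smul_mul_assoc]

theorem conn_represents (X : VecField E U) :
    RepresentsTensor φ ψ pairForm pairVec U (conn D F φ ψ X)
      (fun Y m => (dualPair D X Y m).val) := by
  refine ⟨F.n, F.θ, fun a => dualNabla D F (F.e a) X, rfl, fun Y m x hx => ?_⟩
  refine (dualPair_sum D F X Y m hx).symm.trans ?_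
  exact Finset.sum_congr rfl fun a _ => congrArg (_ * ·) (pair_dualNabla D F X (F.e a) m hx).symm

/-- The values on $Y\otimes m$ are given by `dualPair`, in which no frame occurs. Hence the
isomorphisms built from different coordinates agree on overlaps. -/
theorem conn_eq (hφ : IsFormMap φ)
    (hψ : ∀ {X Y : VecField E U}, (∀ x ∈ U, X.val x = Y.val x) → ψ X = ψ Y) (F F' : Frame E U)
    (X : VecField E U) : conn D F φ ψ X = conn D F' φ ψ X := by
  have hexp (X : VecField E U) : ψ X = ∑ i, (F.θ i).pair X • ψ (F.e i) := by
    rw [hψ (fun x hx => F.vec_eq X hx), map_sum]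
    simp only [map_smul]
  exact RepresentsTensor.unique hφ.smul_eq_zero F.θ F.e (fun α i => α.pair (F.e i))
    (fun _ _ _ _ => rfl) (hφ.expand F) F.e F.θ (fun X i => (F.θ i).pair X)
    (fun _ _ _ _ => rfl) hexp (conn_represents D F X) (conn_represents D F' X)
    (fun _ _ _ _ => rfl)

theorem dualNabla_res (h : V ≤ U) (Y X : VecField E U) (x : M) :
    ((dualNabla D F Y X).res h).val x = (dualNabla D (F.res h) (Y.res h) (X.res h)).val x := by
  change (dualNabla D F Y X).val x = _
  rw [dualNabla, dualNabla, VecField.val_sum, VecField.val_sum]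
  refine Finset.sum_congr rfl fun b _ => ?_
  simp only [VecField.val_smul, Pi.smul_apply', SmoothFn.val_sub]
  rfl

end Shear

namespace GradedManifold

section

variable {𝓜 𝓝 : GradedManifold E M} [IsCommon 𝓜] [IsCommon 𝓝] {U V : CoordDomain E M}

/-- Needed because the shear sends degree $2$ generators to sums that are not generators, so the
commutation relations of the generators do not apply to them directly. -/
theorem homogeneous_comm {k l : ℕ} {x y : 𝓜.Fn U} (hx : x ∈ 𝓜.homogeneous U k)
    (hy : y ∈ 𝓜.homogeneous U l) : x * y = (-1 : ℝ) ^ (k * l) • (y * x) := by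
  refine homogeneous_induction (C := fun l y => x * y = (-1 : ℝ) ^ (k * l) • (y * x))
    ?_ ?_ ?_ ?_ ?_ hy
  · simp
  · intro a l y _ ih
    rw [← mul_assoc, homogeneous_comm_gen hx, smul_mul_assoc, mul_assoc, ih, mul_smul_comm,
      smul_smul, ← mul_assoc, ← pow_add, mul_add]
  · simp
  · exact fun l y z hy hz => by rw [mul_add, hy, hz, add_mul, smul_add]
  · exact fun l c y hy => by rw [mul_smul_comm, hy, smul_mul_assoc, smul_comm]

/-- The map on generators that changes the generators of degree `2` only. -/
def shearGen (t : VecField E U.carrier → 𝓝.Fn U) : Gen (E := E) U.carrier → 𝓝.Fn U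
  | .fn f => 𝓝.gen U (.fn f)
  | .form α => 𝓝.gen U (.form α)
  | .vec X => 𝓝.gen U (.vec X)
  | .mom X => t X

theorem shearGen_mem {t : VecField E U.carrier → 𝓝.Fn U} (ht : ∀ X, t X ∈ 𝓝.homogeneous U 2)
    (a : Gen (E := E) U.carrier) : shearGen t a ∈ 𝓝.homogeneous U a.deg := by
  cases a with
  | fn f => exact gen_mem (𝓜 := 𝓝) (.fn f)
  | form α => exact gen_mem (𝓜 := 𝓝) (.form α)
  | vec X => exact gen_mem (𝓜 := 𝓝) (.vec X)
  | mom X => exact ht X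

theorem shearGen_common {t : VecField E U.carrier → 𝓝.Fn U} (ht : ∀ X, t X ∈ 𝓝.homogeneous U 2)
    {a b : FreeFn (E := E) U.carrier} (h : CommonRel U.carrier a b) :
    FreeAlgebra.lift ℝ (shearGen t) a = FreeAlgebra.lift ℝ (shearGen t) b := by
  have h' := mk_eq (IsCommon.of_common (𝓜 := 𝓝) h)
  cases h with
  | fn_const c f h =>
    rw [AlgHom.commutes] at h' ⊢
    rw [Gen.free, FreeAlgebra.lift_ι_apply]
    exact h'
  | graded_comm a b =>
    simpa only [map_mul, map_smul, Gen.free, FreeAlgebra.lift_ι_apply] using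
      homogeneous_comm (shearGen_mem ht a) (shearGen_mem ht b)
  | _ =>
    simp only [map_add, map_mul, mk_free] at h'
    simpa only [map_add, map_mul, Gen.free, FreeAlgebra.lift_ι_apply, shearGen] using h'

/-- The homomorphism that changes the generators of degree `2` only. -/
def shear (t : VecField E U.carrier → 𝓝.Fn U) (ht : ∀ ⦃a b⦄, 𝓜.rel U.carrier a b →
    FreeAlgebra.lift ℝ (shearGen t) a = FreeAlgebra.lift ℝ (shearGen t) b) : 𝓜.Fn U →ₐ[ℝ] 𝓝.Fn U :=
  RingQuot.liftAlgHom ℝ ⟨FreeAlgebra.lift ℝ (shearGen t), ht⟩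

theorem shear_gen (t : VecField E U.carrier → 𝓝.Fn U) (ht : ∀ ⦃a b⦄, 𝓜.rel U.carrier a b →
    FreeAlgebra.lift ℝ (shearGen t) a = FreeAlgebra.lift ℝ (shearGen t) b)
    (a : Gen (E := E) U.carrier) : shear t ht (𝓜.gen U a) = shearGen t a := by
  rw [shear, ← mk_free, RingQuot.liftAlgHom_mkAlgHom_apply, Gen.free]
  exact FreeAlgebra.lift_ι_apply _ _

/-- A homological vector field transported along an isomorphism of sheaves of graded algebras. -/
def HomologicalField.transport (Q : 𝓜.HomologicalField) (e : ∀ U, 𝓜.Fn U ≃ₐ[ℝ] 𝓝.Fn U)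
    (hdeg : ∀ U k a, a ∈ 𝓜.homogeneous U k ↔ e U a ∈ 𝓝.homogeneous U k)
    (hnat : ∀ {U V : CoordDomain E M} (h : V.carrier ≤ U.carrier) (a : 𝓜.Fn U),
      𝓝.res h (e U a) = e V (𝓜.res h a)) : 𝓝.HomologicalField where
  Q U := (e U).toLinearMap ∘ₗ Q.Q U ∘ₗ (e U).symm.toLinearMap
  degree_one U k a ha :=
    (hdeg U _ _).1 (Q.degree_one U k _ ((hdeg U k _).2 (by simpa using ha)))
  leibniz U k a ha b := by
    have := Q.leibniz U k ((e U).symm a) ((hdeg U k _).2 (by rwa [AlgEquiv.apply_symm_apply]))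
      ((e U).symm b)
    simp [this]
  square_zero U a := by simp [Q.square_zero]
  natural {U V} h a := by
    have : 𝓜.res h ((e U).symm a) = (e V).symm (𝓝.res h a) := by
      rw [AlgEquiv.eq_symm_apply, ← hnat h, AlgEquiv.apply_symm_apply]
    simp [hnat, Q.natural, this]

variable [FiniteDimensional ℝ E] [T2Space M] (D : Connection E M)
  [CovariantDerivative.ContMDiffCovariantDerivative D ∞]

theorem conn_mem (F : Frame E U.carrier) (X : VecField E U.carrier) :
    conn D F (formHom 𝓜 U) (vecHom 𝓜 U) X ∈ 𝓜.homogeneous U 2 :=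
  sum_mem fun _ _ => mul_mem_of_eq (formHom_mem _) (vecHom_mem _) rfl

theorem res_conn (h : V.carrier ≤ U.carrier) (F : Frame E U.carrier) (X : VecField E U.carrier) :
    𝓜.res h (conn D F (formHom 𝓜 U) (vecHom 𝓜 U) X) =
      conn D (F.res h) (formHom 𝓜 V) (vecHom 𝓜 V) (X.res h) := by
  simp only [conn, map_sum, map_mul, res_formHom]
  refine Finset.sum_congr rfl fun a _ => congrArg (_ * ·) ((𝓜.res_gen h (.vec _)).trans ?_)
  exact vecHom_congr fun x _ => dualNabla_res D F h (F.e a) X x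

end

end GradedManifold

/-! ### The isomorphism -/

namespace GradedManifold

local notation "𝓒" => courantManifold E M
local notation "𝓢" => splitManifold E M

section Mom

variable {U V : CoordDomain E M}

theorem mom_linear (f g : SmoothFn E U.carrier) {X Y Z : VecField E U.carrier}
    (h : ∀ x ∈ U.carrier, Z.val x = f.val x • X.val x + g.val x • Y.val x) :
    gen 𝓢 U (.mom Z) = f • gen 𝓢 U (.mom X) + g • gen 𝓢 U (.mom Y) := by
  simpa [mk_free] using! mk_eq (𝓜 := 𝓢) (SplitRel.mom_linear f g X Y Z h)

variable (U) in
/-- Vector fields as functions of degree `2` on the split graded manifold. -/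
def momHom : VecField E U.carrier →ₗ[SmoothFn E U.carrier] Fn 𝓢 U where
  toFun X := gen 𝓢 U (.mom X)
  map_add' X Y := by
    simpa using mom_linear 1 1 (X := X) (Y := Y) (Z := X + Y) (fun x _ => by simp)
  map_smul' f X := by
    simpa using mom_linear f 0 (X := X) (Y := 0) (Z := f • X) (fun x _ => by simp)

theorem momHom_congr {X Y : VecField E U.carrier} (h : ∀ x ∈ U.carrier, X.val x = Y.val x) :
    momHom U X = momHom U Y := by
  simpa using! mom_linear 1 0 (X := Y) (Y := 0) (Z := X) (fun x hx => by simpa using h x hx)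

theorem momHom_expand (F : Frame E U.carrier) (X : VecField E U.carrier) :
    momHom U X = ∑ i, (F.θ i).pair X • momHom U (F.e i) := by
  rw [momHom_congr (fun x hx => F.vec_eq X hx), map_sum]
  simp only [map_smul]

theorem vecHom_expand {𝓜 : GradedManifold E M} [IsCommon 𝓜] (F : Frame E U.carrier)
    (X : VecField E U.carrier) :
    vecHom 𝓜 U X = ∑ i, (F.θ i).pair X • vecHom 𝓜 U (F.e i) := by
  rw [vecHom_congr (fun x hx => F.vec_eq X hx), map_sum]
  simp only [map_smul]

variable [FiniteDimensional ℝ E] [T2Space M] (D : Connection E M)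
  [CovariantDerivative.ContMDiffCovariantDerivative D ∞] (F : Frame E U.carrier)

/-- The isomorphism from the functions on `T^*[2]T[1]M` to those on the split graded manifold. -/
def toSplit : Fn 𝓒 U →ₐ[ℝ] Fn 𝓢 U :=
  shear (fun X => momHom U X + conn D F (formHom 𝓢 U) (vecHom 𝓢 U) X) (by
    intro a b h
    cases h with
    | of_common h =>
      exact shearGen_common (fun X => add_mem (gen_mem (𝓜 := 𝓢) (.mom X)) (conn_mem D F X)) h
    | mom_twisted f g df dg X Y Z hf hg h =>
      simp only [map_add, map_mul, Gen.free, FreeAlgebra.lift_ι_apply, shearGen]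
      have e1 {f : SmoothFn E U.carrier} {df : OneForm E U.carrier} (hf : IsDiff f df) :
        gen 𝓢 U (.form df) = formHom 𝓢 U f.d := formHom_congr hf
      -- The terms $df\,i_X$ and $dg\,i_Y$ of the twisted relation are supplied by `conn`, the
      -- degree $2$ generators of the split manifold being linear.
      have h1 := conn_linear (φ := formHom 𝓢 U) (ψ := vecHom 𝓢 U) D F isFormMap_formHom
        vecHom_congr f g h
      have h2 : momHom U Z = _ := mom_linear f g h
      rw [h1, h2, e1 hf, e1 hg, mul_add, mul_add]
      simp only [fn_smul_def]
      change _ = gen 𝓢 U (.fn f) * gen 𝓢 U (.mom X) + _ +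
        formHom 𝓢 U f.d * vecHom 𝓢 U X + (gen 𝓢 U (.fn g) * gen 𝓢 U (.mom Y) + _ +
        formHom 𝓢 U g.d * vecHom 𝓢 U Y)
      abel)

/-- The inverse isomorphism. -/
def ofSplit : Fn 𝓢 U →ₐ[ℝ] Fn 𝓒 U :=
  shear (fun X => gen 𝓒 U (.mom X) - conn D F (formHom 𝓒 U) (vecHom 𝓒 U) X) (by
    intro a b h
    cases h with
    | of_common h =>
      exact shearGen_common (fun X => sub_mem (gen_mem (𝓜 := 𝓒) (.mom X)) (conn_mem D F X)) h
    | mom_linear f g X Y Z h =>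
      simp only [map_add, map_mul, Gen.free, FreeAlgebra.lift_ι_apply, shearGen]
      have h1 := conn_linear (φ := formHom 𝓒 U) (ψ := vecHom 𝓒 U) D F isFormMap_formHom
        vecHom_congr f g h
      rw [h1, mom_twisted f g h, mul_sub, mul_sub]
      simp only [fn_smul_def]
      abel)

theorem toSplit_gen (a : Gen (E := E) U.carrier) :
    toSplit D F (gen 𝓒 U a) =
      shearGen (fun X => momHom U X + conn D F (formHom 𝓢 U) (vecHom 𝓢 U) X) a :=
  shear_gen _ _ a

theorem ofSplit_gen (a : Gen (E := E) U.carrier) :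
    ofSplit D F (gen 𝓢 U a) =
      shearGen (fun X => gen 𝓒 U (.mom X) - conn D F (formHom 𝓒 U) (vecHom 𝓒 U) X) a :=
  shear_gen _ _ a

theorem toSplit_form (α : OneForm E U.carrier) :
    toSplit D F (formHom 𝓒 U α) = formHom 𝓢 U α := toSplit_gen D F (.form α)

theorem toSplit_vec (X : VecField E U.carrier) :
    toSplit D F (vecHom 𝓒 U X) = vecHom 𝓢 U X := toSplit_gen D F (.vec X)

theorem ofSplit_form (α : OneForm E U.carrier) :
    ofSplit D F (formHom 𝓢 U α) = formHom 𝓒 U α := ofSplit_gen D F (.form α)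

theorem ofSplit_vec (X : VecField E U.carrier) :
    ofSplit D F (vecHom 𝓢 U X) = vecHom 𝓒 U X := ofSplit_gen D F (.vec X)

theorem toSplit_conn (X : VecField E U.carrier) :
    toSplit D F (conn D F (formHom 𝓒 U) (vecHom 𝓒 U) X) =
      conn D F (formHom 𝓢 U) (vecHom 𝓢 U) X := by
  simp only [conn, map_sum, map_mul, toSplit_form, toSplit_vec]

theorem ofSplit_conn (X : VecField E U.carrier) :
    ofSplit D F (conn D F (formHom 𝓢 U) (vecHom 𝓢 U) X) =
      conn D F (formHom 𝓒 U) (vecHom 𝓒 U) X := by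
  simp only [conn, map_sum, map_mul, ofSplit_form, ofSplit_vec]

theorem toSplit_dForm (α : OneForm E U.carrier) :
    toSplit D F (dForm (formHom 𝓒 U) F α) = dForm (formHom 𝓢 U) F α := by
  simp only [dForm, map_sum, map_mul, toSplit_form]

theorem toSplit_iForm (H : ThreeForm E M) (X : VecField E U.carrier) :
    toSplit D F (iForm (formHom 𝓒 U) F H X) = iForm (formHom 𝓢 U) F H X := by
  simp only [iForm, map_sum, map_mul, toSplit_form]

theorem toSplit_diForm (H : ThreeForm E M) (X : VecField E U.carrier) :
    toSplit D F (diForm (formHom 𝓒 U) F H X) = diForm (formHom 𝓢 U) F H X := by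
  simp only [diForm, map_neg, map_sum, map_mul, toSplit_form, toSplit_dForm]

theorem toSplit_mom (X : VecField E U.carrier) :
    toSplit D F (gen 𝓒 U (.mom X)) = momHom U X + conn D F (formHom 𝓢 U) (vecHom 𝓢 U) X :=
  toSplit_gen D F (.mom X)

theorem ofSplit_mom (X : VecField E U.carrier) :
    ofSplit D F (momHom U X) = gen 𝓒 U (.mom X) - conn D F (formHom 𝓒 U) (vecHom 𝓒 U) X :=
  ofSplit_gen D F (.mom X)

theorem toSplit_ofSplit (x : Fn 𝓢 U) : toSplit D F (ofSplit D F x) = x := by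
  refine algHom_ext (F := (toSplit D F).comp (ofSplit D F)) (G := AlgHom.id ℝ _) (fun a => ?_) x
  change toSplit D F (ofSplit D F (gen 𝓢 U a)) = gen 𝓢 U a
  cases a with
  | fn f => rw [ofSplit_gen]; exact toSplit_gen D F (.fn f)
  | form α => rw [ofSplit_gen]; exact toSplit_gen D F (.form α)
  | vec X => rw [ofSplit_gen]; exact toSplit_gen D F (.vec X)
  | mom X =>
    refine (congrArg (toSplit D F) (ofSplit_mom D F X)).trans ?_
    rw [map_sub, toSplit_conn, toSplit_mom, add_sub_cancel_right]
    rfl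

theorem ofSplit_toSplit (x : Fn 𝓒 U) : ofSplit D F (toSplit D F x) = x := by
  refine algHom_ext (F := (ofSplit D F).comp (toSplit D F)) (G := AlgHom.id ℝ _) (fun a => ?_) x
  change ofSplit D F (toSplit D F (gen 𝓒 U a)) = gen 𝓒 U a
  cases a with
  | fn f => rw [toSplit_gen]; exact ofSplit_gen D F (.fn f)
  | form α => rw [toSplit_gen]; exact ofSplit_gen D F (.form α)
  | vec X => rw [toSplit_gen]; exact ofSplit_gen D F (.vec X)
  | mom X => rw [toSplit_mom, map_add, ofSplit_conn, ofSplit_mom, sub_add_cancel]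

/-- The isomorphism over a coordinate domain. -/
def splitEquiv : Fn 𝓒 U ≃ₐ[ℝ] Fn 𝓢 U :=
  AlgEquiv.ofAlgHom (toSplit D F) (ofSplit D F)
    (AlgHom.ext (toSplit_ofSplit D F)) (AlgHom.ext (ofSplit_toSplit D F))

theorem toSplit_mem {k : ℕ} {x : Fn 𝓒 U} (hx : x ∈ homogeneous 𝓒 U k) :
    toSplit D F x ∈ homogeneous 𝓢 U k :=
  map_homogeneous _ (fun a => by
    rw [toSplit_gen]
    exact shearGen_mem
      (fun X => add_mem (gen_mem (𝓜 := 𝓢) (.mom X)) (conn_mem D F X)) a) hx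

theorem ofSplit_mem {k : ℕ} {x : Fn 𝓢 U} (hx : x ∈ homogeneous 𝓢 U k) :
    ofSplit D F x ∈ homogeneous 𝓒 U k :=
  map_homogeneous _ (fun a => by
    rw [ofSplit_gen]
    exact shearGen_mem
      (fun X => sub_mem (gen_mem (𝓜 := 𝓒) (.mom X)) (conn_mem D F X)) a) hx

theorem mem_homogeneous_iff_splitEquiv (k : ℕ) (x : Fn 𝓒 U) :
    x ∈ homogeneous 𝓒 U k ↔ splitEquiv D F x ∈ homogeneous 𝓢 U k :=
  ⟨toSplit_mem D F, fun h => by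
    have := ofSplit_mem D F h
    rwa [show ofSplit D F (splitEquiv D F x) = x from ofSplit_toSplit D F x] at this⟩

/-- The frame on $V$ is arbitrary, as the frames of the coordinate domains are chosen independently
of one another. Independence of `conn` from the frame makes the isomorphisms a map of sheaves. -/
theorem splitEquiv_natural (h : V.carrier ≤ U.carrier) (F' : Frame E V.carrier) (x : Fn 𝓒 U) :
    res 𝓢 h (splitEquiv D F x) = splitEquiv D F' (res 𝓒 h x) := by
  refine algHom_ext (F := (res 𝓢 h).comp (toSplit D F)) (G := (toSplit D F').comp (res 𝓒 h))
    (fun a => ?_) x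
  change res 𝓢 h (toSplit D F (gen 𝓒 U a)) = toSplit D F' (res 𝓒 h (gen 𝓒 U a))
  rw [res_gen, toSplit_gen, toSplit_gen]
  cases a with
  | fn f => exact res_gen 𝓢 h (.fn f)
  | form α => exact res_gen 𝓢 h (.form α)
  | vec X => exact res_gen 𝓢 h (.vec X)
  | mom X =>
    refine (map_add (res 𝓢 h) _ _).trans (congrArg₂ (· + ·) (res_gen 𝓢 h (.mom X)) ?_)
    rw [res_conn]
    exact conn_eq D isFormMap_formHom vecHom_congr _ _ _

end Mom

/-! ### The transported homological vector field and its values -/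

section Field

variable [FiniteDimensional ℝ E] [T2Space M] (D : Connection E M)
  [CovariantDerivative.ContMDiffCovariantDerivative D ∞] {H : ThreeForm E M} (hH : H.Closed)

/-- The homological vector field on the split graded manifold. -/
def splitField : (splitManifold E M).HomologicalField :=
  (courantField hH).transport (fun U => splitEquiv D U.frame)
    (fun U => mem_homogeneous_iff_splitEquiv D U.frame) (fun h => splitEquiv_natural D _ h _)

/-- The isomorphism of NQ-manifolds. -/
def splitIso : NQIso (courantField hH) (splitField D hH) where
  equiv U := splitEquiv D U.frame
  degree U := mem_homogeneous_iff_splitEquiv D U.frame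
  base U f := toSplit_gen D U.frame (.fn f)
  natural h := splitEquiv_natural D _ h _
  intertwines U a :=
    congrArg (fun x => splitEquiv D U.frame ((courantField hH).Q U x))
      ((splitEquiv D U.frame).symm_apply_apply a).symm

theorem splitField_apply (U : CoordDomain E M) (x : Fn 𝓢 U) : (splitField D hH).Q U x =
    toSplit D U.frame ((courantField hH).Q U (ofSplit D U.frame x)) := rfl

theorem splitField_form (U : CoordDomain E M) (α : OneForm E U.carrier) :
    (splitField D hH).Q U (formHom 𝓢 U α) = dForm (formHom 𝓢 U) U.frame α := by
  rw [splitField_apply, ofSplit_form]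
  exact (congrArg _ (courantField_gen hH U (.form α))).trans (toSplit_dForm D _ α)

theorem splitField_vec (U : CoordDomain E M) (X : VecField E U.carrier) :
    (splitField D hH).Q U (vecHom 𝓢 U X) = momHom U X
      + conn D U.frame (formHom 𝓢 U) (vecHom 𝓢 U) X - iForm (formHom 𝓢 U) U.frame H X := by
  rw [splitField_apply, ofSplit_vec]
  refine (congrArg _ (courantField_gen hH U (.vec X))).trans ((map_sub _ _ _).trans ?_)
  rw [toSplit_mom, toSplit_iForm]

/-- The generator pulls back to $L_Z-\sum_a\theta^a\,i_{\nabla^*_{e_a}Z}$. Applying $Q_H$, with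
$\theta^a$ closed and odd, gives
$d\,i_ZH+\sum_a\theta^a\,(L_{\nabla^*_{e_a}Z}-i_{\nabla^*_{e_a}Z}H)$, and carrying this forward
produces a second `conn`. -/
theorem splitField_mom (U : CoordDomain E M) (Z : VecField E U.carrier) :
    (splitField D hH).Q U (momHom U Z) = diForm (formHom 𝓢 U) U.frame H Z +
      ∑ a, formHom 𝓢 U (U.frame.θ a) * (momHom U (dualNabla D U.frame (U.frame.e a) Z)
        + conn D U.frame (formHom 𝓢 U) (vecHom 𝓢 U) (dualNabla D U.frame (U.frame.e a) Z)
        - iForm (formHom 𝓢 U) U.frame H (dualNabla D U.frame (U.frame.e a) Z)) := by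
  have : CompleteSpace E := FiniteDimensional.complete ℝ E
  have h1 (X : VecField E U.carrier) : courantQ U.frame H (vecHom 𝓒 U X) =
    gen 𝓒 U (.mom X) - iForm (formHom 𝓒 U) U.frame H X := courantQ_gen _ _ _
  have h2 : courantQ U.frame H (conn D U.frame (formHom 𝓒 U) (vecHom 𝓒 U) Z) =
      -∑ a, formHom 𝓒 U (U.frame.θ a) *
        (gen 𝓒 U (.mom (dualNabla D U.frame (U.frame.e a) Z))
        - iForm (formHom 𝓒 U) U.frame H (dualNabla D U.frame (U.frame.e a) Z)) := by
    simp only [conn, map_sum, courantQ_form_mul, h1, Frame.θ, dForm_d _ isFormMap_formHom]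
    simp
  rw [splitField_apply, ofSplit_mom]
  change toSplit D U.frame (courantQ U.frame H _) = _
  rw [map_sub, h2, courantQ_gen, sub_neg_eq_add]
  simp only [courantDer, map_add, map_sum, map_mul, map_sub, toSplit_mom, toSplit_iForm,
    toSplit_diForm, toSplit_form]

end Field

end GradedManifold

/-! ### The Chevalley-Eilenberg formulas -/

section Values

variable {U : Opens M}

theorem coPair_form (α : OneForm E U) (a : DSec (E := E) U) (x : M) :
    coPair (α, (0 : VecField E U)) a.val x = (α.pair a.1).val x :=
  (congrArg (_ + ·) (map_zero (a.2.val x))).trans (add_zero _)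

theorem coPair_vec (X : VecField E U) (a : DSec (E := E) U) (x : M) :
    coPair ((0 : OneForm E U), X) a.val x = (a.2.pair X).val x :=
  zero_add _

variable [FiniteDimensional ℝ E] [T2Space M] (D : Connection E M)
  [CovariantDerivative.ContMDiffCovariantDerivative D ∞] (F : Frame E U)

theorem sum_pair_dualNabla (X Y : VecField E U) (m : OneForm E U) {x : M} (hx : x ∈ U) :
    ∑ a, ((F.θ a).pair Y).val x * (m.pair (dualNabla D F (F.e a) X)).val x =
      (dualPair D X Y m).val x :=
  (Finset.sum_congr rfl fun a _ => congrArg (_ * ·) (pair_dualNabla D F X (F.e a) m hx)).trans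
    (dualPair_sum D F X Y m hx)

/-- The curvature in terms of second derivatives with respect to the dual connection. -/
theorem sum_dualPair_dualNabla (X Y Z : VecField E U) (m : OneForm E U) {x : M} (hx : x ∈ U) :
    ∑ a, (((F.θ a).pair X).val x * (dualPair D (dualNabla D F (F.e a) Z) Y m).val x
      - ((F.θ a).pair Y).val x * (dualPair D (dualNabla D F (F.e a) Z) X m).val x) =
      curv D X.val Y.val m.val x (Z.val x) := by
  have : CompleteSpace E := FiniteDimensional.complete ℝ E
  -- This is the form $Y\mapsto\langle m,\nabla^*_YZ\rangle$. Its differential contains the second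
  -- derivatives of $\langle m,Z\rangle$ and the bracket term; the corrections by $\nabla_Xm$ and
  -- $\nabla_Ym$ then leave the curvature of $\nabla$.
  let α : OneForm E U := ∑ a, m.pair (dualNabla D F (F.e a) Z) • F.θ a
  have hα (Y : VecField E U) {y : M} (hy : y ∈ U) :
      (α.pair Y).val y = (dualPair D Z Y m).val y := by
    rw [← sum_pair_dualNabla D F Z Y m hy, OneForm.sum_pair]
    exact Finset.sum_congr rfl fun a _ => mul_comm _ _
  have hαe (Y : VecField E U) (a) : (Y.der (α.pair (F.e a))).val x =
      (Y.der (m.pair (dualNabla D F (F.e a) Z))).val x :=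
    Y.der_congr (fun y hy => (hα _ hy).trans (pair_dualNabla D F Z (F.e a) m hy).symm) hx
  have hαd (Y X : VecField E U) : (Y.der (α.pair X)).val x = (Y.der (dualPair D Z X m)).val x :=
    Y.der_congr (fun y hy => hα _ hy) hx
  have h1 := F.sum_der α X Y hx
  simp only [hαe, hαd, hα _ hx] at h1
  have h2 := sum_pair_dualNabla D F Z X (nablaForm D Y m) hx
  have h3 := sum_pair_dualNabla D F Z Y (nablaForm D X m) hx
  have h4 := VecField.der_bracket X Y (m.pair Z) hx
  have h5 : curv D X.val Y.val m.val x (Z.val x) =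
    ((nablaForm D X (nablaForm D Y m)).pair Z).val x
      - ((nablaForm D Y (nablaForm D X m)).pair Z).val x
      - ((nablaForm D (X.bracket Y) m).pair Z).val x := rfl
  have key := congrArg₂ (· + ·) (congrArg (- ·) h1) (congrArg₂ (· - ·) h3 h2)
  simp only [← Finset.sum_neg_distrib, ← Finset.sum_add_distrib, ← Finset.sum_sub_distrib] at key
  refine Eq.trans (Finset.sum_congr rfl fun a _ => ?_) (key.trans ?_)
  · simp only [dualPair, SmoothFn.val_sub, Pi.sub_apply]
    ring
  · rw [h5]
    simp only [dualPair, VecField.der_sub _ _ _ hx, SmoothFn.val_sub, Pi.sub_apply, h4]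
    ring

/-- By duality $\langle\nabla_Xc_2(Y,W),Z\rangle$ is $X(H(Z,Y,W))$ minus $\langle
c_2(Y,W),\nabla^*_XZ\rangle$. The first terms together with the brackets form $d\,i_ZH$; the others
are contractions of $H$ with derivatives of $Z$. -/
theorem cThree_apply (H : ThreeForm E M) (X Y W Z : VecField E U) {x : M} (hx : x ∈ U) :
    cThree D H X.val Y.val W.val x (Z.val x) =
      der X.val (H.app Z.val Y.val W.val) x - der Y.val (H.app Z.val X.val W.val) x
        + der W.val (H.app Z.val X.val Y.val) x - H.app Z.val (bra X.val Y.val) W.val x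
        + H.app Z.val (bra X.val W.val) Y.val x - H.app Z.val (bra Y.val W.val) X.val x
        - ((dualPair D Z X (H.contract Y W)).val x - (dualPair D Z Y (H.contract X W)).val x
          + (dualPair D Z W (H.contract X Y)).val x) := by
  have : CompleteSpace E := FiniteDimensional.complete ℝ E
  have h1 : cThree D H X.val Y.val W.val x (Z.val x) =
      ((nablaForm D X (H.contract Y W)).pair Z).val x
      + ((nablaForm D Y (H.contract W X)).pair Z).val x
      + ((nablaForm D W (H.contract X Y)).pair Z).val x
      - (((H.contract (X.bracket Y) W).pair Z).val x + ((H.contract (Y.bracket W) X).pair Z).val x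
        + ((H.contract (W.bracket X) Y).pair Z).val x) := rfl
  have h2 (A B C : VecField E U) : (A.der ((H.contract B C).pair Z)).val x =
      der A.val (H.app Z.val B.val C.val) x :=
    A.der_congr (f := (H.contract B C).pair Z) (g := (H.contract Z B).pair C)
      (fun y _ => (H.contract_pair_rotate Z B C y).symm) hx
  have h3 (A B : VecField E U) : ((H.contract A B).pair Z).val x = H.app Z.val A.val B.val x :=
    (H.contract_pair_rotate Z A B x).symm
  have h4 : ((nablaForm D Y (H.contract W X)).pair Z).val x =
      -((nablaForm D Y (H.contract X W)).pair Z).val x := by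
    rw [H.contract_swap W X]
    exact congrArg (fun L => L (Z.val x)) (nablaForm_neg D Y _ hx)
  have h5 : H.app Z.val (W.bracket X).val Y.val x = -H.app Z.val (bra X.val W.val) Y.val x := by
    rw [W.bracket_swap]
    exact (H.val_rotate x _ _ _).trans ((H.val_neg₁ x _ _ _).trans
      (congrArg Neg.neg (H.val_rotate x _ _ _).symm))
  rw [h1, h4, h3, h3, h3, h5]
  simp only [dualPair, SmoothFn.val_sub, Pi.sub_apply, h2]
  change _ - (H.app Z.val (bra X.val Y.val) W.val x + H.app Z.val (bra Y.val W.val) X.val x + _) = _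
  ring

end Values

/-! ### Recognising the brackets of the extension -/

section Represents

variable {U : Opens M} {R : Type*} [Ring R] [Algebra (SmoothFn E U) R]
  {φ : OneForm E U →ₗ[SmoothFn E U] R} {ψ : VecField E U →ₗ[SmoothFn E U] R}

theorem RepresentsAlt.coprod {k : ℕ} {w : R} {Ω : (Fin k → VecField E U) → M → ℝ}
    (h : RepresentsAlt φ pairForm U k w Ω) :
    RepresentsAlt (φ.coprod ψ) (fun s (a : DSec (E := E) U) => coPair s a.val) U k w
      (fun a => Ω fun i => (a i).1) := by
  obtain ⟨r, s, rfl, hs⟩ := h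
  refine ⟨r, fun j i => (s j i, 0), by simp, fun t x hx => ?_⟩
  simp only [coPair_form]
  exact hs _ x hx

variable [FiniteDimensional ℝ E] [T2Space M] (D : Connection E M)
  [CovariantDerivative.ContMDiffCovariantDerivative D ∞] (F : Frame E U) (H : ThreeForm E M)

/-- The element `conn` is read here as a $2$-form on $TM\oplus T^*M$. Its first factor sees only
vector components and its second only covector components, so antisymmetrising yields the two mixed
terms. -/
theorem conn_representsAlt (X : VecField E U) :
    RepresentsAlt (φ.coprod ψ) (fun s (a : DSec (E := E) U) => coPair s a.val) U 2
      (conn D F φ ψ X)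
      (fun a x => (dualPair D X (a 0).1 (a 1).2).val x - (dualPair D X (a 1).1 (a 0).2).val x) := by
  have h := RepresentsAlt.sum (g := φ.coprod ψ)
    (ev := fun s (a : DSec (E := E) U) => coPair s a.val) (U := U) Finset.univ
    fun a _ => RepresentsAlt.mul_two (F.θ a, 0) (0, dualNabla D F (F.e a) X)
  simp only [LinearMap.coprod_apply, map_zero, add_zero, zero_add, coPair_form, coPair_vec,
    Finset.sum_sub_distrib] at h
  exact h.congr fun t x hx => by
    rw [sum_pair_dualNabla D F X _ _ hx, sum_pair_dualNabla D F X _ _ hx]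

/-- The form part gives the Lie bracket term, `conn` the two covariant derivatives, and the
contraction of $H$ gives $c_2$. The minus sign before $i_XH$ is carried by the vector field. -/
theorem degree_one_represents (s : CoSec (E := E) U) :
    RepresentsAlt (φ.coprod ψ) (fun s (a : DSec (E := E) U) => coPair s a.val) U 2
      (dForm φ F s.1 + conn D F φ ψ s.2 + iForm φ F H (-s.2))
      (fun a => der (a 0).1.val (coPair s (a 1).val) - der (a 1).1.val (coPair s (a 0).val)
          - coPair s ((extensionBrackets D (cTwo H) (cThree D H)).l₂ (a 0).val (a 1).val)) := by
  have : CompleteSpace E := FiniteDimensional.complete ℝ E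
  refine (((dForm_represents F s.1).coprod.add (conn_representsAlt D F s.2)).add
    (iForm_represents F H (-s.2)).coprod).congr fun a x hx => ?_
  have h1 (Y : VecField E U) (a : DSec (E := E) U) : der Y.val (coPair s a.val) x =
      (Y.der (s.1.pair a.1)).val x + (Y.der (a.2.pair s.2)).val x :=
    Y.der_add (s.1.pair a.1) (a.2.pair s.2) hx
  have h2 : H.app (-s.2).val (a 0).1.val (a 1).1.val x =
      -((H.contract (a 0).1 (a 1).1).pair s.2).val x :=
    (H.val_neg₁ x _ _ _).trans (congrArg Neg.neg (H.val_rotate x _ _ _))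
  have h3 : coPair s ((extensionBrackets D (cTwo H) (cThree D H)).l₂ (a 0).val (a 1).val) x =
      (s.1.pair ((a 0).1.bracket (a 1).1)).val x + (((nablaForm D (a 0).1 (a 1).2).pair s.2).val x
        - ((nablaForm D (a 1).1 (a 0).2).pair s.2).val x
        + ((H.contract (a 0).1 (a 1).1).pair s.2).val x) := rfl
  simp only [Pi.sub_apply, h1, h2, h3, dualPair, SmoothFn.val_sub]
  change ((a 0).1.der (s.1.pair (a 1).1)).val x - ((a 1).1.der (s.1.pair (a 0).1)).val x
    - (s.1.pair ((a 0).1.bracket (a 1).1)).val x + _ + _ = _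
  ring

/-- The middle sum is the square of the dual connection on $Z$ and contributes the three curvature
terms. The outer two combine to $c_3$ by `cThree_apply`. -/
theorem degree_two_represents (Z : VecField E U) :
    RepresentsAlt (φ.coprod ψ) (fun s (a : DSec (E := E) U) => coPair s a.val) U 3
      (diForm φ F H Z + ∑ a, φ (F.θ a) * conn D F φ ψ (dualNabla D F (F.e a) Z)
        - ∑ a, φ (F.θ a) * iForm φ F H (dualNabla D F (F.e a) Z))
      (fun a x => (extensionBrackets D (cTwo H) (cThree D H)).l₃ (a 0).val (a 1).val (a 2).val x
        (Z.val x)) := by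
  have : CompleteSpace E := FiniteDimensional.complete ℝ E
  have h1 := (diForm_represents (φ := φ) F H Z).coprod (ψ := ψ)
  have h2 := RepresentsAlt.sum (U := U) Finset.univ fun a _ => RepresentsAlt.cons
    (g := φ.coprod ψ) (ev := fun s (a : DSec (E := E) U) => coPair s a.val)
    (F.θ a, (0 : VecField E U)) (conn_representsAlt D F (dualNabla D F (F.e a) Z))
  have h3 := RepresentsAlt.sum (U := U) Finset.univ fun a _ => RepresentsAlt.cons
    (g := φ.coprod ψ) (ev := fun s (a : DSec (E := E) U) => coPair s a.val)
    (-F.θ a, (0 : VecField E U)) (iForm_represents (φ := φ) F H (dualNabla D F (F.e a) Z)).coprod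
  simp only [LinearMap.coprod_apply, map_zero, add_zero, coPair_form] at h2 h3
  simp only [map_neg, neg_mul, Finset.sum_neg_distrib] at h3
  rw [sub_eq_add_neg]
  refine ((h1.add h2).add h3).congr fun a x hx => ?_
  have e1 : (extensionBrackets D (cTwo H) (cThree D H)).l₃ (a 0).val (a 1).val (a 2).val x
      (Z.val x) = cThree D H (a 0).1.val (a 1).1.val (a 2).1.val x (Z.val x)
      + curv D (a 0).1.val (a 1).1.val (a 2).2.val x (Z.val x)
      + curv D (a 1).1.val (a 2).1.val (a 0).2.val x (Z.val x)
      + curv D (a 2).1.val (a 0).1.val (a 1).2.val x (Z.val x) := rfl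
  have e2 (A B C : VecField E U) :
      ∑ i, ((-F.θ i).pair A).val x * H.app (dualNabla D F (F.e i) Z).val B.val C.val x =
      -(dualPair D Z A (H.contract B C)).val x := by
    rw [← sum_pair_dualNabla D F Z A _ hx, ← Finset.sum_neg_distrib]
    refine Finset.sum_congr rfl fun i _ => ?_
    rw [← H.contract_pair_rotate]
    exact neg_mul _ _
  rw [e1, cThree_apply D H _ _ _ _ hx, ← sum_dualPair_dualNabla D F _ _ _ _ hx,
    ← sum_dualPair_dualNabla D F _ _ _ _ hx, ← sum_dualPair_dualNabla D F _ _ _ _ hx]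
  let P (i : Fin F.n) (A : VecField E U) (m : OneForm E U) : ℝ :=
    (dualPair D (dualNabla D F (F.e i) Z) A m).val x
  let T (i : Fin F.n) (A : VecField E U) : ℝ := ((F.θ i).pair A).val x
  let N (i : Fin F.n) (A : VecField E U) : ℝ := ((-F.θ i).pair A).val x
  let G (i : Fin F.n) (A B : VecField E U) : ℝ :=
    H.app (dualNabla D F (F.e i) Z).val A.val B.val x
  -- The shuffle expansion is regrouped according to which argument supplies the covector. Each
  -- group is then one of the curvature sums.
  have e6 : ∑ i, (T i (a 0).1 * (P i (a 1).1 (a 2).2 - P i (a 2).1 (a 1).2)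
      - T i (a 1).1 * (P i (a 0).1 (a 2).2 - P i (a 2).1 (a 0).2)
      + T i (a 2).1 * (P i (a 0).1 (a 1).2 - P i (a 1).1 (a 0).2)) =
      ∑ i, (T i (a 0).1 * P i (a 1).1 (a 2).2 - T i (a 1).1 * P i (a 0).1 (a 2).2)
      + ∑ i, (T i (a 1).1 * P i (a 2).1 (a 0).2 - T i (a 2).1 * P i (a 1).1 (a 0).2)
      + ∑ i, (T i (a 2).1 * P i (a 0).1 (a 1).2 - T i (a 0).1 * P i (a 2).1 (a 1).2) := by
    simp only [← Finset.sum_add_distrib]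
    exact Finset.sum_congr rfl fun i _ => by ring
  have e7 : ∑ i, (N i (a 0).1 * G i (a 1).1 (a 2).1 - N i (a 1).1 * G i (a 0).1 (a 2).1
      + N i (a 2).1 * G i (a 0).1 (a 1).1) =
      -(dualPair D Z (a 0).1 (H.contract (a 1).1 (a 2).1)).val x
      - -(dualPair D Z (a 1).1 (H.contract (a 0).1 (a 2).1)).val x
      + -(dualPair D Z (a 2).1 (H.contract (a 0).1 (a 1).1)).val x := by
    rw [← e2, ← e2, ← e2, Finset.sum_add_distrib, Finset.sum_sub_distrib]
  refine (congrArg₂ (· + ·) (congrArg (_ + ·) e6) e7).trans ?_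
  simp only [T, P, Pi.add_apply, Pi.sub_apply]
  ring

end Represents

open GradedManifold

/-! ### Uniqueness on the split manifold and the Chevalley-Eilenberg property -/

section Split

local notation "𝓢" => splitManifold E M

theorem Frame.form_ext {U : Opens M} (F : Frame E U) {α β : OneForm E U} {x : M} (hx : x ∈ U)
    (h : ∀ Y : VecField E U, (α.pair Y).val x = (β.pair Y).val x) : α.val x = β.val x := by
  rw [F.form_eq α hx, F.form_eq β hx, OneForm.val_sum, OneForm.val_sum]
  exact Finset.sum_congr rfl fun i _ => congrArg (· • (F.θ i).val x) (h (F.e i))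

variable {U : CoordDomain E M}

theorem vecHom_sq {𝓜 : GradedManifold E M} [IsCommon 𝓜] (X : VecField E U.carrier) :
    vecHom 𝓜 U X * vecHom 𝓜 U X = 0 := eq_zero_of_eq_neg (vecHom_anticomm X X)

variable (U) in
/-- Sections of `(TM ⊕ T^*M)^*` as functions of degree `1`. -/
def coHom : CoSec (E := E) U.carrier →ₗ[SmoothFn E U.carrier] Fn 𝓢 U :=
  (formHom 𝓢 U).coprod (vecHom 𝓢 U)

theorem coHom_apply (s : CoSec (E := E) U.carrier) :
    coHom U s = formHom 𝓢 U s.1 + vecHom 𝓢 U s.2 := rfl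

theorem coHom_sq (s : CoSec (E := E) U.carrier) : coHom U s * coHom U s = 0 := by
  rw [coHom_apply, mul_add, add_mul, add_mul, formHom_sq, vecHom_sq, formHom_vecHom_anticomm]
  abel

/-- A frame of `(TM ⊕ T^*M)^*`. -/
def coFrame (F : Frame E U.carrier) : Fin F.n ⊕ Fin F.n → CoSec (E := E) U.carrier :=
  Sum.elim (fun i => (F.θ i, 0)) (fun i => (0, F.e i))

/-- The dual frame of `TM ⊕ T^*M`. -/
def dFrame (F : Frame E U.carrier) : Fin F.n ⊕ Fin F.n → DSec (E := E) U.carrier :=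
  Sum.elim (fun i => (F.e i, 0)) (fun i => (0, F.θ i))

/-- The components of a section of `(TM ⊕ T^*M)^*`. -/
def coComp (F : Frame E U.carrier) (s : CoSec (E := E) U.carrier) :
    Fin F.n ⊕ Fin F.n → SmoothFn E U.carrier :=
  Sum.elim (fun i => s.1.pair (F.e i)) (fun i => (F.θ i).pair s.2)

theorem coComp_val (F : Frame E U.carrier) (s : CoSec (E := E) U.carrier)
    (i : Fin F.n ⊕ Fin F.n) (x : M) :
    (coComp F s i).val x = coPair s (dFrame F i).val x := by
  cases i with
  | inl i => exact (add_zero _).symm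
  | inr i => exact (zero_add _).symm.trans (congrArg (· + _) (map_zero (s.1.val x)).symm)

theorem coHom_expand (F : Frame E U.carrier) (s : CoSec (E := E) U.carrier) :
    coHom U s = ∑ i, coComp F s i • coHom U (coFrame F i) := by
  rw [Fintype.sum_sum_type]
  simp only [coComp, coFrame, Sum.elim_inl, Sum.elim_inr, coHom_apply, map_zero, add_zero,
    zero_add]
  rw [← isFormMap_formHom.expand F, ← vecHom_expand F]

theorem coHom_unique (F : Frame E U.carrier) {k : ℕ} {w w' : Fn 𝓢 U}
    {Ω : (Fin k → DSec (E := E) U.carrier) → M → ℝ}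
    (hw : RepresentsAlt (coHom U) (fun s (a : DSec (E := E) U.carrier) => coPair s a.val)
      U.carrier k w Ω)
    (hw' : RepresentsAlt (coHom U) (fun s (a : DSec (E := E) U.carrier) => coPair s a.val)
      U.carrier k w' Ω) : w = w' :=
  RepresentsAlt.unique coHom_sq (fun _ h => smul_eq_zero_of_eqOn h) (coFrame F) (dFrame F)
    (coComp F) (fun s i x _ => coComp_val F s i x) (coHom_expand F) hw hw' (fun _ _ _ => rfl)

theorem coHom_momHom_unique (F : Frame E U.carrier) {w w' : Fn 𝓢 U}
    {Ω : DSec (E := E) U.carrier → OneForm E U.carrier → M → ℝ}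
    (hw : RepresentsTensor (coHom U) (momHom U)
      (fun s (a : DSec (E := E) U.carrier) => coPair s a.val) pairVec U.carrier w Ω)
    (hw' : RepresentsTensor (coHom U) (momHom U)
      (fun s (a : DSec (E := E) U.carrier) => coPair s a.val) pairVec U.carrier w' Ω) : w = w' :=
  RepresentsTensor.unique (fun _ h => smul_eq_zero_of_eqOn h) (coFrame F) (dFrame F)
    (coComp F) (fun s i x _ => coComp_val F s i x) (coHom_expand F) F.e F.θ
    (fun X i => (F.θ i).pair X) (fun _ _ _ _ => rfl) (momHom_expand F) hw hw' (fun _ _ _ _ => rfl)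

/-- Each formula prescribes $Q$ of a generator as a sum of pieces, and every piece is separately
fixed by its pairings with sections. Two solutions therefore agree on generators, hence everywhere.
-/
theorem IsChevalleyEilenberg.unique [FiniteDimensional ℝ E] {L : Brackets E M}
    {Q Q' : (splitManifold E M).HomologicalField} (hQ : IsChevalleyEilenberg L Q)
    (hQ' : IsChevalleyEilenberg L Q') : Q = Q' := by
  refine HomologicalField.ext_gen fun U a => ?_
  have hco (s : CoSec (E := E) U.carrier) : Q.Q U (coHom U s) = Q'.Q U (coHom U s) := by
    obtain ⟨w, Z, hw, hZ, h⟩ := hQ.on_degree_one U s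
    obtain ⟨w', Z', hw', hZ', h'⟩ := hQ'.on_degree_one U s
    refine h.trans (Eq.trans ?_ h'.symm)
    refine congrArg₂ (· + ·) (coHom_unique U.frame hw hw') (momHom_congr fun x hx => ?_)
    exact U.frame.vec_ext hx fun m => (hZ m x hx).trans (hZ' m x hx).symm
  cases a with
  | fn f =>
    obtain ⟨s, hs, h⟩ := hQ.on_fn U f
    obtain ⟨s', hs', h'⟩ := hQ'.on_fn U f
    refine h.trans (Eq.trans ?_ h'.symm)
    have hss (a : DSec (E := E) U.carrier) {x : M} (hx : x ∈ U.carrier) :=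
      (hs a x hx).trans (hs' a x hx).symm
    refine congrArg₂ (· + ·) (formHom_congr fun x hx => ?_) (vecHom_congr fun x hx => ?_)
    · refine U.frame.form_ext hx fun Y => ?_
      simpa [coPair, DSec.val] using hss (Y, 0) hx
    · refine U.frame.vec_ext hx fun m => ?_
      simpa [coPair, DSec.val] using hss (0, m) hx
  | form α =>
    have := hco (α, 0)
    rwa [coHom_apply, map_zero, add_zero] at this
  | vec X =>
    have := hco (0, X)
    rwa [coHom_apply, map_zero, zero_add] at this
  | mom Z =>
    obtain ⟨w, v, hw, hv, h⟩ := hQ.on_degree_two U Z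
    obtain ⟨w', v', hw', hv', h'⟩ := hQ'.on_degree_two U Z
    exact h.trans ((congrArg₂ (· + ·) (coHom_unique U.frame hw hw')
      (coHom_momHom_unique U.frame hv hv')).trans h'.symm)

theorem isChevalleyEilenberg_splitField [FiniteDimensional ℝ E] [T2Space M] (D : Connection E M)
    [CovariantDerivative.ContMDiffCovariantDerivative D ∞] {H : ThreeForm E M} (hH : H.Closed) :
    IsChevalleyEilenberg (extensionBrackets D (cTwo H) (cThree D H)) (splitField D hH) := by
  have : CompleteSpace E := FiniteDimensional.complete ℝ E
  refine ⟨fun U f => ⟨(f.d, 0), fun a x _ => coPair_form f.d a x, ?_⟩, fun U s => ?_,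
    fun U Z => ?_⟩
  · rw [splitField_apply, ofSplit_gen]
    refine (congrArg _ (courantField_gen hH U (.fn f))).trans ((toSplit_form D _ _).trans ?_)
    change _ = coHom U (f.d, 0)
    rw [coHom_apply, map_zero, add_zero]
  · refine ⟨_, s.2, degree_one_represents (φ := formHom 𝓢 U) (ψ := vecHom 𝓢 U) D U.frame H s,
      fun m x _ => (zero_add _).symm.trans (congrArg (· + _) (map_zero (s.1.val x)).symm), ?_⟩
    change (splitField D hH).Q U (coHom U s) = _ + momHom U s.2
    have h : iForm (formHom 𝓢 U) U.frame H (-s.2) = -iForm (formHom 𝓢 U) U.frame H s.2 := by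
      rw [iForm_linear U.frame H isFormMap_formHom (-1) 0 (X := s.2) (Y := 0)
        (fun x _ => by simp)]
      module
    rw [coHom_apply, map_add, splitField_form, splitField_vec, h]
    abel
  -- The value of $Q$ on a degree $2$ generator is split by type. The products of a form with a
  -- degree $2$ generator make up the tensor part and encode $\nabla$ acting on $A_{-1}$; everything
  -- else is a $3$-form on $A_0$.
  · refine ⟨_, ∑ a, formHom 𝓢 U (U.frame.θ a) *
      momHom U (dualNabla D U.frame (U.frame.e a) Z), degree_two_represents (φ := formHom 𝓢 U) (ψ := vecHom 𝓢 U) D U.frame H Z,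
      ⟨U.frame.n, fun a => (U.frame.θ a, 0), fun a => dualNabla D U.frame (U.frame.e a) Z,
        Finset.sum_congr rfl fun a _ => ?_, fun Y m x hx => ?_⟩, ?_⟩
    · change _ = coHom U (U.frame.θ a, 0) * momHom U _
      rw [coHom_apply, map_zero, add_zero]
    · simp only [coPair_form]
      exact (sum_pair_dualNabla D U.frame Z Y.1 m hx).symm
    · refine (splitField_mom D hH U Z).trans ?_
      simp only [mul_add, mul_sub, Finset.sum_add_distrib, Finset.sum_sub_distrib]
      abel

end Split

end CourantExt

end

/-! ### The proposition -/

open CourantExt GradedManifold in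
theorem mainTheorem5
    {E : Type*} [NormedAddCommGroup E] [NormedSpace ℝ E] [FiniteDimensional ℝ E]
    {M : Type*} [TopologicalSpace M] [ChartedSpace E M] [IsManifold 𝓘(ℝ, E) ∞ M]
    [T2Space M] [SecondCountableTopology M]
    (H : ThreeForm E M) (hH : H.Closed)
    (D : Connection E M) [CovariantDerivative.ContMDiffCovariantDerivative D ∞] :
    IsTwoCocycle D (cTwo H) (cThree D H) ∧
    ∃ (QC : (courantManifold E M).HomologicalField) (QE : (splitManifold E M).HomologicalField),
      (IsCourantField H QC ∧ ∀ Q', IsCourantField H Q' → Q' = QC) ∧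
      (IsChevalleyEilenberg (extensionBrackets D (cTwo H) (cThree D H)) QE ∧
        ∀ Q', IsChevalleyEilenberg (extensionBrackets D (cTwo H) (cThree D H)) Q' → Q' = QE) ∧
      ∃ Φ : NQIso QC QE, ∀ U (α : OneForm E U.carrier),
        Φ.equiv U ((courantManifold E M).gen U (.form α)) =
          (splitManifold E M).gen U (.form α) :=
  ⟨isTwoCocycle_cTwo D H, courantField hH, splitField D hH,
    ⟨isCourantField_courantField hH, fun _ hQ => hQ.eq_courantField hH⟩,
    ⟨isChevalleyEilenberg_splitField D hH,
      fun _ hQ => hQ.unique (isChevalleyEilenberg_splitField D hH)⟩,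
    splitIso D hH, fun U α => toSplit_form D U.frame α⟩
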